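/- Let $\kappa,d>0$. Consider solutions $(\phi,a)$ on $[-d,d]$, with $\phi>0$ and $h>0$, of the Ginzburg--Landau problem $$\phi''=\kappa^2\phi(\phi^2+a^2-1),\qquad a''=\phi^2a,\qquad \phi'(\pm d)=0,\quad a'(\pm d)=h. \tag{GL}$$ A solution is symmetric if $\phi$ is even and $a$ is odd, and asymmetric otherwise. With $\phi=\alpha\psi$, $\alpha=\phi(-d)$, the problem becomes $$\psi''=\kappa^2(\alpha^2\psi^2+a^2-1)\psi,\quad a''=\alpha^2\psi^2a,\quad \psi(-d)=1,\ \psi'(\pm d)=0,\ a'(\pm d)=h. \tag{S}$$ For $c\in\mathbb R$ let $h(c)>0$ be the unique $h>0$ for which the linear problem $$\psi_0''=\kappa^2(h^2(x+c)^2-1)\psi_0,\qquad \psi_0(-d)=1,\quad \psi_0'(\pm d)=0$$ has a positive solution $\psi_0$ on $[-d,d]$ (which is then unique), and let $I(c)=\int_{-d}^{d}(x+c)\psi_0(x)^2\,dx$. Both depend on $(\kappa,d)$. (i) For all $\kappa,d>0$ symmetric solutions bifurcate from the normal state: there are $\alpha_0>0$ and a family $(h_\alpha,\phi_\alpha,a_\alpha)$,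 $0\le\alpha<\alpha_0$, continuous in $\alpha$ (uniformly on $[-d,d]$), such that $h_0=h(0)$, $\phi_0=0$, $a_0(x)=h(0)x$, and for $0<\alpha<\alpha_0$ the pair $(\phi_\alpha,a_\alpha)$ is a symmetric solution of (GL) with $h=h_\alpha$ and $\phi_\alpha(-d)=\alpha$. (ii) There are constants $K$ and $k>0$ such that whenever $\kappa d>K$ or $\kappa d<k$ there are $\delta>0$ and $\alpha_0>0$ (depending on $\kappa,d$) such that for every $\alpha\in(0,\alpha_0)$ the problem (S) has exactly one solution $(\psi,a,h)$ with $\psi>0$, $h>0$ and $|h-h(0)|<\delta$, and this solution is symmetric. (iii) Let $t\mapsto(\kappa(t),d(t))$, $t\in[0,1]$, be a real analytic curve in $(0,\infty)^2$ such that $I'(0)<0$ for $(\kappa,d)=(\kappa(0),d(0))$ and $I'(0)>0$ for $(\kappa,d)=(\kappa(1),d(1))$. Then there is $t_0\in(0,1)$ such that, with $\tilde h_0$ the value $h(0)$ belonging to $(\kappa(t_0),d(t_0))$, for every $\varepsilon>0$ there are $t\in(0,1)$ and $h>0$ with $|t-t_0|$, $|\kappa(t)-\kappa(t_0)|$, $|d(t)-d(t_0)|$,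 $|h-\tilde h_0|<\varepsilon$, and an asymmetric solution $(\phi,a)$ of (GL) for $(\kappa(t),d(t),h)$ that is within $\varepsilon$ of $(0,\tilde h_0x)$ in the $C^1$ norm on $[-d(t),d(t)]$ (that is, each of $|\phi|$, $|\phi'|$, $|a-\tilde h_0x|$, $|a'-\tilde h_0|$ is less than $\varepsilon$ there) and is nearly symmetric: $|\phi(-x)-\phi(x)|<\varepsilon\,\phi(-d(t))$ and $|a(-x)+a(x)|<\varepsilon$ for $|x|\le d(t)$. -/

import Mathlib

namespace GinzburgLandau

/-- Derivative of a function on the slab `[-d, d]` (one-sided at the two ends). -/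
noncomputable def slabDeriv (d : ℝ) (f : ℝ → ℝ) : ℝ → ℝ :=
  derivWithin f (Set.Icc (-d) d)

/-- `f` is twice differentiable on `[-d, d]` and `f'' = F` there. -/
def HasSecondDeriv (d : ℝ) (f F : ℝ → ℝ) : Prop :=
  DifferentiableOn ℝ f (Set.Icc (-d) d) ∧
    ∀ x ∈ Set.Icc (-d) d, HasDerivWithinAt (slabDeriv d f) (F x) (Set.Icc (-d) d) x

/-- `(φ, a)` is a (physical, i.e. `φ > 0` and `h > 0`) solution of the Ginzburg-Landau boundary
value problem `φ'' = κ² φ (φ² + a² - 1)`, `a'' = φ² a`, `φ'(± d) = 0`, `a'(± d) = h`. -/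
structure IsSolution (κ d h : ℝ) (φ a : ℝ → ℝ) : Prop where
  field_pos : 0 < h
  pos : ∀ x ∈ Set.Icc (-d) d, 0 < φ x
  eq_phi : HasSecondDeriv d φ fun x => κ ^ 2 * φ x * (φ x ^ 2 + a x ^ 2 - 1)
  eq_a : HasSecondDeriv d a fun x => φ x ^ 2 * a x
  phi_left : slabDeriv d φ (-d) = 0
  phi_right : slabDeriv d φ d = 0
  a_left : slabDeriv d a (-d) = h
  a_right : slabDeriv d a d = h

/-- `(ψ, a)` is a solution of the problem obtained by the substitution `φ = α ψ`,
`α = φ(-d)`:  `ψ'' = κ² (α² ψ² + a² - 1) ψ`, `a'' = α² ψ² a`,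
`ψ(-d) = 1`, `ψ'(± d) = 0`, `a'(± d) = h` (again with `ψ > 0` and `h > 0`). -/
structure IsScaledSolution (κ d α h : ℝ) (ψ a : ℝ → ℝ) : Prop where
  field_pos : 0 < h
  pos : ∀ x ∈ Set.Icc (-d) d, 0 < ψ x
  eq_psi : HasSecondDeriv d ψ fun x => κ ^ 2 * (α ^ 2 * ψ x ^ 2 + a x ^ 2 - 1) * ψ x
  eq_a : HasSecondDeriv d a fun x => α ^ 2 * ψ x ^ 2 * a x
  psi_init : ψ (-d) = 1
  psi_left : slabDeriv d ψ (-d) = 0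
  psi_right : slabDeriv d ψ d = 0
  a_left : slabDeriv d a (-d) = h
  a_right : slabDeriv d a d = h

/-- Symmetric pairs: the order parameter is even and the potential is odd on `[-d, d]`.
A solution is asymmetric when it is not symmetric. -/
def IsSymmetric (d : ℝ) (φ a : ℝ → ℝ) : Prop :=
  ∀ x ∈ Set.Icc (-d) d, φ (-x) = φ x ∧ a (-x) = -a x

/-- `ψ` is a positive solution of the problem linearized at the normal state `(0, h (x + c))`:
`ψ'' = κ² (h² (x + c)² - 1) ψ`, `ψ(-d) = 1`, `ψ'(± d) = 0`. -/
structure IsNormalMode (κ d c h : ℝ) (ψ : ℝ → ℝ) : Prop where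
  pos : ∀ x ∈ Set.Icc (-d) d, 0 < ψ x
  eq_psi : HasSecondDeriv d ψ fun x => κ ^ 2 * (h ^ 2 * (x + c) ^ 2 - 1) * ψ x
  psi_init : ψ (-d) = 1
  psi_left : slabDeriv d ψ (-d) = 0
  psi_right : slabDeriv d ψ d = 0

/-- The pair `(h(c), ψ₀)`: for `κ, d > 0` and each `c` there is exactly one `h > 0` for which
the linearized problem has a positive solution `ψ₀`, and `ψ₀` is then unique on `[-d, d]`. -/
noncomputable def normalPair (κ d c : ℝ) : ℝ × (ℝ → ℝ) :=
  Classical.epsilon fun p : ℝ × (ℝ → ℝ) => 0 < p.1 ∧ IsNormalMode κ d c p.1 p.2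

/-- The eigenvalue `h(c)`. -/
noncomputable def criticalField (κ d c : ℝ) : ℝ := (normalPair κ d c).1

/-- The positive eigenfunction `ψ₀` belonging to `h(c)`. -/
noncomputable def normalMode (κ d c : ℝ) : ℝ → ℝ := (normalPair κ d c).2

/-- `I(c) = ∫_{-d}^{d} (x + c) ψ₀(x)² dx`. -/
noncomputable def bifurcationIntegral (κ d c : ℝ) : ℝ :=
  ∫ x in (-d)..d, (x + c) * normalMode κ d c x ^ 2

/-- A curve of symmetric solutions, parametrized by `α = φ(-d)`, bifurcates from the normal
state `(0, h(0) x)` at `h = h(0)`: it is continuous in the uniform norm on `[-d, d]` up to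
`α = 0`, where it reaches the normal state. -/
def SymmetricBifurcation (κ d : ℝ) : Prop :=
  ∃ α₀ : ℝ, 0 < α₀ ∧ ∃ (H : ℝ → ℝ) (φ a : ℝ → ℝ → ℝ),
    ContinuousOn H (Set.Ico 0 α₀) ∧
    ContinuousOn (Function.uncurry φ) (Set.Ico 0 α₀ ×ˢ Set.Icc (-d) d) ∧
    ContinuousOn (Function.uncurry a) (Set.Ico 0 α₀ ×ˢ Set.Icc (-d) d) ∧
    H 0 = criticalField κ d 0 ∧
    (∀ x ∈ Set.Icc (-d) d, φ 0 x = 0 ∧ a 0 x = criticalField κ d 0 * x) ∧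
    ∀ α ∈ Set.Ioo 0 α₀, IsSolution κ d (H α) (φ α) (a α) ∧ IsSymmetric d (φ α) (a α) ∧
      φ α (-d) = α

/-- For some `δ > 0` and all sufficiently small `α > 0` the scaled problem has exactly one
solution `(ψ, a)` with field `h` satisfying `|h - h(0)| < δ`, and this solution is symmetric. -/
def UniqueSymmetricBifurcation (κ d : ℝ) : Prop :=
  ∃ δ : ℝ, 0 < δ ∧ ∃ α₀ : ℝ, 0 < α₀ ∧ ∀ α ∈ Set.Ioo 0 α₀,
    ∃ (h : ℝ) (ψ a : ℝ → ℝ),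
      |h - criticalField κ d 0| < δ ∧ IsScaledSolution κ d α h ψ a ∧ IsSymmetric d ψ a ∧
      ∀ (h' : ℝ) (ψ' a' : ℝ → ℝ),
        |h' - criticalField κ d 0| < δ → IsScaledSolution κ d α h' ψ' a' →
          h' = h ∧ Set.EqOn ψ' ψ (Set.Icc (-d) d) ∧ Set.EqOn a' a (Set.Icc (-d) d)

/-- `(φ, a)` is within `ε` of the normal state `(0, h₀ x)` in the `C¹` norm on `[-d, d]`. -/
def NearNormalState (d h₀ ε : ℝ) (φ a : ℝ → ℝ) : Prop :=
  ∀ x ∈ Set.Icc (-d) d, |φ x| < ε ∧ |slabDeriv d φ x| < ε ∧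
    |a x - h₀ * x| < ε ∧ |slabDeriv d a x - h₀| < ε

/-- Near symmetry: the normalized order parameter `φ / φ(-d)` is even, and `a` is odd,
up to an error `ε`. -/
def NearlySymmetric (d ε : ℝ) (φ a : ℝ → ℝ) : Prop :=
  ∀ x ∈ Set.Icc (-d) d, |φ (-x) / φ (-d) - φ x / φ (-d)| < ε ∧ |a (-x) + a x| < ε

end GinzburgLandau

namespace GinzburgLandau

open Set Filter Topology MeasureTheory

/-! Write `ψ = E + η o` and `a = A + η e` with `E`, `e` even and `o`, `A` odd, normalize `E(0) = 1`,
and let `σ` be the squared amplitude at the centre. The equations for the parts are polynomial in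
`σ` and `ζ = η²`. Since `e'` is divisible by `σ`, putting `e' = σ m` keeps the system (`partsField`)
regular at `σ = ζ = 0`. Solutions of the boundary value problem correspond to zeros of three end
values, `E'(d)`, `o'(d)` and `m(d)`; the conditions at `-d` follow by reflection. The end values are
strictly differentiable in the centre data and the parameters (`exists_local_flow`), and at zero
amplitude they are explicit (`linearProfile`, `exists_profile_of_zero_amplitude`).

Symmetric branch: when the asymmetric parts vanish, only `E'(d) = 0` and the prescribed amplitude
remain. The implicit function theorem applies because the end slope of the even linear mode grows at
a positive rate with the field (`deriv_even_end_pos`).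

Asymmetric solutions: normalize `e(0) = 1` and solve `E'(d) = o'(d) = 0` for the slopes `b = A'(0)`
and `ρ = o'(0)`. What is left is the scalar equation `m(d) = 0`. At `σ = 0` the value `m(d)` is, up
to a positive factor, the quotient `I(c)/c` with `c = η/b` (`bifurcationIntegral_eq`), so at the
normal state it has the sign of `I'(0)` whenever this derivative is nonzero. When the sign changes
along a curve, connectedness forces zeros of `m(d)` with `σ, ζ > 0` arbitrarily close to the normal
state (`exists_frequently_end_eq_zero`); only continuity of the curve matters.

Uniqueness in short and long slabs is a compactness argument in two stages. A priori bounds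
(`exists_centre_bound`) let the centre data of small solutions converge. In the first limit one gets
a positive Neumann mode at the critical field `h` for a slab shifted by `s`, together with the limit
of `m(d) = 0`; one must show `s = 0`. Rescaling by the size of the asymmetry then gives a second
limit, which must be shown to vanish.

Both facts are read off from the linear modes `E`, `o` and the quotient `r = E'/o'`, whose
derivative is `G = κ²(h²x² - 1)/o'²`. The Neumann conditions say `r(d + s) + r(d - s) = 0`, an
expression that vanishes at `s = 0` and has derivative `G(d + s) - G(d - s)`. The condition on `m`
forces `d - s > 1/h`. In a short slab `G` increases on the relevant range, in a long one it
decreases from about `2/√(κh)` on, so the sum has a strict sign (`ratio_add_pos_of_short`,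
`ratio_add_neg_of_long`). The second limit vanishes because `G'(d) ≠ 0`
(`CriticalModes.nondegenerate`). -/

/-- The time interval on which flows are considered; initial values are taken at its centre. -/
abbrev TimeInterval : Type := Set.Icc (-1 : ℝ) 1

/-- The nearest point of the time interval. -/
noncomputable def clampTime (s : ℝ) : TimeInterval := Set.projIcc (-1 : ℝ) 1 (by norm_num) s

/-- The centre of the time interval. -/
def midTime : TimeInterval := ⟨0, by norm_num⟩

lemma continuous_clampTime : Continuous clampTime := continuous_projIcc (h := by norm_num)

lemma clampTime_of_mem {s : ℝ} (hs : s ∈ Set.Icc (-1 : ℝ) 1) : clampTime s = ⟨s, hs⟩ :=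
  Set.projIcc_of_mem _ hs

lemma clampTime_coe (s : TimeInterval) : clampTime (s : ℝ) = s :=
  Set.projIcc_val _ s

/-! ### Flows of autonomous `C¹` fields through Volterra operators. -/

section Volterra

variable {V : Type*} [NormedAddCommGroup V]

lemma continuous_comp_clampTime (g : C(TimeInterval, V)) : Continuous fun s => g (clampTime s) :=
  g.continuous.comp continuous_clampTime

lemma intervalIntegrable_comp_clampTime (g : C(TimeInterval, V)) (a b : ℝ) :
    IntervalIntegrable (fun s => g (clampTime s)) volume a b :=
  (continuous_comp_clampTime g).intervalIntegrable a b

variable [NormedSpace ℝ V]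

lemma abs_coe_le_one (t : TimeInterval) : |(t : ℝ)| ≤ 1 := abs_le.2 ⟨t.2.1, t.2.2⟩

/-- The primitive vanishing at the centre, as a bounded operator. -/
noncomputable def primitiveCLM [CompleteSpace V] : C(TimeInterval, V) →L[ℝ] C(TimeInterval, V) :=
  LinearMap.mkContinuous
    { toFun := fun g => ⟨fun t => ∫ s in (0 : ℝ)..t, g (clampTime s),
        (intervalIntegral.continuous_primitive
          (fun a b => intervalIntegrable_comp_clampTime g a b) 0).comp continuous_subtype_val⟩
      map_add' := fun g₁ g₂ => by
        ext t
        simp [intervalIntegral.integral_add (intervalIntegrable_comp_clampTime g₁ _ _)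
          (intervalIntegrable_comp_clampTime g₂ _ _)]
      map_smul' := fun c g => by
        ext t
        simp [intervalIntegral.integral_smul] } 1 (fun g => by
      rw [one_mul]
      refine (ContinuousMap.norm_le _ (norm_nonneg g)).2 fun t => ?_
      refine (intervalIntegral.norm_integral_le_of_norm_le_const
        (C := ‖g‖) fun s _ => g.norm_coe_le_norm _).trans ?_
      rw [sub_zero]
      exact mul_le_of_le_one_right (norm_nonneg g) (abs_coe_le_one t))

lemma primitiveCLM_apply [CompleteSpace V] (g : C(TimeInterval, V)) (t : TimeInterval) :
    primitiveCLM g t = ∫ s in (0 : ℝ)..t, g (clampTime s) := rfl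

/-- Pointwise application of a continuous family of bounded operators. -/
noncomputable def pointwiseCLM {W : Type*} [NormedAddCommGroup W] [NormedSpace ℝ W]
    (A : C(TimeInterval, V →L[ℝ] W)) : C(TimeInterval, V) →L[ℝ] C(TimeInterval, W) :=
  LinearMap.mkContinuous
    { toFun := fun v => ⟨fun t => A t (v t), A.continuous.clm_apply v.continuous⟩
      map_add' := fun g₁ g₂ => by ext t; simp
      map_smul' := fun c g => by ext t; simp } ‖A‖ (fun g => by
      refine (ContinuousMap.norm_le _ (by positivity)).2 fun t => ?_
      exact ((A t).le_opNorm _).trans (mul_le_mul (A.norm_coe_le_norm t) (g.norm_coe_le_norm t)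
        (norm_nonneg _) (by positivity)))

lemma pointwiseCLM_apply {W : Type*} [NormedAddCommGroup W] [NormedSpace ℝ W]
    (A : C(TimeInterval, V →L[ℝ] W)) (v : C(TimeInterval, V)) (t : TimeInterval) :
    pointwiseCLM A v t = A t (v t) := rfl

/-- Each integration from the centre raises the power of `|t|` by one and divides by the new
exponent, so iterates of a Volterra operator decay factorially. -/
lemma norm_volterra_pow_apply_le [CompleteSpace V] (A : C(TimeInterval, V →L[ℝ] V)) (n : ℕ)
    (v : C(TimeInterval, V)) (t : TimeInterval) :
    ‖(((primitiveCLM.comp (pointwiseCLM A)) ^ n) v) t‖ ≤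
      ‖A‖ ^ n * |(t : ℝ)| ^ n / n.factorial * ‖v‖ := by
  induction n generalizing t with
  | zero => simpa using v.norm_coe_le_norm t
  | succ n ih =>
    rw [pow_succ', mul_apply_eq_comp, ContinuousLinearMap.comp_apply,
      primitiveCLM_apply]
    set w := ((primitiveCLM.comp (pointwiseCLM A)) ^ n) v
    have hpt : ∀ s ∈ Set.uIoc (0 : ℝ) t, ‖(pointwiseCLM A w) (clampTime s)‖ ≤
        (‖A‖ ^ (n + 1) / n.factorial * ‖v‖) * |s - 0| ^ n := by
      intro s hs
      have hmem : s ∈ Set.Icc (-1 : ℝ) 1 := by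
        have h1 := t.2.1
        have h2 := t.2.2
        rcases Set.mem_uIoc.1 hs with h | h
        · exact ⟨by linarith [h.1], by linarith [h.2]⟩
        · exact ⟨by linarith [h.1], by linarith [h.2]⟩
      rw [pointwiseCLM_apply]
      refine ((A _).le_opNorm _).trans ?_
      refine (mul_le_mul (A.norm_coe_le_norm _) (ih (clampTime s)) (norm_nonneg _)
        (norm_nonneg _)).trans (le_of_eq ?_)
      rw [clampTime_of_mem hmem, sub_zero]
      ring
    refine (intervalIntegral.norm_integral_le_abs_of_norm_le
      ((ae_restrict_mem measurableSet_uIoc).mono hpt)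
      (Continuous.intervalIntegrable (by fun_prop) _ _)).trans (le_of_eq ?_)
    rw [intervalIntegral.integral_const_mul, abs_mul, intervalIntegral.abs_intervalIntegral_eq,
      integral_pow_abs_sub_uIoc, sub_zero, abs_of_nonneg (by positivity),
      abs_of_nonneg (by positivity), Nat.factorial_succ]
    push_cast
    field_simp

/-- Factorial decay makes some power `K ^ n` a strict contraction. Then `1 - K ^ n` is a unit, and
it is the product of `1 - K` with a geometric sum commuting with it. No smallness of `A` is needed.
-/
lemma isUnit_one_sub_volterra [CompleteSpace V] (A : C(TimeInterval, V →L[ℝ] V)) :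
    IsUnit (1 - primitiveCLM.comp (pointwiseCLM A)) := by
  set K := primitiveCLM.comp (pointwiseCLM A)
  have hbound : ∀ n : ℕ, ‖K ^ n‖ ≤ ‖A‖ ^ n / n.factorial := fun n => by
    refine ContinuousLinearMap.opNorm_le_bound _ (by positivity) fun v => ?_
    refine (ContinuousMap.norm_le _ (by positivity)).2 fun t => ?_
    refine (norm_volterra_pow_apply_le A n v t).trans ?_
    have h1 : |(t : ℝ)| ^ n ≤ 1 := pow_le_one₀ (abs_nonneg _) (abs_coe_le_one t)
    have : ‖A‖ ^ n * |(t : ℝ)| ^ n ≤ ‖A‖ ^ n := mul_le_of_le_one_right (by positivity) h1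
    gcongr
  obtain ⟨n, hn⟩ := ((FloorSemiring.tendsto_pow_div_factorial_atTop ‖A‖).eventually
    (gt_mem_nhds one_pos)).exists
  have hunit : IsUnit (1 - K ^ n) := (Units.oneSub (K ^ n) ((hbound n).trans_lt hn)).isUnit
  have hcomm : Commute (1 - K) (∑ i ∈ Finset.range n, K ^ i) :=
    (Commute.one_left _).sub_left (Commute.sum_right _ _ _ fun i _ => Commute.self_pow K i)
  rw [← mul_neg_geom_sum] at hunit
  exact (hcomm.isUnit_mul_iff.1 hunit).1

/-- Composition of continuous curves with a continuous map. -/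
def compCurve {W : Type*} [NormedAddCommGroup W] [NormedSpace ℝ W] {f : V → W}
    (hf : Continuous f) (u : C(TimeInterval, V)) : C(TimeInterval, W) := (⟨f, hf⟩ : C(V, W)).comp u

/-- The derivative of a `C¹` map along a curve. -/
noncomputable def fderivCurve {W : Type*} [NormedAddCommGroup W] [NormedSpace ℝ W] {f : V → W}
    (hf : ContDiff ℝ 1 f) (u : C(TimeInterval, V)) : C(TimeInterval, V →L[ℝ] W) :=
  ⟨fun t => fderiv ℝ f (u t), (hf.continuous_fderiv one_ne_zero).comp u.continuous⟩

/-- The range of `u` is compact, so `fderiv ℝ f` varies by at most `ε` on a tube of radius `δ`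
around it, with `δ` independent of `t`. The mean value inequality on each ball then gives the
uniform estimate. -/
lemma hasStrictFDerivAt_compCurve {W : Type*} [NormedAddCommGroup W] [NormedSpace ℝ W]
    {f : V → W} (hf : ContDiff ℝ 1 f) (u : C(TimeInterval, V)) :
    HasStrictFDerivAt (compCurve hf.continuous) (pointwiseCLM (fderivCurve hf u)) u := by
  refine HasStrictFDerivAt.of_isLittleO (Asymptotics.isLittleO_iff.2 fun ε hε => ?_)
  have hcont : Continuous (fderiv ℝ f) := hf.continuous_fderiv one_ne_zero
  have huc := (isCompact_range u.continuous).uniformContinuousAt_of_continuousAt (fderiv ℝ f)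
    (fun a _ => hcont.continuousAt) (Metric.dist_mem_uniformity hε)
  obtain ⟨δ, hδ, hδ'⟩ := Metric.mem_uniformity_dist.1 huc
  filter_upwards [prod_mem_nhds (Metric.ball_mem_nhds u hδ) (Metric.ball_mem_nhds u hδ)]
  rintro ⟨v, w⟩ ⟨hv, hw⟩
  refine (ContinuousMap.norm_le _ (by positivity)).2 fun t => ?_
  have hmem : ∀ z ∈ Metric.ball u δ, z t ∈ Metric.ball (u t) δ := fun z hz =>
    (ContinuousMap.dist_apply_le_dist t).trans_lt hz
  have hmv := (convex_ball (u t) δ).norm_image_sub_le_of_norm_hasFDerivWithin_le'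
    (f := f) (f' := fderiv ℝ f) (φ := fderiv ℝ f (u t)) (C := ε)
    (fun x _ => ((hf.differentiable one_ne_zero) x).hasFDerivAt.hasFDerivWithinAt)
    (fun x hx => by
      have := hδ' (a := u t) (b := x) (by rw [dist_comm]; exact hx) ⟨t, rfl⟩
      rw [← dist_eq_norm, dist_comm]
      exact this.le)
    (hmem w hw) (hmem v hv)
  refine hmv.trans ?_
  gcongr
  exact (v - w).norm_coe_le_norm t

/-- `u` is an integral curve of the autonomous vector field `f`, in integrated form. -/
def IsFlow (f : V → V) (u : C(TimeInterval, V)) : Prop :=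
  ∀ t : TimeInterval, u t = u midTime + ∫ s in (0 : ℝ)..t, f (u (clampTime s))

lemma isFlow_of_hasDerivWithinAt [CompleteSpace V] {f : V → V} (hf : Continuous f) {v : ℝ → V}
    (hv : ∀ t ∈ Set.Icc (-1 : ℝ) 1, HasDerivWithinAt v (f (v t)) (Set.Icc (-1) 1) t) :
    ∃ u : C(TimeInterval, V), IsFlow f u ∧ ∀ t : TimeInterval, u t = v t := by
  have hc : ContinuousOn v (Set.Icc (-1) 1) := fun t ht => (hv t ht).continuousWithinAt
  refine ⟨⟨fun t => v t, continuousOn_iff_continuous_domRestrict.1 hc⟩, fun t => ?_, fun t => rfl⟩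
  have hsub : Set.uIcc (0 : ℝ) t ⊆ Set.Icc (-1) 1 := Set.uIcc_subset_Icc midTime.2 t.2
  have := ODE.picard_eq_of_hasDerivAt (f := fun _ => f) (t₀ := 0) (t := t) (u := Set.univ) (α := v)
    (by fun_prop) (fun s hs => (hv s (hsub hs)).mono hsub) (Set.mapsTo_univ _ _)
  rw [ODE.picard_apply] at this
  refine this.symm.trans ?_
  congr 1
  refine intervalIntegral.integral_congr fun s hs => ?_
  simp only [clampTime_of_mem (hsub hs)]
  rfl

lemma IsFlow.hasDerivWithinAt [CompleteSpace V] {f : V → V} (hf : Continuous f)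
    {u : C(TimeInterval, V)} (hu : IsFlow f u) {t : ℝ} (ht : t ∈ Set.Icc (-1 : ℝ) 1) :
    HasDerivWithinAt (fun s => u (clampTime s)) (f (u (clampTime t))) (Set.Icc (-1) 1) t := by
  have hcont : Continuous fun s => f (u (clampTime s)) := hf.comp (continuous_comp_clampTime u)
  have h1 : HasDerivAt (fun s : ℝ => u midTime + ∫ r in (0 : ℝ)..s, f (u (clampTime r)))
      (f (u (clampTime t))) t :=
    (intervalIntegral.integral_hasDerivAt_right (hcont.intervalIntegrable _ _)
      hcont.stronglyMeasurable.stronglyMeasurableAtFilter hcont.continuousAt).const_add _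
  refine h1.hasDerivWithinAt.congr (fun s hs => ?_) ?_
  · have := hu ⟨s, hs⟩
    simpa [clampTime_of_mem hs] using this
  · have := hu ⟨t, ht⟩
    simpa [clampTime_of_mem ht] using this

/-- Both curves stay in one closed ball, which is compact in a proper space, so `f` is Lipschitz
where it matters and Grönwall uniqueness applies. -/
lemma IsFlow.eq_of_initial_eq [ProperSpace V] {f : V → V} (hf : ContDiff ℝ 1 f)
    {u v : C(TimeInterval, V)}
    (hu : IsFlow f u) (hv : IsFlow f v) (h0 : u midTime = v midTime) : u = v := by
  have : CompleteSpace V := inferInstance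
  set R := max ‖u‖ ‖v‖
  obtain ⟨C, hC⟩ := (isCompact_closedBall (0 : V) R).exists_bound_of_continuousOn
    (f := fderiv ℝ f) (hf.continuous_fderiv one_ne_zero).continuousOn
  have hlip : LipschitzOnWith C.toNNReal f (Metric.closedBall 0 R) :=
    (convex_closedBall (0 : V) R).lipschitzOnWith_of_nnnorm_fderiv_le
      (fun x _ => (hf.differentiable one_ne_zero) x)
      (fun x hx => NNReal.coe_le_coe.1 ((hC x hx).trans (Real.le_coe_toNNReal C)))
  have hd : ∀ w : C(TimeInterval, V), IsFlow f w → ∀ t ∈ Set.Ioo (-1 : ℝ) 1,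
      HasDerivAt (fun s => w (clampTime s)) (f (w (clampTime t))) t := fun w hw t ht =>
    (hw.hasDerivWithinAt hf.continuous (Ioo_subset_Icc_self ht)).hasDerivAt
      (Icc_mem_nhds ht.1 ht.2)
  have key := ODE_solution_unique_of_mem_Icc (v := fun _ => f) (s := fun _ => Metric.closedBall 0 R)
    (t₀ := 0) (f := fun s => u (clampTime s)) (g := fun s => v (clampTime s))
    (fun t _ => hlip) (by norm_num)
    (continuous_comp_clampTime u).continuousOn (hd u hu)
    (fun t _ => mem_closedBall_zero_iff.2 ((u.norm_coe_le_norm _).trans (le_max_left _ _)))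
    (continuous_comp_clampTime v).continuousOn (hd v hv)
    (fun t _ => mem_closedBall_zero_iff.2 ((v.norm_coe_le_norm _).trans (le_max_right _ _)))
    (by simpa only [show clampTime 0 = midTime from clampTime_of_mem midTime.2] using h0)
  ext t
  have := key t.2
  simpa [clampTime_coe] using this

/-- The nonlinear Volterra map whose fibres over constants are the integral curves. -/
noncomputable def volterraMap [CompleteSpace V] {f : V → V} (hf : Continuous f) (u : C(TimeInterval, V)) :
    C(TimeInterval, V) := u - primitiveCLM (compCurve hf u)

lemma volterraMap_eq_const_iff [CompleteSpace V] {f : V → V} (hf : Continuous f) {u : C(TimeInterval, V)} {y : V} :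
    volterraMap hf u = ContinuousMap.const _ y ↔ IsFlow f u ∧ u midTime = y := by
  have hval : ∀ t, volterraMap hf u t = u t - ∫ s in (0 : ℝ)..t, f (u (clampTime s)) :=
    fun t => rfl
  constructor
  · intro h
    have h' : ∀ t : TimeInterval, u t - ∫ s in (0 : ℝ)..t, f (u (clampTime s)) = y := fun t => by
      rw [← hval, h, ContinuousMap.const_apply]
    have h0 : u midTime = y := by simpa [midTime] using h' midTime
    exact ⟨fun t => by rw [h0, ← h' t, sub_add_cancel], h0⟩
  · rintro ⟨h, rfl⟩
    ext t
    rw [hval, ContinuousMap.const_apply, sub_eq_iff_eq_add]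
    exact h t

/-- Constant curves. -/
noncomputable def constCurveCLM : V →L[ℝ] C(TimeInterval, V) :=
  LinearMap.mkContinuous
    { toFun := fun y => ContinuousMap.const _ y
      map_add' := fun _ _ => rfl
      map_smul' := fun _ _ => rfl } 1 (fun y => by
      rw [one_mul]
      exact (ContinuousMap.norm_le _ (norm_nonneg y)).2 fun t => le_rfl)

/-- Integral curves are the preimages of constants under `u ↦ u - ∫ f(u)`, whose derivative is `1`
minus a Volterra operator and hence invertible. The inverse function theorem in the space of curves
gives at once existence on the whole time interval for nearby initial values and strict
differentiability in them. -/
theorem exists_local_flow [CompleteSpace V] {f : V → V} (hf : ContDiff ℝ 1 f)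
    {u : C(TimeInterval, V)} (hu : IsFlow f u) :
    ∃ Φ : V → C(TimeInterval, V), (∃ L : V →L[ℝ] C(TimeInterval, V), HasStrictFDerivAt Φ L (u midTime)) ∧
      ∀ᶠ y in 𝓝 (u midTime), IsFlow f (Φ y) ∧ Φ y midTime = y := by
  obtain ⟨U, hU⟩ := isUnit_one_sub_volterra (fderivCurve hf u)
  let e : C(TimeInterval, V) ≃L[ℝ] C(TimeInterval, V) := ContinuousLinearEquiv.unitsEquiv ℝ _ U
  have he : (e : C(TimeInterval, V) →L[ℝ] C(TimeInterval, V)) =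
      1 - primitiveCLM.comp (pointwiseCLM (fderivCurve hf u)) := by
    rw [← hU]; rfl
  have hS : HasStrictFDerivAt (volterraMap hf.continuous)
      (e : C(TimeInterval, V) →L[ℝ] C(TimeInterval, V)) u := by
    rw [he]
    exact (hasStrictFDerivAt_id u).sub
      (primitiveCLM.hasStrictFDerivAt.comp u (hasStrictFDerivAt_compCurve hf u))
  have hval : volterraMap hf.continuous u = ContinuousMap.const _ (u midTime) :=
    (volterraMap_eq_const_iff hf.continuous).2 ⟨hu, rfl⟩
  let c : V →L[ℝ] C(TimeInterval, V) := constCurveCLM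
  have hinv := hS.to_localInverse
  rw [hval] at hinv
  refine ⟨fun y => hS.localInverse _ _ _ (c y), ⟨_, hinv.comp (u midTime) c.hasStrictFDerivAt⟩, ?_⟩
  have hev := hS.eventually_right_inverse
  rw [hval] at hev
  filter_upwards [(c.continuous.tendsto (u midTime)).eventually hev] with y hy
  exact (volterraMap_eq_const_iff hf.continuous).1 hy

/-- There is an integral curve on the whole time interval with value `y` at its centre. -/
def FlowsFrom (f : V → V) (y : V) : Prop := ∃ u : C(TimeInterval, V), IsFlow f u ∧ u midTime = y

open Classical in
/-- The integral curve with value `y` at the centre (zero if there is none). -/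
noncomputable def flow (f : V → V) (y : V) : C(TimeInterval, V) :=
  if h : FlowsFrom f y then h.choose else 0

lemma FlowsFrom.isFlow {f : V → V} {y : V} (h : FlowsFrom f y) : IsFlow f (flow f y) := by
  rw [flow, dif_pos h]; exact h.choose_spec.1

lemma FlowsFrom.flow_midTime {f : V → V} {y : V} (h : FlowsFrom f y) : flow f y midTime = y := by
  rw [flow, dif_pos h]; exact h.choose_spec.2

lemma IsFlow.eq_flow [ProperSpace V] {f : V → V} (hf : ContDiff ℝ 1 f) {u : C(TimeInterval, V)}
    (hu : IsFlow f u) : u = flow f (u midTime) :=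
  have h : FlowsFrom f (u midTime) := ⟨u, hu, rfl⟩
  hu.eq_of_initial_eq hf h.isFlow h.flow_midTime.symm

theorem FlowsFrom.eventually [ProperSpace V] {f : V → V} (hf : ContDiff ℝ 1 f) {y : V}
    (h : FlowsFrom f y) : ∀ᶠ z in 𝓝 y, FlowsFrom f z := by
  obtain ⟨u, hu, rfl⟩ := h
  obtain ⟨Φ, -, hΦ⟩ := exists_local_flow hf hu
  filter_upwards [hΦ] with z hz using ⟨Φ z, hz⟩

theorem FlowsFrom.hasStrictFDerivAt [ProperSpace V] {f : V → V} (hf : ContDiff ℝ 1 f) {y : V}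
    (h : FlowsFrom f y) :
    ∃ L : V →L[ℝ] C(TimeInterval, V), HasStrictFDerivAt (flow f) L y := by
  obtain ⟨u, hu, rfl⟩ := h
  obtain ⟨Φ, ⟨L, hL⟩, hΦ⟩ := exists_local_flow hf hu
  refine ⟨L, hL.congr_of_eventuallyEq ?_⟩
  filter_upwards [hΦ] with z hz
  have := hz.1.eq_flow hf
  rwa [hz.2] at this

theorem FlowsFrom.continuousAt [ProperSpace V] {f : V → V} (hf : ContDiff ℝ 1 f) {y : V}
    (h : FlowsFrom f y) : ContinuousAt (flow f) y :=
  let ⟨_, hL⟩ := h.hasStrictFDerivAt hf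
  hL.continuousAt

end Volterra

/-- After rescaling to the time interval, the first-order system in integrated form is `(1 - K) u =
const` with `K` a Volterra operator; one inversion gives the solution on an interval of any length.
-/
lemma exists_linear_second_order {q : ℝ → ℝ} (hq : Continuous q) {R : ℝ}
    (hR : 0 < R) (y₀ y₁ : ℝ) :
    ∃ y y' : ℝ → ℝ, y 0 = y₀ ∧ y' 0 = y₁ ∧ ∀ x ∈ Set.Ioo (-R) R,
      HasDerivAt y (y' x) x ∧ HasDerivAt y' (q x * y x) x := by
  let A : C(TimeInterval, ℝ × ℝ →L[ℝ] ℝ × ℝ) :=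
    ⟨fun t => R • ((ContinuousLinearMap.inl ℝ ℝ ℝ).comp (ContinuousLinearMap.snd ℝ ℝ ℝ) +
      q (R * t) • (ContinuousLinearMap.inr ℝ ℝ ℝ).comp (ContinuousLinearMap.fst ℝ ℝ ℝ)),
      by fun_prop⟩
  obtain ⟨U, hU⟩ := isUnit_one_sub_volterra A
  let rhs : C(TimeInterval, ℝ × ℝ) := ContinuousMap.const _ (y₀, y₁)
  let u : C(TimeInterval, ℝ × ℝ) := (↑U⁻¹ : C(TimeInterval, ℝ × ℝ) →L[ℝ] _) rhs
  have hu : u - primitiveCLM (pointwiseCLM A u) = rhs := by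
    have h1 : ((U : C(TimeInterval, ℝ × ℝ) →L[ℝ] C(TimeInterval, ℝ × ℝ)) * ↑U⁻¹) rhs = rhs := by
      rw [Units.mul_inv]; rfl
    rw [hU] at h1
    exact h1
  have hut : ∀ t : TimeInterval, u t = (y₀, y₁) +
      ∫ s in (0 : ℝ)..t, (pointwiseCLM A u) (clampTime s) := by
    intro t
    have := congrArg (fun w : C(TimeInterval, ℝ × ℝ) => w t) (sub_eq_iff_eq_add.1 hu)
    simp only [rhs, ContinuousMap.add_apply, ContinuousMap.const_apply, primitiveCLM_apply] at this
    exact this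
  have hd : ∀ s ∈ Set.Ioo (-1 : ℝ) 1, HasDerivAt (fun s => u (clampTime s))
      (R * (u (clampTime s)).2, R * (q (R * s) * (u (clampTime s)).1)) s := by
    intro s hs
    have hcont := continuous_comp_clampTime (pointwiseCLM A u)
    have h1 : HasDerivAt (fun s : ℝ => (y₀, y₁) +
        ∫ r in (0 : ℝ)..s, (pointwiseCLM A u) (clampTime r))
        ((pointwiseCLM A u) (clampTime s)) s :=
      (intervalIntegral.integral_hasDerivAt_right (hcont.intervalIntegrable _ _)
        hcont.stronglyMeasurable.stronglyMeasurableAtFilter hcont.continuousAt).const_add _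
    have h2 : (pointwiseCLM A u) (clampTime s) =
        (R * (u (clampTime s)).2, R * (q (R * s) * (u (clampTime s)).1)) := by
      have : ((clampTime s : TimeInterval) : ℝ) = s := by
        rw [clampTime_of_mem (Ioo_subset_Icc_self hs)]
      rw [pointwiseCLM_apply]
      ext <;> simp [A, this]
    rw [← h2]
    refine h1.congr_of_eventuallyEq ?_
    filter_upwards [Icc_mem_nhds hs.1 hs.2] with r hr
    have := hut ⟨r, hr⟩
    simpa only [clampTime_of_mem hr] using this
  have hmid : u (clampTime 0) = (y₀, y₁) := by
    have := hut midTime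
    simpa [midTime, show clampTime 0 = midTime from clampTime_of_mem midTime.2] using this
  refine ⟨fun x => (u (clampTime (x / R))).1, fun x => (u (clampTime (x / R))).2,
    by simp [hmid], by simp [hmid], fun x hx => ?_⟩
  have hxR : x / R ∈ Set.Ioo (-1 : ℝ) 1 :=
    ⟨by rw [lt_div_iff₀ hR]; linarith [hx.1], by rw [div_lt_one hR]; exact hx.2⟩
  have h3 := (hd _ hxR).scomp x ((hasDerivAt_id x).div_const R)
  have h4 : R * (x / R) = x := by field_simp
  have h5 := (hasFDerivAt_fst (𝕜 := ℝ) (p := u (clampTime (x / R)))).comp_hasDerivAt x h3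
  have h6 := (hasFDerivAt_snd (𝕜 := ℝ) (p := u (clampTime (x / R)))).comp_hasDerivAt x h3
  constructor
  · refine h5.congr_deriv ?_
    simp; field_simp
  · refine h6.congr_deriv ?_
    simp [h4]; field_simp

/-! ### The rescaled system for the even and odd parts. -/

/-- The Ginzburg-Landau equations for the even and odd parts of `ψ = E + η o`, `a = A + η e`
(`E`, `e` even, `o`, `A` odd). The state is `(E, E', o, o', A, A', e, m)` with `e' = σ m`, the
parameters are `(σ, ζ, κ, d)` with `ζ = η ^ 2` and `σ` the square of the amplitude at the centre. -/
def partsField (p : Fin 4 → ℝ) (v : Fin 8 → ℝ) : Fin 8 → ℝ :=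
  ![v 1,
    p 2 ^ 2 * ((p 0 * (v 0 ^ 2 + p 1 * v 2 ^ 2) + v 4 ^ 2 + p 1 * v 6 ^ 2 - 1) * v 0 +
      2 * p 1 * (p 0 * v 0 * v 2 + v 4 * v 6) * v 2),
    v 3,
    p 2 ^ 2 * ((p 0 * (v 0 ^ 2 + p 1 * v 2 ^ 2) + v 4 ^ 2 + p 1 * v 6 ^ 2 - 1) * v 2 +
      2 * (p 0 * v 0 * v 2 + v 4 * v 6) * v 0),
    v 5,
    p 0 * ((v 0 ^ 2 + p 1 * v 2 ^ 2) * v 4 + 2 * p 1 * v 0 * v 2 * v 6),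
    p 0 * v 7,
    (v 0 ^ 2 + p 1 * v 2 ^ 2) * v 6 + 2 * v 0 * v 2 * v 4]

/-- The autonomous field on the time interval: the slab is rescaled to `[-1, 1]` and the parameters
are carried along as constants. -/
def timeField (w : (Fin 8 → ℝ) × (Fin 4 → ℝ)) : (Fin 8 → ℝ) × (Fin 4 → ℝ) :=
  (w.2 3 • partsField w.2 w.1, 0)

lemma contDiff_timeField : ContDiff ℝ 1 timeField := by
  have h : ContDiff ℝ 1 fun w : (Fin 8 → ℝ) × (Fin 4 → ℝ) => partsField w.2 w.1 := by
    refine contDiff_pi.2 fun i => ?_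
    fin_cases i <;> simp [partsField] <;> fun_prop
  unfold timeField
  fun_prop

/-- `P` solves the equations for the parts on the slab `[-d, d]`. -/
def IsProfile (p : Fin 4 → ℝ) (P : ℝ → Fin 8 → ℝ) : Prop :=
  ∀ x ∈ Set.Icc (-p 3) (p 3), HasDerivWithinAt P (partsField p (P x)) (Set.Icc (-p 3) (p 3)) x

lemma IsProfile.apply {p : Fin 4 → ℝ} {P : ℝ → Fin 8 → ℝ} (h : IsProfile p P) (i : Fin 8) {x : ℝ}
    (hx : x ∈ Set.Icc (-p 3) (p 3)) :
    HasDerivWithinAt (fun x => P x i) (partsField p (P x) i) (Set.Icc (-p 3) (p 3)) x :=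
  hasDerivWithinAt_pi.1 (h x hx) i

/-- The profile with state `y` at the centre. -/
noncomputable def profile (y : Fin 8 → ℝ) (p : Fin 4 → ℝ) (x : ℝ) : Fin 8 → ℝ :=
  (flow timeField (y, p) (clampTime (x / p 3))).1

lemma IsFlow.parameters_const {u : C(TimeInterval, (Fin 8 → ℝ) × (Fin 4 → ℝ))}
    (hu : IsFlow timeField u) (t : TimeInterval) : (u t).2 = (u midTime).2 := by
  have hint : IntervalIntegrable (fun s => timeField (u (clampTime s))) volume 0 t :=
    (contDiff_timeField.continuous.comp (continuous_comp_clampTime u)).intervalIntegrable _ _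
  have h := congrArg (ContinuousLinearMap.snd ℝ (Fin 8 → ℝ) (Fin 4 → ℝ)) (hu t)
  rw [map_add, ← ContinuousLinearMap.intervalIntegral_comp_comm _ hint] at h
  simpa [timeField] using h

lemma div_mem_Icc {d x : ℝ} (hd : 0 < d) (hx : x ∈ Set.Icc (-d) d) :
    x / d ∈ Set.Icc (-1 : ℝ) 1 :=
  ⟨by rw [le_div_iff₀ hd]; linarith [hx.1], by rw [div_le_one hd]; exact hx.2⟩

lemma mul_mem_Icc {d t : ℝ} (hd : 0 < d) (ht : t ∈ Set.Icc (-1 : ℝ) 1) :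
    d * t ∈ Set.Icc (-d) d :=
  ⟨by nlinarith [ht.1], by nlinarith [ht.2]⟩

lemma isProfile_profile {y : Fin 8 → ℝ} {p : Fin 4 → ℝ} (hd : 0 < p 3)
    (h : FlowsFrom timeField (y, p)) : IsProfile p (profile y p) := by
  intro x hx
  have h1 := h.isFlow.hasDerivWithinAt contDiff_timeField.continuous (div_mem_Icc hd hx)
  have h2 := h1.scomp x (s := Set.Icc (-p 3) (p 3))
    (((hasDerivAt_id x).div_const (p 3)).hasDerivWithinAt) (fun z hz => div_mem_Icc hd hz)
  have h3 := (hasFDerivAt_fst (𝕜 := ℝ)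
    (p := flow timeField (y, p) (clampTime (x / p 3)))).comp_hasDerivWithinAt x h2
  refine h3.congr_deriv ?_
  have h4 : (flow timeField (y, p) (clampTime (x / p 3))).2 = p := by
    rw [h.isFlow.parameters_const, h.flow_midTime]
  have hne := hd.ne'
  ext i
  simp [timeField, h4, profile, hne]

lemma profile_zero {y : Fin 8 → ℝ} {p : Fin 4 → ℝ} (h : FlowsFrom timeField (y, p)) :
    profile y p 0 = y := by
  rw [profile, zero_div, show clampTime 0 = midTime from clampTime_of_mem midTime.2,
    h.flow_midTime]

/-- Every profile on the closed slab comes from the flow, so uniqueness and continuous dependence on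
the centre state hold for all profiles. -/
lemma IsProfile.flowsFrom {p : Fin 4 → ℝ} (hd : 0 < p 3) {P : ℝ → Fin 8 → ℝ}
    (hP : IsProfile p P) : FlowsFrom timeField (P 0, p) ∧
      ∀ x ∈ Set.Icc (-p 3) (p 3), profile (P 0) p x = P x := by
  obtain ⟨u, hu, huv⟩ := isFlow_of_hasDerivWithinAt contDiff_timeField.continuous
    (v := fun t => (P (p 3 * t), p)) (fun t ht => by
      have h1 := (hP _ (mul_mem_Icc hd ht)).scomp t (s := Set.Icc (-1 : ℝ) 1)
        ((hasDerivAt_id t).const_mul (p 3)).hasDerivWithinAt (fun z hz => mul_mem_Icc hd hz)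
      have h2 := h1.prodMk (hasDerivWithinAt_const t (Set.Icc (-1 : ℝ) 1) p)
      simpa [timeField] using h2)
  have h0 : u midTime = (P 0, p) := by rw [huv]; simp [midTime]
  refine ⟨⟨u, hu, h0⟩, fun x hx => ?_⟩
  have := hu.eq_flow contDiff_timeField
  rw [h0] at this
  rw [profile, ← this, huv, clampTime_of_mem (div_mem_Icc hd hx)]
  simp [mul_div_cancel₀ x hd.ne']

lemma IsProfile.eqOn {p : Fin 4 → ℝ} (hd : 0 < p 3) {P Q : ℝ → Fin 8 → ℝ}
    (hP : IsProfile p P) (hQ : IsProfile p Q) (h0 : P 0 = Q 0) :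
    Set.EqOn P Q (Set.Icc (-p 3) (p 3)) := fun x hx => by
  rw [← (hP.flowsFrom hd).2 x hx, ← (hQ.flowsFrom hd).2 x hx, h0]

/-- The action of the reflection `x ↦ -x` on states. -/
def reflectState (v : Fin 8 → ℝ) : Fin 8 → ℝ :=
  ![v 0, -v 1, -v 2, v 3, -v 4, v 5, v 6, -v 7]

lemma IsProfile.reflect {p : Fin 4 → ℝ} {P : ℝ → Fin 8 → ℝ} (hP : IsProfile p P) :
    IsProfile p fun x => reflectState (P (-x)) := by
  intro x hx
  have hx' : -x ∈ Set.Icc (-p 3) (p 3) := ⟨by linarith [hx.2], by linarith [hx.1]⟩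
  have h (i : Fin 8) := (hP.apply i hx').scomp x (s := Set.Icc (-p 3) (p 3))
    (hasDerivAt_neg x).hasDerivWithinAt
    (fun z hz => ⟨by linarith [hz.2], by linarith [hz.1]⟩)
  refine hasDerivWithinAt_pi.2 fun i => ?_
  fin_cases i
  · exact (h 0).congr_deriv (by simp [partsField, reflectState])
  · exact (h 1).neg.congr_deriv (by simp [partsField, reflectState]; left; ring)
  · exact (h 2).neg.congr_deriv (by simp [partsField, reflectState])
  · exact (h 3).congr_deriv (by simp [partsField, reflectState]; ring)
  · exact (h 4).neg.congr_deriv (by simp [partsField, reflectState])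
  · exact (h 5).congr_deriv (by simp [partsField, reflectState]; ring)
  · exact (h 6).congr_deriv (by simp [partsField, reflectState])
  · exact (h 7).neg.congr_deriv (by simp [partsField, reflectState])

/-- The state at the centre: `E = 1`, `o' = ρ`, `A' = b`, `e = q`. -/
def centreState (b ρ q : ℝ) : Fin 8 → ℝ := ![1, 0, 0, ρ, 0, b, q, 0]

/-- The centre state is fixed by the reflection. Hence end conditions have to be imposed at `d`
only. -/
lemma IsProfile.apply_neg {p : Fin 4 → ℝ} (hd : 0 < p 3) {P : ℝ → Fin 8 → ℝ}
    (hP : IsProfile p P) {b ρ q : ℝ} (h0 : P 0 = centreState b ρ q) {x : ℝ}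
    (hx : x ∈ Set.Icc (-p 3) (p 3)) : P (-x) = reflectState (P x) := by
  have := hP.reflect.eqOn hd hP (by
    ext i
    fin_cases i <;> simp [h0, reflectState, centreState]) (x := x) hx
  rw [← this]
  ext i
  fin_cases i <;> simp [reflectState]

lemma hasSecondDeriv_of_hasDerivWithinAt {d : ℝ} (hd : 0 < d) {f g F : ℝ → ℝ}
    (hf : ∀ x ∈ Set.Icc (-d) d, HasDerivWithinAt f (g x) (Set.Icc (-d) d) x)
    (hg : ∀ x ∈ Set.Icc (-d) d, HasDerivWithinAt g (F x) (Set.Icc (-d) d) x) :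
    HasSecondDeriv d f F ∧ ∀ x ∈ Set.Icc (-d) d, slabDeriv d f x = g x := by
  have h : ∀ x ∈ Set.Icc (-d) d, slabDeriv d f x = g x := fun x hx =>
    (hf x hx).derivWithin (uniqueDiffOn_Icc (by linarith) x hx)
  exact ⟨⟨fun x hx => (hf x hx).differentiableWithinAt, fun x hx => (hg x hx).congr h (h x hx)⟩, h⟩

lemma HasSecondDeriv.hasDerivWithinAt {d : ℝ} {f F : ℝ → ℝ} (h : HasSecondDeriv d f F) {x : ℝ}
    (hx : x ∈ Set.Icc (-d) d) :
    HasDerivWithinAt f (slabDeriv d f x) (Set.Icc (-d) d) x :=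
  (h.1 x hx).hasDerivWithinAt

lemma neg_mem_slab {d x : ℝ} (hx : x ∈ Set.Icc (-d) d) : -x ∈ Set.Icc (-d) d :=
  ⟨by linarith [hx.2], by linarith [hx.1]⟩

lemma HasDerivWithinAt.comp_neg_slab {d x : ℝ} {f f' : ℝ → ℝ}
    (hf : ∀ x ∈ Set.Icc (-d) d, HasDerivWithinAt f (f' x) (Set.Icc (-d) d) x)
    (hx : x ∈ Set.Icc (-d) d) :
    HasDerivWithinAt (fun x => f (-x)) (-f' (-x)) (Set.Icc (-d) d) x := by
  have := (hf (-x) (neg_mem_slab hx)).scomp x (s := Set.Icc (-d) d)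
    (hasDerivAt_neg x).hasDerivWithinAt (fun z hz => neg_mem_slab hz)
  exact this.congr_deriv (by simp)

/-- Recombining a profile with vanishing boundary data gives a solution of the boundary value
problem. -/
lemma IsProfile.isSolution {κ d β η b ρ q : ℝ} (hd : 0 < d) (hβ : 0 < β) {P : ℝ → Fin 8 → ℝ}
    (hP : IsProfile ![β ^ 2, η ^ 2, κ, d] P) (h0 : P 0 = centreState b ρ q)
    (h1 : P d 1 = 0) (h3 : P d 3 = 0) (h7 : P d 7 = 0) (h5 : 0 < P d 5)
    (hpos : ∀ x ∈ Set.Icc (-d) d, 0 < P x 0 + η * P x 2) :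
    IsSolution κ d (P d 5) (fun x => β * (P x 0 + η * P x 2)) (fun x => P x 4 + η * P x 6) ∧
      ∀ x ∈ Set.Icc (-d) d,
        slabDeriv d (fun x => β * (P x 0 + η * P x 2)) x = β * (P x 1 + η * P x 3) ∧
        slabDeriv d (fun x => P x 4 + η * P x 6) x = P x 5 + η * (β ^ 2 * P x 7) := by
  have hder (i : Fin 8) {x : ℝ} (hx : x ∈ Set.Icc (-d) d) := hP.apply i hx
  have hdd : d ∈ Set.Icc (-d) d := ⟨by linarith, le_rfl⟩
  have hdn : -d ∈ Set.Icc (-d) d := neg_mem_slab hdd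
  have hneg : P (-d) = reflectState (P d) := hP.apply_neg hd h0 hdd
  obtain ⟨hφ, hφ'⟩ := hasSecondDeriv_of_hasDerivWithinAt (f := fun x => β * (P x 0 + η * P x 2))
    (g := fun x => β * (P x 1 + η * P x 3))
    (F := fun x => κ ^ 2 * (β * (P x 0 + η * P x 2)) *
      ((β * (P x 0 + η * P x 2)) ^ 2 + (P x 4 + η * P x 6) ^ 2 - 1)) hd
    (fun x hx => (((hder 0 hx).add ((hder 2 hx).const_mul η)).const_mul β).congr_deriv (by
      simp [partsField]))
    (fun x hx => (((hder 1 hx).add ((hder 3 hx).const_mul η)).const_mul β).congr_deriv (by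
      simp [partsField]; ring))
  obtain ⟨ha, ha'⟩ := hasSecondDeriv_of_hasDerivWithinAt (f := fun x => P x 4 + η * P x 6)
    (g := fun x => P x 5 + η * (β ^ 2 * P x 7))
    (F := fun x => (β * (P x 0 + η * P x 2)) ^ 2 * (P x 4 + η * P x 6)) hd
    (fun x hx => ((hder 4 hx).add ((hder 6 hx).const_mul η)).congr_deriv (by
      simp [partsField]))
    (fun x hx => ((hder 5 hx).add (((hder 7 hx).const_mul (β ^ 2)).const_mul η)).congr_deriv (by
      simp [partsField]; ring))
  refine ⟨⟨h5, fun x hx => mul_pos hβ (hpos x hx), hφ, ha, ?_, ?_, ?_, ?_⟩,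
    fun x hx => ⟨hφ' x hx, ha' x hx⟩⟩
  · rw [hφ' _ hdn, hneg]; simp [reflectState, h1, h3]
  · rw [hφ' _ hdd]; simp [h1, h3]
  · rw [ha' _ hdn, hneg]; simp [reflectState, h7]
  · rw [ha' _ hdd]; simp [h7]

lemma IsSolution.isScaledSolution {κ d h : ℝ} {φ a : ℝ → ℝ} (hd : 0 < d)
    (hs : IsSolution κ d h φ a) :
    IsScaledSolution κ d (φ (-d)) h (fun x => φ x / φ (-d)) a := by
  have hdd : d ∈ Set.Icc (-d) d := ⟨by linarith, le_rfl⟩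
  have hdn : -d ∈ Set.Icc (-d) d := neg_mem_slab hdd
  have hα := hs.pos _ hdn
  have hα' := hα.ne'
  obtain ⟨h1, h2⟩ := hasSecondDeriv_of_hasDerivWithinAt hd (f := fun x => φ x / φ (-d))
    (g := fun x => slabDeriv d φ x / φ (-d))
    (F := fun x => κ ^ 2 * (φ (-d) ^ 2 * (φ x / φ (-d)) ^ 2 + a x ^ 2 - 1) * (φ x / φ (-d)))
    (fun x hx => (hs.eq_phi.hasDerivWithinAt hx).div_const _)
    (fun x hx => ((hs.eq_phi.2 x hx).div_const _).congr_deriv (by field_simp))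
  refine ⟨hs.field_pos, fun x hx => div_pos (hs.pos x hx) hα, h1, ?_, div_self hα', ?_, ?_,
    hs.a_left, hs.a_right⟩
  · refine ⟨hs.eq_a.1, fun x hx => (hs.eq_a.2 x hx).congr_deriv ?_⟩
    field_simp
  · rw [h2 _ hdn, hs.phi_left, zero_div]
  · rw [h2 _ hdd, hs.phi_right, zero_div]

/-- The even and odd parts of a pair `(ψ, a)`, normalized by the value at the centre and with the
asymmetric parts divided by `η`; `σ` is the squared amplitude at the centre. -/
noncomputable def partsOf (d σ η : ℝ) (ψ a : ℝ → ℝ) (x : ℝ) : Fin 8 → ℝ :=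
  ![(ψ x + ψ (-x)) / (2 * ψ 0), (slabDeriv d ψ x - slabDeriv d ψ (-x)) / (2 * ψ 0),
    (ψ x - ψ (-x)) / (2 * ψ 0 * η), (slabDeriv d ψ x + slabDeriv d ψ (-x)) / (2 * ψ 0 * η),
    (a x - a (-x)) / 2, (slabDeriv d a x + slabDeriv d a (-x)) / 2,
    (a x + a (-x)) / (2 * η), (slabDeriv d a x - slabDeriv d a (-x)) / (2 * η * σ)]

/-- A converse to `IsProfile.isSolution`. The scale `η` is at our disposal: it is later taken equal
to `1`, and then equal to the size of the asymmetry. -/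
lemma IsScaledSolution.isProfile_partsOf {κ d α h η : ℝ} {ψ a : ℝ → ℝ} (hd : 0 < d) (hα : 0 < α)
    (hs : IsScaledSolution κ d α h ψ a) (hη : η ≠ 0) :
    IsProfile ![α ^ 2 * ψ 0 ^ 2, η ^ 2, κ, d] (partsOf d (α ^ 2 * ψ 0 ^ 2) η ψ a) ∧
      partsOf d (α ^ 2 * ψ 0 ^ 2) η ψ a 0 =
        centreState (slabDeriv d a 0) (slabDeriv d ψ 0 / ψ 0 / η) (a 0 / η) ∧
      partsOf d (α ^ 2 * ψ 0 ^ 2) η ψ a d 1 = 0 ∧ partsOf d (α ^ 2 * ψ 0 ^ 2) η ψ a d 3 = 0 ∧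
      partsOf d (α ^ 2 * ψ 0 ^ 2) η ψ a d 5 = h ∧ partsOf d (α ^ 2 * ψ 0 ^ 2) η ψ a d 7 = 0 := by
  have hN : ψ 0 ≠ 0 := (hs.pos 0 ⟨by linarith, hd.le⟩).ne'
  have hα' := hα.ne'
  refine ⟨fun x hx => ?_, ?_, ?_, ?_, ?_, ?_⟩
  · have hx : x ∈ Set.Icc (-d) d := hx
    have p0 := hs.eq_psi.hasDerivWithinAt hx
    have p1 := hs.eq_psi.2 x hx
    have a0 := hs.eq_a.hasDerivWithinAt hx
    have a1 := hs.eq_a.2 x hx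
    have p0n := HasDerivWithinAt.comp_neg_slab (fun x hx => hs.eq_psi.hasDerivWithinAt hx) hx
    have p1n := HasDerivWithinAt.comp_neg_slab hs.eq_psi.2 hx
    have a0n := HasDerivWithinAt.comp_neg_slab (fun x hx => hs.eq_a.hasDerivWithinAt hx) hx
    have a1n := HasDerivWithinAt.comp_neg_slab hs.eq_a.2 hx
    refine hasDerivWithinAt_pi.2 fun i => ?_
    fin_cases i
    · exact ((p0.add p0n).div_const _).congr_deriv (by simp [partsField, partsOf]; ring)
    · exact ((p1.sub p1n).div_const _).congr_deriv (by
        simp [partsField, partsOf]; field_simp; ring)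
    · exact ((p0.sub p0n).div_const _).congr_deriv (by simp [partsField, partsOf])
    · exact ((p1.add p1n).div_const _).congr_deriv (by
        simp [partsField, partsOf]; field_simp; ring)
    · exact ((a0.sub a0n).div_const _).congr_deriv (by simp [partsField, partsOf])
    · exact ((a1.add a1n).div_const _).congr_deriv (by
        simp [partsField, partsOf]; field_simp; ring)
    · exact ((a0.add a0n).div_const _).congr_deriv (by
        simp [partsField, partsOf]; field_simp; ring)
    · exact ((a1.sub a1n).div_const _).congr_deriv (by
        simp [partsField, partsOf]; field_simp; ring)
  · ext i
    fin_cases i <;> simp [partsOf, centreState] <;> field_simp <;> ring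
  · simp [partsOf, hs.psi_left, hs.psi_right]
  · simp [partsOf, hs.psi_left, hs.psi_right]
  · simp [partsOf, hs.a_left, hs.a_right]
  · simp [partsOf, hs.a_left, hs.a_right]

lemma partsOf_recombine {d σ η : ℝ} {ψ a : ℝ → ℝ} (hη : η ≠ 0) (x : ℝ) :
    partsOf d σ η ψ a x 0 + η * partsOf d σ η ψ a x 2 = ψ x / ψ 0 ∧
      partsOf d σ η ψ a x 4 + η * partsOf d σ η ψ a x 6 = a x := by
  simp only [partsOf]
  constructor <;> simp <;> field_simp <;> ring

/-! ### Explicit profiles at zero amplitude. -/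

/-- At zero amplitude, with the even and odd parts decoupled, the equations are linear and the
solution is explicit in terms of the even and the odd solution `E`, `o` of `y'' = κ² (b² x² - 1) y`. -/
noncomputable def linearProfile (κ b ρ q : ℝ) (E E' o o' : ℝ → ℝ) (x : ℝ) : Fin 8 → ℝ :=
  ![E x, E' x, q / b * E' x + (ρ + q / b * κ ^ 2) * o x,
    q / b * (κ ^ 2 * (b ^ 2 * x ^ 2 - 1) * E x) + (ρ + q / b * κ ^ 2) * o' x, b * x, b, q,
    q * (x * E x ^ 2) + (ρ + q / b * κ ^ 2) / (κ ^ 2 * b) *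
      (κ ^ 2 * (b ^ 2 * x ^ 2 - 1) * E x * o x - E' x * o' x)]

/-- `y'' = κ² (b² x² - 1) y` on a neighbourhood of `[-R, R]`. -/
def IsLinearMode (κ b R : ℝ) (y y' : ℝ → ℝ) : Prop :=
  ∀ x ∈ Set.Icc (-R) R, HasDerivAt y (y' x) x ∧
    HasDerivAt y' (κ ^ 2 * (b ^ 2 * x ^ 2 - 1) * y x) x

lemma exists_isLinearMode (κ b R y₀ y₁ : ℝ) :
    ∃ y y' : ℝ → ℝ, y 0 = y₀ ∧ y' 0 = y₁ ∧ IsLinearMode κ b R y y' := by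
  obtain ⟨y, y', h0, h1, h⟩ := exists_linear_second_order
    (q := fun x => κ ^ 2 * (b ^ 2 * x ^ 2 - 1)) (by fun_prop) (R := |R| + 1) (by positivity) y₀ y₁
  refine ⟨y, y', h0, h1, fun x hx => h x ⟨?_, ?_⟩⟩ <;>
    linarith [hx.1, hx.2, le_abs_self R]

/-- With `Q = κ²(b²x² - 1)`, two identities integrate the system: `E'` is a particular solution of
`y'' = Q y + Q' E`, which handles the forcing of the odd part by `q`, and `(Q E o - E' o')' = Q' E
o`, which gives the last component. The coefficient of `o` is fixed by the slope `ρ` at the centre,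
where `E'' = -κ²`. -/
lemma isProfile_linearProfile {κ b ρ q d : ℝ} (hκ : κ ≠ 0) (hb : b ≠ 0) {E E' o o' : ℝ → ℝ}
    (hE : IsLinearMode κ b d E E') (ho : IsLinearMode κ b d o o') :
    IsProfile ![0, 0, κ, d] (linearProfile κ b ρ q E E' o o') := by
  intro x hx
  obtain ⟨e0, e1⟩ := hE x hx
  obtain ⟨o0, o1⟩ := ho x hx
  have hQ : HasDerivAt (fun x : ℝ => κ ^ 2 * (b ^ 2 * x ^ 2 - 1)) (κ ^ 2 * (b ^ 2 * (2 * x))) x := by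
    have := (((hasDerivAt_pow 2 x).const_mul (b ^ 2)).sub_const 1).const_mul (κ ^ 2)
    simpa using this
  refine hasDerivWithinAt_pi.2 fun i => HasDerivAt.hasDerivWithinAt ?_
  fin_cases i
  · exact e0.congr_deriv (by simp [partsField, linearProfile])
  · exact e1.congr_deriv (by simp [partsField, linearProfile]; ring)
  · exact ((e1.const_mul _).add (o0.const_mul _)).congr_deriv (by
      simp [partsField, linearProfile])
  · exact (((hQ.mul e0).const_mul _).add (o1.const_mul _)).congr_deriv (by
      simp [partsField, linearProfile]; field_simp; ring)
  · exact ((hasDerivAt_id x).const_mul b).congr_deriv (by simp [partsField, linearProfile])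
  · exact (hasDerivAt_const x b).congr_deriv (by simp [partsField])
  · exact (hasDerivAt_const x q).congr_deriv (by simp [partsField])
  · exact ((((hasDerivAt_id x).mul (e0.pow 2)).const_mul q).add
      ((((hQ.mul e0).mul o0).sub (e1.mul o1)).const_mul _)).congr_deriv (by
        simp [partsField, linearProfile]; field_simp; ring)

lemma linearProfile_zero {κ b ρ q : ℝ} {E E' o o' : ℝ → ℝ} (hE : E 0 = 1) (hE' : E' 0 = 0)
    (ho : o 0 = 0) (ho' : o' 0 = 1) :
    linearProfile κ b ρ q E E' o o' 0 = centreState b ρ q := by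
  ext i
  fin_cases i <;> simp [linearProfile, centreState, hE, hE', ho, ho']

lemma flowsFrom_of_zero_amplitude {κ b d : ℝ} (hκ : κ ≠ 0) (hb : b ≠ 0) (hd : 0 < d) (ρ q : ℝ) :
    FlowsFrom timeField (centreState b ρ q, ![0, 0, κ, d]) := by
  obtain ⟨E, E', hE0, hE1, hE⟩ := exists_isLinearMode κ b d 1 0
  obtain ⟨o, o', ho0, ho1, ho⟩ := exists_isLinearMode κ b d 0 1
  have := ((isProfile_linearProfile (ρ := ρ) (q := q) hκ hb hE ho).flowsFrom hd).1
  rwa [linearProfile_zero hE0 hE1 ho0 ho1] at this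

lemma profile_eq_linearProfile {κ b d : ℝ} (hκ : κ ≠ 0) (hb : b ≠ 0) (hd : 0 < d) (ρ q : ℝ)
    {E E' o o' : ℝ → ℝ} (hE : IsLinearMode κ b d E E') (ho : IsLinearMode κ b d o o')
    (hE0 : E 0 = 1) (hE1 : E' 0 = 0) (ho0 : o 0 = 0) (ho1 : o' 0 = 1) :
    ∀ x ∈ Set.Icc (-d) d, profile (centreState b ρ q) ![0, 0, κ, d] x =
      linearProfile κ b ρ q E E' o o' x := by
  have := ((isProfile_linearProfile (ρ := ρ) (q := q) hκ hb hE ho).flowsFrom hd).2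
  rwa [linearProfile_zero hE0 hE1 ho0 ho1] at this

/-- At zero amplitude the coupled equations are still linear. -/
lemma exists_profile_of_zero_amplitude {κ b d : ℝ} (hκ : κ ≠ 0) (hb : b ≠ 0) (r q : ℝ) :
    ∃ (P : ℝ → Fin 8 → ℝ) (ψ ψ' : ℝ → ℝ), IsProfile ![0, 1, κ, d] P ∧ P 0 = centreState b r q ∧
      ψ 0 = 1 ∧ ψ' 0 = r ∧
      (∀ x ∈ Set.Icc (-d) d, HasDerivAt ψ (ψ' x) x ∧
        HasDerivAt ψ' (κ ^ 2 * ((b * x + q) ^ 2 - 1) * ψ x) x) ∧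
      (∀ x, P x 0 + P x 2 = ψ x ∧ P x 1 + P x 3 = ψ' x ∧ P x 5 = b ∧
        4 * b * P x 7 = (((b * x + q) ^ 2 - 1) * ψ x ^ 2 - ψ' x ^ 2 / κ ^ 2) -
          ((b * (-x) + q) ^ 2 - 1) * ψ (-x) ^ 2 + ψ' (-x) ^ 2 / κ ^ 2) := by
  obtain ⟨ψ, ψ', h0, h1, h⟩ := exists_linear_second_order
    (q := fun x => κ ^ 2 * ((b * x + q) ^ 2 - 1)) (by fun_prop) (R := |d| + 1) (by positivity) 1 r
  have hm : ∀ x ∈ Set.Icc (-d) d, HasDerivAt ψ (ψ' x) x ∧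
        HasDerivAt ψ' (κ ^ 2 * ((b * x + q) ^ 2 - 1) * ψ x) x := fun x hx =>
    h x ⟨by linarith [hx.1, le_abs_self d], by linarith [hx.2, le_abs_self d]⟩
  -- Multiplying the equation by `ψ'` shows `N' = 2b(bx + q)ψ²`. Since `m'` is the even part of `(bx
  -- + q)ψ²`, the component `m` is the odd part of `N` divided by `2b`.
  let N : ℝ → ℝ := fun x => ((b * x + q) ^ 2 - 1) * ψ x ^ 2 - ψ' x ^ 2 / κ ^ 2
  have hN : ∀ x ∈ Set.Icc (-d) d, HasDerivAt N (2 * b * ((b * x + q) * ψ x ^ 2)) x := by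
    intro x hx
    obtain ⟨p0, p1⟩ := hm x hx
    have hQ : HasDerivAt (fun x : ℝ => (b * x + q) ^ 2 - 1) (2 * (b * x + q) * b) x := by
      have := ((((hasDerivAt_id x).const_mul b).add_const q).pow 2).sub_const 1
      simpa using this
    exact ((hQ.mul (p0.pow 2)).sub ((p1.pow 2).div_const (κ ^ 2))).congr_deriv (by
      simp; field_simp; ring)
  have hneg {f f' : ℝ → ℝ} (hf : ∀ x ∈ Set.Icc (-d) d, HasDerivAt f (f' x) x) (x : ℝ)
      (hx : x ∈ Set.Icc (-d) d) : HasDerivAt (fun x => f (-x)) (-f' (-x)) x := by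
    have := (hf (-x) (neg_mem_slab hx)).scomp x (hasDerivAt_neg x)
    exact this.congr_deriv (by simp)
  refine ⟨fun x => ![(ψ x + ψ (-x)) / 2, (ψ' x - ψ' (-x)) / 2, (ψ x - ψ (-x)) / 2,
    (ψ' x + ψ' (-x)) / 2, b * x, b, q, (N x - N (-x)) / (4 * b)], ψ, ψ', fun x hx => ?_, ?_, h0, h1,
    hm, fun x => ?_⟩
  · have hx : x ∈ Set.Icc (-d) d := hx
    obtain ⟨p0, p1⟩ := hm x hx
    have p0n := hneg (fun x hx => (hm x hx).1) x hx
    have p1n := hneg (fun x hx => (hm x hx).2) x hx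
    refine hasDerivWithinAt_pi.2 fun i => HasDerivAt.hasDerivWithinAt ?_
    fin_cases i
    · exact ((p0.add p0n).div_const _).congr_deriv (by simp [partsField]; ring)
    · exact ((p1.sub p1n).div_const _).congr_deriv (by simp [partsField]; ring)
    · exact ((p0.sub p0n).div_const _).congr_deriv (by simp [partsField])
    · exact ((p1.add p1n).div_const _).congr_deriv (by simp [partsField]; ring)
    · exact ((hasDerivAt_id x).const_mul b).congr_deriv (by simp [partsField])
    · exact (hasDerivAt_const x b).congr_deriv (by simp [partsField])
    · exact (hasDerivAt_const x q).congr_deriv (by simp [partsField])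
    · exact (((hN x hx).sub (hneg hN x hx)).div_const _).congr_deriv (by
        simp [partsField]; field_simp; ring)
  · ext i
    fin_cases i <;> simp [centreState, h0, h1]
  · refine ⟨by simp; ring, by simp; ring, by simp, ?_⟩
    simp [N]
    field_simp
    ring

/-! ### Monotonicity criteria and Sturm comparison. -/

section Sturm

lemma monotoneOn_Icc_of_hasDerivWithinAt {a b : ℝ} {f f' : ℝ → ℝ}
    (hf : ∀ x ∈ Set.Icc a b, HasDerivWithinAt f (f' x) (Set.Icc a b) x)
    (h : ∀ x ∈ Set.Ioo a b, 0 ≤ f' x) : MonotoneOn f (Set.Icc a b) := by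
  refine monotoneOn_of_hasDerivWithinAt_nonneg (convex_Icc a b)
    (fun x hx => (hf x hx).continuousWithinAt) (f' := f') (fun x hx => ?_) (fun x hx => ?_)
  · exact (hf x (interior_subset hx)).mono interior_subset
  · rw [interior_Icc] at hx; exact h x hx

lemma strictMonoOn_Icc_of_hasDerivWithinAt {a b : ℝ} {f f' : ℝ → ℝ}
    (hf : ∀ x ∈ Set.Icc a b, HasDerivWithinAt f (f' x) (Set.Icc a b) x)
    (h : ∀ x ∈ Set.Ioo a b, 0 < f' x) : StrictMonoOn f (Set.Icc a b) := by
  refine strictMonoOn_of_hasDerivWithinAt_pos (convex_Icc a b)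
    (fun x hx => (hf x hx).continuousWithinAt) (f' := f') (fun x hx => ?_) (fun x hx => ?_)
  · exact (hf x (interior_subset hx)).mono interior_subset
  · rw [interior_Icc] at hx; exact h x hx

lemma eq_of_hasDerivWithinAt_zero {a b : ℝ} {f f' : ℝ → ℝ}
    (hf : ∀ x ∈ Set.Icc a b, HasDerivWithinAt f (f' x) (Set.Icc a b) x)
    (h : ∀ x ∈ Set.Ioo a b, f' x = 0) {x y : ℝ} (hx : x ∈ Set.Icc a b) (hy : y ∈ Set.Icc a b) :
    f x = f y := by
  have h1 := monotoneOn_Icc_of_hasDerivWithinAt hf fun x hx => (h x hx).ge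
  have h2 := monotoneOn_Icc_of_hasDerivWithinAt (fun x hx => (hf x hx).neg)
    fun x hx => (neg_nonneg.2 (h x hx).le)
  rcases le_total x y with hxy | hxy
  · exact le_antisymm (h1 hx hy hxy) (neg_le_neg_iff.1 (h2 hx hy hxy))
  · exact le_antisymm (neg_le_neg_iff.1 (h2 hy hx hxy)) (h1 hy hx hxy)

/-- Sturm comparison: if `y'' = Q y` and `g'' = q g` with `q ≤ Q` and `g > 0`, and
`y / g` is positive and nondecreasing initially, it remains so. -/
lemma sturm_comparison {a b : ℝ} {y y' g g' Q q : ℝ → ℝ}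
    (hy : ∀ x ∈ Set.Icc a b, HasDerivWithinAt y (y' x) (Set.Icc a b) x)
    (hy' : ∀ x ∈ Set.Icc a b, HasDerivWithinAt y' (Q x * y x) (Set.Icc a b) x)
    (hg : ∀ x ∈ Set.Icc a b, HasDerivWithinAt g (g' x) (Set.Icc a b) x)
    (hg' : ∀ x ∈ Set.Icc a b, HasDerivWithinAt g' (q x * g x) (Set.Icc a b) x)
    (hqQ : ∀ x ∈ Set.Icc a b, q x ≤ Q x) (hgpos : ∀ x ∈ Set.Icc a b, 0 < g x)
    (ha : 0 < y a) (hW : 0 ≤ y' a * g a - y a * g' a) {x : ℝ} (hx : x ∈ Set.Icc a b) :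
    0 < y x ∧ y' a * g a - y a * g' a ≤ y' x * g x - y x * g' x := by
  have hWd : ∀ x ∈ Set.Icc a b, HasDerivWithinAt (fun x => y' x * g x - y x * g' x)
      ((Q x - q x) * (y x * g x)) (Set.Icc a b) x := fun x hx =>
    (((hy' x hx).mul (hg x hx)).sub ((hy x hx).mul (hg' x hx))).congr_deriv (by ring)
  have hrd : ∀ x ∈ Set.Icc a b, HasDerivWithinAt (fun x => y x / g x)
      ((y' x * g x - y x * g' x) / g x ^ 2) (Set.Icc a b) x := fun x hx =>
    (hy x hx).div (hg x hx) (hgpos x hx).ne'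
  -- As long as `y > 0` the Wronskian does not decrease, so neither does `y / g`; this bounds `y`
  -- away from zero up to and including `c`.
  have step : ∀ c ∈ Set.Icc a b, (∀ x ∈ Set.Ioo a c, 0 < y x) →
      ∀ x ∈ Set.Icc a c, 0 < y x ∧ y' a * g a - y a * g' a ≤ y' x * g x - y x * g' x := by
    intro c hc hpos x hx
    have hsub : Set.Icc a c ⊆ Set.Icc a b := Set.Icc_subset_Icc_right hc.2
    have hac : a ≤ c := hc.1
    have hmW := monotoneOn_Icc_of_hasDerivWithinAt (fun x hx => (hWd x (hsub hx)).mono hsub)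
      (fun x hx => by
        have hx' := hsub (Set.Ioo_subset_Icc_self hx)
        have := hpos x hx
        have := hgpos x hx'
        have := sub_nonneg.2 (hqQ x hx')
        positivity)
    have hWx : ∀ x ∈ Set.Icc a c, y' a * g a - y a * g' a ≤ y' x * g x - y x * g' x :=
      fun x hx => hmW ⟨le_rfl, hac⟩ hx hx.1
    have hmr := monotoneOn_Icc_of_hasDerivWithinAt (fun x hx => (hrd x (hsub hx)).mono hsub)
      (fun x hx => div_nonneg (hW.trans (hWx x (Set.Ioo_subset_Icc_self hx))) (by positivity))
    have h1 : y a / g a ≤ y x / g x := hmr ⟨le_rfl, hac⟩ hx hx.1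
    have h2 : 0 < y a / g a := div_pos ha (hgpos a (hsub ⟨le_rfl, hac⟩))
    exact ⟨(div_pos_iff_of_pos_right (hgpos x (hsub hx))).1 (h2.trans_le h1), hWx x hx⟩
  have hall : ∀ x ∈ Set.Icc a b, 0 < y x := by
    by_contra! hcon
    -- At a first point where `y ≤ 0`, the previous step would still give `y > 0`.
    set S := Set.Icc a b ∩ y ⁻¹' Set.Iic 0
    have hSc : IsClosed S := ContinuousOn.preimage_isClosed_of_isClosed
      (fun x hx => (hy x hx).continuousWithinAt) isClosed_Icc isClosed_Iic
    have hSn : S.Nonempty := hcon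
    have hSb : BddBelow S := ⟨a, fun x hx => hx.1.1⟩
    have hmem : sInf S ∈ S := hSc.csInf_mem hSn hSb
    refine absurd (step (sInf S) hmem.1 (fun x hx => ?_) (sInf S) ⟨hmem.1.1, le_rfl⟩).1
      (not_lt.2 hmem.2)
    by_contra hx0
    exact absurd (csInf_le hSb (show x ∈ S from ⟨⟨hx.1.le, hx.2.le.trans hmem.1.2⟩, not_lt.1 hx0⟩))
      (not_le.2 hx.2)
  exact step b ⟨hx.1.trans hx.2, le_rfl⟩ (fun x hx => hall x (Set.Ioo_subset_Icc_self hx)) x hx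

end Sturm

/-! ### Uniqueness and parity of linear modes. -/

/-- Two positive solutions of the linearized problem at the same `c` coincide. -/
lemma IsNormalMode.unique {κ d c h₁ h₂ : ℝ} {ψ₁ ψ₂ : ℝ → ℝ} (hκ : 0 < κ) (hd : 0 < d)
    (hh₁ : 0 < h₁) (hh₂ : 0 < h₂) (H₁ : IsNormalMode κ d c h₁ ψ₁) (H₂ : IsNormalMode κ d c h₂ ψ₂) :
    h₁ = h₂ ∧ Set.EqOn ψ₁ ψ₂ (Set.Icc (-d) d) := by
  have hdd : d ∈ Set.Icc (-d) d := ⟨by linarith, le_rfl⟩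
  have hdn : -d ∈ Set.Icc (-d) d := neg_mem_slab hdd
  have key : ∀ {h₁ h₂ : ℝ} {ψ₁ ψ₂ : ℝ → ℝ}, 0 < h₁ → h₁ ≤ h₂ → IsNormalMode κ d c h₁ ψ₁ →
      IsNormalMode κ d c h₂ ψ₂ → h₁ = h₂ ∧ Set.EqOn ψ₁ ψ₂ (Set.Icc (-d) d) := by
    intro h₁ h₂ ψ₁ ψ₂ hpos hle H₁ H₂
    -- The Wronskian vanishes at both ends by the Neumann conditions and is monotone when `h₁ ≤ h₂`,
    -- so it vanishes throughout.
    have hWd : ∀ x ∈ Set.Icc (-d) d, HasDerivWithinAt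
        (fun x => slabDeriv d ψ₂ x * ψ₁ x - ψ₂ x * slabDeriv d ψ₁ x)
        (κ ^ 2 * ((h₂ ^ 2 - h₁ ^ 2) * (x + c) ^ 2) * (ψ₁ x * ψ₂ x)) (Set.Icc (-d) d) x :=
      fun x hx => (((H₂.eq_psi.2 x hx).mul (H₁.eq_psi.hasDerivWithinAt hx)).sub
        ((H₂.eq_psi.hasDerivWithinAt hx).mul (H₁.eq_psi.2 x hx))).congr_deriv (by ring)
    have hsq : 0 ≤ h₂ ^ 2 - h₁ ^ 2 := by nlinarith
    have hnn : ∀ x ∈ Set.Icc (-d) d,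
        0 ≤ κ ^ 2 * ((h₂ ^ 2 - h₁ ^ 2) * (x + c) ^ 2) * (ψ₁ x * ψ₂ x) := fun x hx => by
      have := H₁.pos x hx
      have := H₂.pos x hx
      positivity
    have hmono := monotoneOn_Icc_of_hasDerivWithinAt hWd fun x hx => hnn x (Ioo_subset_Icc_self hx)
    have hW0 : ∀ x ∈ Set.Icc (-d) d,
        slabDeriv d ψ₂ x * ψ₁ x - ψ₂ x * slabDeriv d ψ₁ x = 0 := fun x hx => by
      have e1 := hmono hdn hx hx.1
      have e2 := hmono hx hdd hx.2
      simp only [H₁.psi_left, H₂.psi_left, H₁.psi_right, H₂.psi_right] at e1 e2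
      linarith
    constructor
    · by_contra hne
      have hsq' : 0 < h₂ ^ 2 - h₁ ^ 2 := by
        have : h₁ < h₂ := lt_of_le_of_ne hle hne
        nlinarith
      have hsm : ∀ a b : ℝ, -d ≤ a → a < b → b ≤ d → (∀ x ∈ Set.Ioo a b, x + c ≠ 0) → False := by
        intro a b ha hab hb hne
        have hsub : Set.Icc a b ⊆ Set.Icc (-d) d := Set.Icc_subset_Icc ha hb
        have := strictMonoOn_Icc_of_hasDerivWithinAt (fun x hx => (hWd x (hsub hx)).mono hsub)
          (fun x hx => by
            have := H₁.pos x (hsub (Ioo_subset_Icc_self hx))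
            have := H₂.pos x (hsub (Ioo_subset_Icc_self hx))
            have : 0 < (x + c) ^ 2 := by have := hne x hx; positivity
            positivity)
        have h1 := this (Set.left_mem_Icc.2 hab.le) (Set.right_mem_Icc.2 hab.le) hab
        simp only [hW0 a (hsub (Set.left_mem_Icc.2 hab.le)),
          hW0 b (hsub (Set.right_mem_Icc.2 hab.le))] at h1
        exact lt_irrefl _ h1
      -- The zero `-c` of `x + c` misses one of the half slabs, on which a strict inequality between
      -- the fields would make the Wronskian strictly increasing.
      rcases le_or_gt 0 c with hc | hc
      · exact hsm 0 d (by linarith) hd le_rfl fun x hx => by linarith [hx.1]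
      · exact hsm (-d) 0 le_rfl (by linarith) hd.le fun x hx => by linarith [hx.2]
    · intro x hx
      have hrd : ∀ x ∈ Set.Icc (-d) d, HasDerivWithinAt (fun x => ψ₂ x / ψ₁ x) 0
          (Set.Icc (-d) d) x := fun x hx =>
        ((H₂.eq_psi.hasDerivWithinAt hx).div (H₁.eq_psi.hasDerivWithinAt hx)
          (H₁.pos x hx).ne').congr_deriv (by rw [hW0 x hx, zero_div])
      have := eq_of_hasDerivWithinAt_zero hrd (fun _ _ => rfl) hx hdn
      simp only [H₁.psi_init, H₂.psi_init, div_one] at this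
      exact ((div_eq_one_iff_eq (H₁.pos x hx).ne').1 this).symm
  rcases le_total h₁ h₂ with hle | hle
  · exact key hh₁ hle H₁ H₂
  · obtain ⟨e1, e2⟩ := key hh₂ hle H₂ H₁
    exact ⟨e1.symm, e2.symm⟩

lemma IsNormalMode.normalPair_eq {κ d c h : ℝ} {ψ : ℝ → ℝ} (hκ : 0 < κ) (hd : 0 < d) (hh : 0 < h)
    (H : IsNormalMode κ d c h ψ) :
    criticalField κ d c = h ∧ Set.EqOn (normalMode κ d c) ψ (Set.Icc (-d) d) := by
  have hs : 0 < (normalPair κ d c).1 ∧ IsNormalMode κ d c (normalPair κ d c).1 (normalPair κ d c).2 :=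
    Classical.epsilon_spec (p := fun p : ℝ × (ℝ → ℝ) => 0 < p.1 ∧ IsNormalMode κ d c p.1 p.2)
      ⟨(h, ψ), hh, H⟩
  exact hs.2.unique hκ hd hs.1 hh H

/-- A linear mode is the even component of a profile with `σ = ζ = 0` and no asymmetric part, so
uniqueness of profiles applies. -/
lemma IsLinearMode.unique {κ b R : ℝ} (hR : 0 < R) {y y' z z' : ℝ → ℝ}
    (hy : IsLinearMode κ b R y y') (hz : IsLinearMode κ b R z z')
    (h0 : y 0 = z 0) (h1 : y' 0 = z' 0) {x : ℝ} (hx : x ∈ Set.Icc (-R) R) :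
    y x = z x ∧ y' x = z' x := by
  let P : (ℝ → ℝ) → (ℝ → ℝ) → ℝ → Fin 8 → ℝ := fun y y' x => ![y x, y' x, 0, 0, b * x, b, 0, 0]
  have hP : ∀ {y y' : ℝ → ℝ}, IsLinearMode κ b R y y' → IsProfile ![0, 0, κ, R] (P y y') := by
    intro y y' hy x hx
    obtain ⟨e0, e1⟩ := hy x hx
    refine hasDerivWithinAt_pi.2 fun i => HasDerivAt.hasDerivWithinAt ?_
    fin_cases i
    · exact e0.congr_deriv (by simp [partsField, P])
    · exact e1.congr_deriv (by simp [partsField, P]; ring)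
    · exact (hasDerivAt_const x (0 : ℝ)).congr_deriv (by simp [partsField, P])
    · exact (hasDerivAt_const x (0 : ℝ)).congr_deriv (by simp [partsField, P])
    · exact ((hasDerivAt_id x).const_mul b).congr_deriv (by simp [partsField, P])
    · exact (hasDerivAt_const x b).congr_deriv (by simp [partsField, P])
    · exact (hasDerivAt_const x (0 : ℝ)).congr_deriv (by simp [partsField, P])
    · exact (hasDerivAt_const x (0 : ℝ)).congr_deriv (by simp [partsField, P])
  have := (hP hy).eqOn hR (hP hz) (by simp [P, h0, h1]) hx
  exact ⟨congrFun this 0, congrFun this 1⟩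

lemma IsLinearMode.mono {κ b R R' : ℝ} (hR : R' ≤ R) {y y' : ℝ → ℝ}
    (hy : IsLinearMode κ b R y y') : IsLinearMode κ b R' y y' := fun x hx =>
  hy x ⟨by linarith [hx.1], by linarith [hx.2]⟩

lemma IsLinearMode.comp_neg {κ b R : ℝ} {y y' : ℝ → ℝ} (hy : IsLinearMode κ b R y y') :
    IsLinearMode κ b R (fun x => y (-x)) (fun x => -y' (-x)) := fun x hx => by
  obtain ⟨h0, h1⟩ := hy (-x) (neg_mem_slab hx)
  have h0' := h0.scomp x (hasDerivAt_neg x)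
  have h1' := (h1.scomp x (hasDerivAt_neg x)).neg
  exact ⟨h0'.congr_deriv (by simp), h1'.congr_deriv (by simp)⟩

lemma IsLinearMode.const_mul {κ b R : ℝ} {y y' : ℝ → ℝ} (c : ℝ) (hy : IsLinearMode κ b R y y') :
    IsLinearMode κ b R (fun x => c * y x) (fun x => c * y' x) := fun x hx =>
  ⟨(hy x hx).1.const_mul c, ((hy x hx).2.const_mul c).congr_deriv (by ring)⟩

lemma IsLinearMode.even {κ b R : ℝ} (hR : 0 < R) {y y' : ℝ → ℝ} (hy : IsLinearMode κ b R y y')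
    (h : y' 0 = 0) {x : ℝ} (hx : x ∈ Set.Icc (-R) R) : y (-x) = y x ∧ y' (-x) = -y' x := by
  have := hy.comp_neg.unique hR hy (by simp) (by simp [h]) hx
  exact ⟨this.1, by linarith [this.2]⟩

lemma IsLinearMode.odd {κ b R : ℝ} (hR : 0 < R) {y y' : ℝ → ℝ} (hy : IsLinearMode κ b R y y')
    (h : y 0 = 0) {x : ℝ} (hx : x ∈ Set.Icc (-R) R) : y (-x) = -y x ∧ y' (-x) = y' x := by
  have := hy.comp_neg.unique hR (hy.const_mul (-1)) (by simp [h]) (by simp) hx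
  exact ⟨by linarith [this.1], by linarith [this.2]⟩

/-! ### Existence of the critical field. -/

lemma hasDerivAt_gaussian (k x : ℝ) :
    HasDerivAt (fun x => Real.exp (-(k * x ^ 2 / 2))) (-(k * x) * Real.exp (-(k * x ^ 2 / 2))) x := by
  have h : HasDerivAt (fun x : ℝ => -(k * x ^ 2 / 2)) (-(k * x)) x := by
    have := (((hasDerivAt_pow 2 x).const_mul k).div_const 2).neg
    exact this.congr_deriv (by simp; ring)
  exact h.exp.congr_deriv (by ring)

lemma hasDerivAt_gaussian' (k x : ℝ) :
    HasDerivAt (fun x => -(k * x) * Real.exp (-(k * x ^ 2 / 2)))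
      ((k ^ 2 * x ^ 2 - k) * Real.exp (-(k * x ^ 2 / 2))) x := by
  have h : HasDerivAt (fun x : ℝ => -(k * x)) (-k) x := by
    exact (((hasDerivAt_id x).const_mul k).neg).congr_deriv (by simp)
  exact (h.mul (hasDerivAt_gaussian k x)).congr_deriv (by ring)

/-- Above `κ` the even solution is positive. -/
lemma IsLinearMode.even_pos {κ b R : ℝ} (hκ : 0 < κ) (hb : κ ≤ b) (hR : 0 < R) {E E' : ℝ → ℝ}
    (hE : IsLinearMode κ b R E E') (h0 : E 0 = 1) (h1 : E' 0 = 0) {x : ℝ}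
    (hx : x ∈ Set.Icc (-R) R) : 0 < E x := by
  have key : ∀ x ∈ Set.Icc 0 R, 0 < E x := fun x hx => by
    have hsub : ∀ x ∈ Set.Icc 0 R, x ∈ Set.Icc (-R) R := fun x hx => ⟨by linarith [hx.1], hx.2⟩
    -- Comparison with `exp(-κbx²/2)`, whose potential `κ²b²x² - κb` lies below `κ²(b²x² - 1)`
    -- exactly because `κ ≤ b`.
    refine (sturm_comparison (a := 0) (b := R) (y := E) (y' := E')
      (Q := fun x => κ ^ 2 * (b ^ 2 * x ^ 2 - 1)) (q := fun x => (κ * b) ^ 2 * x ^ 2 - κ * b)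
      (fun x hx => (hE x (hsub x hx)).1.hasDerivWithinAt)
      (fun x hx => (hE x (hsub x hx)).2.hasDerivWithinAt)
      (fun x _ => (hasDerivAt_gaussian (κ * b) x).hasDerivWithinAt)
      (fun x _ => (hasDerivAt_gaussian' (κ * b) x).hasDerivWithinAt)
      (fun x _ => by nlinarith) (fun x _ => Real.exp_pos _) (by rw [h0]; exact one_pos)
      (by simp [h1]) hx).1
  rcases le_total 0 x with h | h
  · exact key x ⟨h, hx.2⟩
  · rw [← (hE.even hR h1 hx).1]
    exact key (-x) ⟨by linarith, by linarith [hx.1]⟩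

/-- For a field above `κ` depending only on `κ` and `d`, the even solution increases at `d`. -/
lemma exists_even_deriv_pos {κ d : ℝ} (hκ : 0 < κ) (hd : 0 < d) :
    ∃ H, κ < H ∧ ∀ E E' : ℝ → ℝ, IsLinearMode κ H d E E' → E 0 = 1 → E' 0 = 0 → 0 < E' d := by
  -- The comparison function is `g = 1 - κ²x² + cx⁴`. The first summand of `c` ensures `g ≥ 1/2`,
  -- the second `g'(d) > 0`.
  set c := κ ^ 4 / 2 + κ ^ 2 / d ^ 2 with hc
  have hcpos : 0 < c := by positivity
  have hc1 : κ ^ 4 ≤ 2 * c := by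
    have : 0 ≤ κ ^ 2 / d ^ 2 := by positivity
    linarith
  have hc2 : κ ^ 2 < c * d ^ 2 := by
    have : c * d ^ 2 = κ ^ 4 / 2 * d ^ 2 + κ ^ 2 := by rw [hc]; field_simp
    have h2 : 0 < κ ^ 4 / 2 * d ^ 2 := by positivity
    linarith
  -- Large enough for `g'' ≤ κ²(H²x² - 1) g` on `[0, d]`, using `g ≥ 1/2` on the term with `H`.
  set H := κ + 1 + 2 * (12 * c + κ ^ 2 * c * d ^ 2) / κ ^ 2 with hH
  have hX : 0 < 2 * (12 * c + κ ^ 2 * c * d ^ 2) / κ ^ 2 := by positivity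
  have hH2 : 2 * (12 * c + κ ^ 2 * c * d ^ 2) ≤ κ ^ 2 * H ^ 2 := by
    have h1 : 2 * (12 * c + κ ^ 2 * c * d ^ 2) / κ ^ 2 ≤ H ^ 2 := by nlinarith
    rw [div_le_iff₀ (by positivity)] at h1
    linarith
  refine ⟨H, by linarith, fun E E' hE h0 h1 => ?_⟩
  have hg : ∀ x : ℝ, HasDerivAt (fun x : ℝ => 1 - κ ^ 2 * x ^ 2 + c * x ^ 4)
      (-(2 * κ ^ 2 * x) + 4 * c * x ^ 3) x := fun x => by
    have := (((hasDerivAt_pow 2 x).const_mul (κ ^ 2)).const_sub 1).add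
      ((hasDerivAt_pow 4 x).const_mul c)
    exact this.congr_deriv (by simp; ring)
  have hg' : ∀ x : ℝ, HasDerivAt (fun x : ℝ => -(2 * κ ^ 2 * x) + 4 * c * x ^ 3)
      (-(2 * κ ^ 2) + 12 * c * x ^ 2) x := fun x => by
    have := (((hasDerivAt_id x).const_mul (2 * κ ^ 2)).neg).add
      ((hasDerivAt_pow 3 x).const_mul (4 * c))
    exact this.congr_deriv (by simp; ring)
  have hgpos : ∀ x : ℝ, 1 / 2 ≤ 1 - κ ^ 2 * x ^ 2 + c * x ^ 4 := fun x => by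
    nlinarith [sq_nonneg (κ ^ 2 * x ^ 2 - 1), mul_le_mul_of_nonneg_right hc1 (by positivity : 0 ≤ x ^ 4)]
  have hgpos' : ∀ x : ℝ, 0 < 1 - κ ^ 2 * x ^ 2 + c * x ^ 4 := fun x => by linarith [hgpos x]
  have hsub : ∀ x ∈ Set.Icc 0 d, x ∈ Set.Icc (-d) d := fun x hx => ⟨by linarith [hx.1], hx.2⟩
  have hW := sturm_comparison (a := 0) (b := d) (y := E) (y' := E')
    (Q := fun x => κ ^ 2 * (H ^ 2 * x ^ 2 - 1))
    (q := fun x => (-(2 * κ ^ 2) + 12 * c * x ^ 2) / (1 - κ ^ 2 * x ^ 2 + c * x ^ 4))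
    (fun x hx => (hE x (hsub x hx)).1.hasDerivWithinAt)
    (fun x hx => (hE x (hsub x hx)).2.hasDerivWithinAt)
    (fun x _ => (hg x).hasDerivWithinAt)
    (fun x _ => ((hg' x).hasDerivWithinAt.congr_deriv (div_mul_cancel₀ _ (hgpos' x).ne').symm))
    (fun x hx => by
      rw [div_le_iff₀ (hgpos' x)]
      have hx2 : 0 ≤ x ^ 2 := sq_nonneg x
      have hxd : x ^ 2 ≤ d ^ 2 := by nlinarith [hx.1, hx.2]
      have e1 : κ ^ 2 * (H ^ 2 * x ^ 2) * (1 / 2) ≤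
          κ ^ 2 * (H ^ 2 * x ^ 2) * (1 - κ ^ 2 * x ^ 2 + c * x ^ 4) :=
        mul_le_mul_of_nonneg_left (hgpos x) (by positivity)
      have e2 : 2 * (12 * c + κ ^ 2 * c * d ^ 2) * x ^ 2 ≤ κ ^ 2 * H ^ 2 * x ^ 2 :=
        mul_le_mul_of_nonneg_right hH2 hx2
      have e3 : κ ^ 2 * c * x ^ 2 * x ^ 2 ≤ κ ^ 2 * c * x ^ 2 * d ^ 2 :=
        mul_le_mul_of_nonneg_left hxd (by positivity)
      have e4 : 0 ≤ κ ^ 2 * (κ ^ 2 * x ^ 2) := by positivity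
      nlinarith)
    (fun x _ => hgpos' x) (by rw [h0]; exact one_pos) (by simp [h1])
    (x := d) ⟨hd.le, le_rfl⟩
  have h2 : 0 < -(2 * κ ^ 2 * d) + 4 * c * d ^ 3 := by nlinarith
  have h3 := hW.2
  simp only [h1, h0] at h3
  have h4 := mul_pos hW.1 h2
  have h5 : 0 < E' d * (1 - κ ^ 2 * d ^ 2 + c * d ^ 4) := by
    norm_num at h3
    linarith
  exact (pos_iff_pos_of_mul_pos h5).2 (hgpos' d)

/-- The state at the right end of the slab. -/
noncomputable def endState (y : Fin 8 → ℝ) (p : Fin 4 → ℝ) : Fin 8 → ℝ :=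
  (flow timeField (y, p) (clampTime 1)).1

lemma endState_eq {y : Fin 8 → ℝ} {p : Fin 4 → ℝ} (hp : p 3 ≠ 0) :
    endState y p = profile y p (p 3) := by
  rw [endState, profile, div_self hp]

lemma hasStrictFDerivAt_endState {y : Fin 8 → ℝ} {p : Fin 4 → ℝ}
    (h : FlowsFrom timeField (y, p)) :
    ∃ L : (Fin 8 → ℝ) × (Fin 4 → ℝ) →L[ℝ] (Fin 8 → ℝ),
      HasStrictFDerivAt (fun w : (Fin 8 → ℝ) × (Fin 4 → ℝ) => endState w.1 w.2) L (y, p) := by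
  obtain ⟨L, hL⟩ := h.hasStrictFDerivAt contDiff_timeField
  let ev : C(TimeInterval, (Fin 8 → ℝ) × (Fin 4 → ℝ)) →L[ℝ] (Fin 8 → ℝ) × (Fin 4 → ℝ) :=
    ContinuousMap.evalCLM ℝ (clampTime 1)
  exact ⟨_, ((ContinuousLinearMap.fst ℝ (Fin 8 → ℝ) (Fin 4 → ℝ)).comp ev).hasStrictFDerivAt.comp
    (y, p) hL⟩

/-- The even solution `E` and the odd solution `o` of `y'' = κ² (h² x² - 1) y` on `[-R, R]`, when
`E` is positive with `E' = 0` at the ends of the slab `[-d, d]`. -/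
structure CriticalModes (κ h d R : ℝ) (E E' o o' : ℝ → ℝ) : Prop where
  kappa_pos : 0 < κ
  kappa_lt : κ < h
  d_pos : 0 < d
  le : d ≤ R
  modeE : IsLinearMode κ h R E E'
  modeo : IsLinearMode κ h R o o'
  E_zero : E 0 = 1
  E'_zero : E' 0 = 0
  o_zero : o 0 = 0
  o'_zero : o' 0 = 1
  E_pos : ∀ x ∈ Set.Icc (-d) d, 0 < E x
  E'_end : E' d = 0

/-- Shooting in the field `b`: at `b = κ` the even solution is a Gaussian, decreasing at `d`; for
large `b` it increases there. The intermediate value theorem gives a zero of the end slope, and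
positivity holds for every `b ≥ κ`. -/
lemma exists_critical {κ d : ℝ} (hκ : 0 < κ) (hd : 0 < d) :
    ∃ h, κ < h ∧ ∃ E E' : ℝ → ℝ, IsLinearMode κ h d E E' ∧ E 0 = 1 ∧ E' 0 = 0 ∧
      (∀ x ∈ Set.Icc (-d) d, 0 < E x) ∧ E' d = 0 := by
  let T : ℝ → ℝ := fun b => endState (centreState b 0 0) ![0, 0, κ, d] 1
  have hdd : d ∈ Set.Icc (-d) d := ⟨by linarith, le_rfl⟩
  have hT : ∀ b, 0 < b → ∀ E E' : ℝ → ℝ, IsLinearMode κ b d E E' → E 0 = 1 → E' 0 = 0 →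
      T b = E' d := by
    intro b hb E E' hE h0 h1
    obtain ⟨o, o', ho0, ho1, ho⟩ := exists_isLinearMode κ b d 0 1
    have := profile_eq_linearProfile hκ.ne' hb.ne' hd 0 0 hE ho h0 h1 ho0 ho1 d hdd
    show endState (centreState b 0 0) ![0, 0, κ, d] 1 = _
    rw [endState_eq (by simpa using hd.ne')]
    simp [this, linearProfile]
  obtain ⟨H, hκH, hH⟩ := exists_even_deriv_pos hκ hd
  have hcont : ContinuousOn T (Set.Icc κ H) := by
    intro b hb
    have hb0 : 0 < b := hκ.trans_le hb.1
    obtain ⟨L, hL⟩ := hasStrictFDerivAt_endState (flowsFrom_of_zero_amplitude hκ.ne' hb0.ne' hd 0 0)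
    have hc : Continuous fun b : ℝ => (centreState b 0 0, (![0, 0, κ, d] : Fin 4 → ℝ)) := by
      unfold centreState; fun_prop
    have := ContinuousAt.comp (f := fun b : ℝ => (centreState b 0 0, (![0, 0, κ, d] : Fin 4 → ℝ)))
      (x := b) hL.continuousAt hc.continuousAt
    exact ((continuous_apply (1 : Fin 8)).continuousAt.comp this).continuousWithinAt
  have hTκ : T κ < 0 := by
    have hg : IsLinearMode κ κ d (fun x => Real.exp (-((κ * κ) * x ^ 2 / 2)))
        (fun x => -((κ * κ) * x) * Real.exp (-((κ * κ) * x ^ 2 / 2))) := fun x _ =>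
      ⟨hasDerivAt_gaussian _ x, (hasDerivAt_gaussian' _ x).congr_deriv (by ring)⟩
    rw [hT κ hκ _ _ hg (by simp) (by simp)]
    have := Real.exp_pos (-((κ * κ) * d ^ 2 / 2))
    have : 0 < κ * κ * d := by positivity
    nlinarith
  obtain ⟨EH, EH', hEH0, hEH1, hEH⟩ := exists_isLinearMode κ H d 1 0
  have hTH : 0 < T H := by
    rw [hT H (hκ.trans hκH) _ _ hEH hEH0 hEH1]
    exact hH _ _ hEH hEH0 hEH1
  obtain ⟨h, hh, hTh⟩ := intermediate_value_Icc hκH.le hcont ⟨hTκ.le, hTH.le⟩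
  have hlt : κ < h := lt_of_le_of_ne hh.1 fun he => by rw [← he] at hTh; exact hTκ.ne hTh
  obtain ⟨E, E', h0, h1, hE⟩ := exists_isLinearMode κ h d 1 0
  exact ⟨h, hlt, E, E', hE, h0, h1, fun x hx => hE.even_pos hκ hlt.le hd h0 h1 hx,
    by rw [← hT h (hκ.trans hlt) E E' hE h0 h1, hTh]⟩

lemma IsLinearMode.isNormalMode {κ h d : ℝ} (hd : 0 < d) {E E' : ℝ → ℝ}
    (hE : IsLinearMode κ h d E E') (h1 : E' 0 = 0)
    (hpos : ∀ x ∈ Set.Icc (-d) d, 0 < E x) (hend : E' d = 0) :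
    IsNormalMode κ d 0 h (fun x => E x / E d) := by
  have hdd : d ∈ Set.Icc (-d) d := ⟨by linarith, le_rfl⟩
  have hdn : -d ∈ Set.Icc (-d) d := neg_mem_slab hdd
  have hne := (hpos d hdd).ne'
  obtain ⟨s1, s2⟩ := hasSecondDeriv_of_hasDerivWithinAt hd (f := fun x => E x / E d)
    (g := fun x => E' x / E d) (F := fun x => κ ^ 2 * (h ^ 2 * (x + 0) ^ 2 - 1) * (E x / E d))
    (fun x hx => ((hE x hx).1.div_const _).hasDerivWithinAt)
    (fun x hx => (((hE x hx).2.div_const _).congr_deriv (by ring)).hasDerivWithinAt)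
  obtain ⟨p1, p2⟩ := hE.even hd h1 hdd
  refine ⟨fun x hx => div_pos (hpos x hx) (hpos d hdd), s1, ?_, ?_, ?_⟩
  · simp only [p1, div_self hne]
  · rw [s2 _ hdn, p2, hend]; simp
  · rw [s2 _ hdd, hend]; simp

/-- The modes are needed beyond the slab, on `[-R, R]`, because slabs displaced by a shift will be
examined. On `[-d, d]` they agree with the critical ones by uniqueness. -/
theorem exists_criticalModes {κ d : ℝ} (hκ : 0 < κ) (hd : 0 < d) {R : ℝ} (hR : d ≤ R) :
    ∃ E E' o o' : ℝ → ℝ, CriticalModes κ (criticalField κ d 0) d R E E' o o' := by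
  obtain ⟨h, hlt, E, E', hE, h0, h1, hpos, hend⟩ := exists_critical hκ hd
  have hN := hE.isNormalMode hd h1 hpos hend
  rw [(hN.normalPair_eq hκ hd (hκ.trans hlt)).1]
  obtain ⟨F, F', f0, f1, hF⟩ := exists_isLinearMode κ h R 1 0
  obtain ⟨o, o', o0, o1, ho⟩ := exists_isLinearMode κ h R 0 1
  have hEF : ∀ x ∈ Set.Icc (-d) d, F x = E x ∧ F' x = E' x := fun x hx =>
    (hF.mono hR).unique hd hE (by rw [f0, h0]) (by rw [f1, h1]) hx
  exact ⟨F, F', o, o', hκ, hlt, hd, hR, hF, ho, f0, f1, o0, o1,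
    fun x hx => by rw [(hEF x hx).1]; exact hpos x hx,
    by rw [(hEF d ⟨by linarith, le_rfl⟩).2, hend]⟩

/-! ### Signs of the critical modes. -/

namespace CriticalModes

variable {κ h d R : ℝ} {E E' o o' : ℝ → ℝ}

lemma field_pos (M : CriticalModes κ h d R E E' o o') : 0 < h := M.kappa_pos.trans M.kappa_lt

lemma R_pos (M : CriticalModes κ h d R E E' o o') : 0 < R := M.d_pos.trans_le M.le

lemma wronskian (M : CriticalModes κ h d R E E' o o') {x : ℝ} (hx : x ∈ Set.Icc (-R) R) :
    E x * o' x - E' x * o x = 1 := by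
  have hd : ∀ x ∈ Set.Icc (-R) R, HasDerivWithinAt (fun x => E x * o' x - E' x * o x) 0
      (Set.Icc (-R) R) x := fun x hx =>
    ((((M.modeE x hx).1.mul (M.modeo x hx).2).sub
      ((M.modeE x hx).2.mul (M.modeo x hx).1)).congr_deriv (by ring)).hasDerivWithinAt
  have := eq_of_hasDerivWithinAt_zero hd (fun _ _ => rfl) hx
    (show (0 : ℝ) ∈ Set.Icc (-R) R from ⟨by linarith [M.R_pos], M.R_pos.le⟩)
  simpa [M.E_zero, M.E'_zero, M.o_zero, M.o'_zero] using this

lemma mem_of_nonneg (M : CriticalModes κ h d R E E' o o') {x : ℝ} (h0 : 0 ≤ x) (h1 : x ≤ d) :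
    x ∈ Set.Icc (-R) R :=
  ⟨by linarith [M.R_pos], h1.trans M.le⟩

lemma potential_neg (M : CriticalModes κ h d R E E' o o') {x : ℝ} (h0 : 0 ≤ x) (h1 : h * x < 1) :
    κ ^ 2 * (h ^ 2 * x ^ 2 - 1) < 0 := by
  have h2 : 0 ≤ h * x := mul_nonneg M.field_pos.le h0
  have h3 : h ^ 2 * x ^ 2 < 1 := by nlinarith
  have := pow_pos M.kappa_pos 2
  nlinarith

lemma potential_pos (M : CriticalModes κ h d R E E' o o') {x : ℝ} (h1 : 1 < h * x) :
    0 < κ ^ 2 * (h ^ 2 * x ^ 2 - 1) := by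
  have h3 : 1 < h ^ 2 * x ^ 2 := by nlinarith
  have := pow_pos M.kappa_pos 2
  nlinarith

/-- `E` is strictly concave where the potential is negative, that is for `hx < 1`, and `E'(0) = 0`.
-/
lemma E'_neg_of_le (M : CriticalModes κ h d R E E' o o') {c : ℝ} (hc : c ≤ d) (hhc : h * c ≤ 1)
    {x : ℝ} (hx : x ∈ Set.Ioc 0 c) : E' x < 0 := by
  have hm := strictMonoOn_Icc_of_hasDerivWithinAt (a := 0) (b := c) (f := fun x => -E' x)
    (fun x hx => ((M.modeE x (M.mem_of_nonneg hx.1 (hx.2.trans hc))).2.neg).hasDerivWithinAt)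
    (fun x hx => by
      have h1 := M.potential_neg hx.1.le
        ((mul_lt_mul_of_pos_left hx.2 M.field_pos).trans_le hhc)
      have h2 := M.E_pos x ⟨by linarith [hx.1, M.d_pos], hx.2.le.trans hc⟩
      rw [neg_pos]
      exact mul_neg_of_neg_of_pos h1 h2)
  have := hm ⟨le_rfl, hx.1.le.trans hx.2⟩ ⟨hx.1.le, hx.2⟩ hx.1
  simp only [M.E'_zero, neg_zero] at this
  linarith

lemma one_lt (M : CriticalModes κ h d R E E' o o') : 1 < h * d := by
  by_contra! hcon
  exact absurd M.E'_end (M.E'_neg_of_le le_rfl hcon ⟨M.d_pos, le_rfl⟩).ne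

/-- `E'` decreases from `0` until `1/h` and then increases back to `E'(d) = 0`. -/
lemma E'_neg (M : CriticalModes κ h d R E E' o o') {x : ℝ} (h0 : 0 < x) (h1 : x < d) :
    E' x < 0 := by
  rcases le_or_gt (h * x) 1 with hx | hx
  · exact M.E'_neg_of_le h1.le hx ⟨h0, le_rfl⟩
  · have hm := strictMonoOn_Icc_of_hasDerivWithinAt (a := x) (b := d) (f := E')
      (fun y hy => (M.modeE y (M.mem_of_nonneg (h0.le.trans hy.1) hy.2)).2.hasDerivWithinAt)
      (fun y hy => mul_pos (M.potential_pos (hx.trans (mul_lt_mul_of_pos_left hy.1 M.field_pos)))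
        (M.E_pos y ⟨by linarith [hy.1, M.d_pos], hy.2.le⟩))
    have := hm ⟨le_rfl, h1.le⟩ ⟨h1.le, le_rfl⟩ h1
    rwa [M.E'_end] at this

lemma E'_nonpos (M : CriticalModes κ h d R E E' o o') {x : ℝ} (h0 : 0 ≤ x) (h1 : x ≤ d) :
    E' x ≤ 0 := by
  rcases h0.eq_or_lt with rfl | h0
  · exact M.E'_zero.le
  rcases h1.eq_or_lt with rfl | h1
  · exact M.E'_end.le
  exact (M.E'_neg h0 h1).le

/-- By the Wronskian identity, `(o / E)' = 1 / E²`. -/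
lemma o_pos (M : CriticalModes κ h d R E E' o o') {x : ℝ} (h0 : 0 < x) (h1 : x ≤ d) : 0 < o x := by
  have hm := strictMonoOn_Icc_of_hasDerivWithinAt (a := 0) (b := d) (f := fun x => o x / E x)
    (f' := fun x => 1 / E x ^ 2) (fun y hy => by
      have hy' := M.mem_of_nonneg hy.1 hy.2
      have hE := M.E_pos y ⟨by linarith [hy.1, M.d_pos], hy.2⟩
      refine (((M.modeo y hy').1.div (M.modeE y hy').1 hE.ne').congr_deriv ?_).hasDerivWithinAt
      rw [← M.wronskian hy']
      ring)
    (fun y hy => by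
      have hE := M.E_pos y ⟨by linarith [hy.1, M.d_pos], hy.2.le⟩
      positivity)
  have := hm ⟨le_rfl, M.d_pos.le⟩ ⟨h0.le, h1⟩ h0
  simp only [M.o_zero, zero_div] at this
  exact (div_pos_iff_of_pos_right (M.E_pos x ⟨by linarith [M.d_pos], h1⟩)).1 this

/-- The quantity `o E'' - o' E'` vanishes at `0` and has derivative `2κ²h²x o E > 0`. For `hx ≤ 1`
its first term is nonpositive, so `o' E' < 0`, while `E' < 0`. -/
lemma o'_pos_of_le (M : CriticalModes κ h d R E E' o o') {x : ℝ} (h0 : 0 ≤ x) (h1 : h * x ≤ 1) :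
    0 < o' x := by
  rcases h0.eq_or_lt with rfl | h0
  · rw [M.o'_zero]; exact one_pos
  have hxd : x < d := by
    have := M.one_lt
    have := M.field_pos
    by_contra! hcon
    nlinarith
  have hm := strictMonoOn_Icc_of_hasDerivWithinAt (a := 0) (b := d)
    (f := fun x => o x * (κ ^ 2 * (h ^ 2 * x ^ 2 - 1) * E x) - o' x * E' x)
    (f' := fun x => 2 * κ ^ 2 * h ^ 2 * x * (o x * E x)) (fun y hy => by
      have hy' := M.mem_of_nonneg hy.1 hy.2
      have hQ : HasDerivAt (fun x : ℝ => κ ^ 2 * (h ^ 2 * x ^ 2 - 1))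
          (κ ^ 2 * (h ^ 2 * (2 * y))) y := by
        have := (((hasDerivAt_pow 2 y).const_mul (h ^ 2)).sub_const 1).const_mul (κ ^ 2)
        simpa using this
      obtain ⟨e0, e1⟩ := M.modeE y hy'
      obtain ⟨o0, o1⟩ := M.modeo y hy'
      exact (((o0.mul (hQ.mul e0)).sub (o1.mul e1)).congr_deriv (by
        simp; ring)).hasDerivWithinAt)
    (fun y hy => by
      have := M.E_pos y ⟨by linarith [hy.1, M.d_pos], hy.2.le⟩
      have := M.o_pos hy.1 hy.2.le
      have := M.kappa_pos
      have := M.field_pos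
      have := hy.1
      positivity)
  have h2 := hm ⟨le_rfl, M.d_pos.le⟩ ⟨h0.le, hxd.le⟩ h0
  simp only [M.o_zero, M.E'_zero, zero_mul, mul_zero, sub_zero] at h2
  have h3 : o x * (κ ^ 2 * (h ^ 2 * x ^ 2 - 1) * E x) ≤ 0 := by
    have hq : κ ^ 2 * (h ^ 2 * x ^ 2 - 1) ≤ 0 := by
      have : 0 ≤ h * x := mul_nonneg M.field_pos.le h0.le
      have : h ^ 2 * x ^ 2 ≤ 1 := by nlinarith
      have := sq_nonneg κ
      nlinarith
    exact mul_nonpos_of_nonneg_of_nonpos (M.o_pos h0 hxd.le).le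
      (mul_nonpos_of_nonpos_of_nonneg hq (M.E_pos x ⟨by linarith [M.d_pos], hxd.le⟩).le)
  have h4 := M.E'_neg h0 hxd
  nlinarith

/-- Beyond `1/h` the potential is nonnegative, so a positive increasing solution stays positive and
increasing, also outside the slab; comparison with the constant `1` makes this precise. -/
lemma o_o'_pos (M : CriticalModes κ h d R E E' o o') {x : ℝ} (h0 : 0 < x) (h1 : x ≤ R) :
    0 < o x ∧ 0 < o' x := by
  have hh := M.field_pos
  have hc : h * (1 / h) = 1 := by field_simp
  have hcd : 1 / h < d := by
    rw [div_lt_iff₀ hh]; linarith [M.one_lt]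
  have hc0 : 0 < 1 / h := by positivity
  rcases le_or_gt x (1 / h) with hx | hx
  · exact ⟨M.o_pos h0 (hx.trans hcd.le), M.o'_pos_of_le h0.le
      (by rw [← hc]; exact mul_le_mul_of_nonneg_left hx hh.le)⟩
  · have hoc := M.o'_pos_of_le hc0.le hc.le
    have := sturm_comparison (a := 1 / h) (b := R) (y := o) (y' := o') (g := fun _ => 1)
      (g' := fun _ => 0) (Q := fun x => κ ^ 2 * (h ^ 2 * x ^ 2 - 1)) (q := fun _ => 0)
      (fun y hy => (M.modeo y ⟨by linarith [hy.1, M.R_pos], hy.2⟩).1.hasDerivWithinAt)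
      (fun y hy => (M.modeo y ⟨by linarith [hy.1, M.R_pos], hy.2⟩).2.hasDerivWithinAt)
      (fun y _ => hasDerivWithinAt_const _ _ _)
      (fun y _ => (hasDerivWithinAt_const _ _ _).congr_deriv (by simp))
      (fun y hy => by
        have : 1 ≤ h * y := by rw [← hc]; exact mul_le_mul_of_nonneg_left hy.1 hh.le
        have : 1 ≤ h ^ 2 * y ^ 2 := by nlinarith
        have := sq_nonneg κ
        nlinarith)
      (fun _ _ => one_pos) (M.o_pos hc0 hcd.le) (by simpa using hoc.le)
      (x := x) ⟨hx.le, h1⟩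
    refine ⟨this.1, ?_⟩
    have := this.2
    simp at this
    linarith [show (0 : ℝ) < o' (1 / h) from hoc, show o' (1 / h) = o' h⁻¹ by rw [one_div]]

lemma o'_pos (M : CriticalModes κ h d R E E' o o') {x : ℝ} (hx : x ∈ Set.Icc (-R) R) :
    0 < o' x := by
  rcases lt_trichotomy x 0 with h0 | rfl | h0
  · rw [← (M.modeo.odd M.R_pos M.o_zero hx).2]
    exact (M.o_o'_pos (x := -x) (by linarith) (by linarith [hx.1])).2
  · rw [M.o'_zero]; exact one_pos
  · exact (M.o_o'_pos h0 hx.2).2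

end CriticalModes

/-! ### The quotient `E' / o'` and shifted slabs. -/

namespace CriticalModes

variable {κ h d R : ℝ} {E E' o o' : ℝ → ℝ}

/-- `(E' / o')' = κ² (h² x² - 1) / o'²`. -/
lemma hasDerivAt_ratio (M : CriticalModes κ h d R E E' o o') {x : ℝ} (hx : x ∈ Set.Icc (-R) R) :
    HasDerivAt (fun x => E' x / o' x) (κ ^ 2 * (h ^ 2 * x ^ 2 - 1) / o' x ^ 2) x := by
  refine ((M.modeE x hx).2.div (M.modeo x hx).2 (M.o'_pos hx).ne').congr_deriv ?_
  congr 1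
  linear_combination (κ ^ 2 * (h ^ 2 * x ^ 2 - 1)) * M.wronskian hx

lemma hasDerivAt_potential_div (M : CriticalModes κ h d R E E' o o') {x : ℝ}
    (hx : x ∈ Set.Icc (-R) R) :
    HasDerivAt (fun x => κ ^ 2 * (h ^ 2 * x ^ 2 - 1) / o' x ^ 2)
      (2 * κ ^ 2 * (h ^ 2 * x * o' x - κ ^ 2 * (h ^ 2 * x ^ 2 - 1) ^ 2 * o x) / o' x ^ 3) x := by
  have hQ : HasDerivAt (fun x : ℝ => κ ^ 2 * (h ^ 2 * x ^ 2 - 1)) (κ ^ 2 * (h ^ 2 * (2 * x))) x := by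
    have := (((hasDerivAt_pow 2 x).const_mul (h ^ 2)).sub_const 1).const_mul (κ ^ 2)
    simpa using this
  have ho := (M.o'_pos hx).ne'
  refine (hQ.div ((M.modeo x hx).2.pow 2) (pow_ne_zero 2 ho)).congr_deriv ?_
  simp
  field_simp

/-- The quotient `E' / o'` takes equal values at the two ends of the shifted slab on which there is
a solution satisfying the Neumann conditions. -/
lemma ratio_eq_of_neumann (M : CriticalModes κ h d R E E' o o') {s : ℝ} (hs0 : 0 ≤ s)
    (hs : s + d ≤ R) {ψ ψ' : ℝ → ℝ}
    (hψ : ∀ x ∈ Set.Icc (-d) d, HasDerivAt ψ (ψ' x) x ∧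
      HasDerivAt ψ' (κ ^ 2 * ((h * x + h * s) ^ 2 - 1) * ψ x) x)
    (hpos : ∀ x ∈ Set.Icc (-d) d, 0 < ψ x) (hl : ψ' (-d) = 0) (hr : ψ' d = 0) :
    E' (d + s) / o' (d + s) = E' (s - d) / o' (s - d) := by
  have hd := M.d_pos
  have hsh : ∀ {y y' : ℝ → ℝ}, IsLinearMode κ h R y y' →
      ψ d * y' (d + s) = ψ (-d) * y' (s - d) := by
    intro y y' hy
    -- The translate by `s` of a linear mode solves the same equation as `ψ`, so their Wronskian is
    -- constant; the Neumann conditions reduce it to the end values of `ψ`.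
    have hder : ∀ x ∈ Set.Icc (-d) d, HasDerivWithinAt
        (fun x => ψ x * y' (x + s) - ψ' x * y (x + s)) 0 (Set.Icc (-d) d) x := fun x hx => by
      obtain ⟨p0, p1⟩ := hψ x hx
      obtain ⟨y0, y1⟩ := hy (x + s) ⟨by linarith [hx.1], by linarith [hx.2]⟩
      have y0' := y0.comp_add_const x s
      have y1' := y1.comp_add_const x s
      exact (((p0.mul y1').sub (p1.mul y0')).congr_deriv (by ring)).hasDerivWithinAt
    have := eq_of_hasDerivWithinAt_zero hder (fun _ _ => rfl)
      (show d ∈ Set.Icc (-d) d from ⟨by linarith, le_rfl⟩)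
      (show -d ∈ Set.Icc (-d) d from ⟨le_rfl, by linarith⟩)
    simp only [hl, hr, zero_mul, sub_zero] at this
    rw [this]
    congr 2
    ring
  have h1 := hsh M.modeE
  have h2 := hsh M.modeo
  have hp := hpos d ⟨by linarith, le_rfl⟩
  have ho1 := M.o'_pos (x := d + s) ⟨by linarith, by linarith⟩
  have ho2 := M.o'_pos (x := s - d) ⟨by linarith, by linarith⟩
  rw [div_eq_div_iff ho1.ne' ho2.ne']
  have hp' := hpos (-d) ⟨le_rfl, by linarith⟩
  have h3 : ψ d * (E' (d + s) * o' (s - d)) * ψ (-d) = ψ d * (E' (s - d) * o' (d + s)) * ψ (-d) := by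
    linear_combination (ψ (-d) * o' (s - d)) * h1 - (ψ (-d) * E' (s - d)) * h2
  exact mul_left_cancel₀ hp.ne' (mul_right_cancel₀ hp'.ne' h3)

lemma ratio_strictMonoOn (M : CriticalModes κ h d R E E' o o') :
    StrictMonoOn (fun x => E' x / o' x) (Set.Icc (1 / h) R) := by
  have hh := M.field_pos
  have hsub : ∀ x ∈ Set.Icc (1 / h) R, x ∈ Set.Icc (-R) R := fun x hx =>
    ⟨by linarith [hx.1, M.R_pos, one_div_pos.2 hh], hx.2⟩
  refine strictMonoOn_Icc_of_hasDerivWithinAt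
    (fun x hx => (M.hasDerivAt_ratio (hsub x hx)).hasDerivWithinAt) fun x hx => ?_
  have h1 : 1 < h * x := by
    have := (div_lt_iff₀ hh).1 hx.1
    linarith
  have := M.potential_pos h1
  have := M.o'_pos (hsub x (Set.Ioo_subset_Icc_self hx))
  positivity

/-- A nonzero shift compatible with the Neumann conditions and the vanishing of the bifurcation
integral keeps the left end of the shifted slab in the region where the potential is positive. -/
lemma shift_bounds (M : CriticalModes κ h d (3 * d) E E' o o') {s : ℝ} (hs0 : 0 < s)
    {ψ ψ' : ℝ → ℝ}
    (hψ : ∀ x ∈ Set.Icc (-d) d, HasDerivAt ψ (ψ' x) x ∧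
      HasDerivAt ψ' (κ ^ 2 * ((h * x + h * s) ^ 2 - 1) * ψ x) x)
    (hpos : ∀ x ∈ Set.Icc (-d) d, 0 < ψ x) (hl : ψ' (-d) = 0) (hr : ψ' d = 0)
    (hvir : ((h * d + h * s) ^ 2 - 1) * ψ d ^ 2 = ((h * (-d) + h * s) ^ 2 - 1) * ψ (-d) ^ 2) :
    1 / h < d - s ∧ E' (d + s) / o' (d + s) + E' (d - s) / o' (d - s) = 0 := by
  have hd := M.d_pos
  have hh := M.field_pos
  have hhd := M.one_lt
  have hinv : h * (1 / h) = 1 := by field_simp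
  have hinvd : 1 / h < d := by rw [div_lt_iff₀ hh]; linarith
  -- For a larger shift the potential is positive inside the slab, so `ψ'` would increase strictly
  -- between two zeros.
  have hs2 : s < d + 1 / h := by
    by_contra! hcon
    have hm := strictMonoOn_Icc_of_hasDerivWithinAt
      (fun x hx => (hψ x hx).2.hasDerivWithinAt) (fun x hx => by
        have h1 : 1 < h * x + h * s := by
          have : h * (d + 1 / h) ≤ h * s := mul_le_mul_of_nonneg_left hcon hh.le
          have : h * (-d) < h * x := mul_lt_mul_of_pos_left hx.1 hh
          linarith
        have h2 : 0 < (h * x + h * s) ^ 2 - 1 := by nlinarith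
        have := hpos x (Set.Ioo_subset_Icc_self hx)
        have := M.kappa_pos
        positivity)
    have := hm ⟨le_rfl, by linarith⟩ ⟨by linarith, le_rfl⟩ (show -d < d by linarith)
    rw [hl, hr] at this
    exact lt_irrefl _ this
  have hR : s + d ≤ 3 * d := by linarith
  have hratio := M.ratio_eq_of_neumann hs0.le hR hψ hpos hl hr
  have hodd : E' (s - d) / o' (s - d) = -(E' (d - s) / o' (d - s)) := by
    have hmem : d - s ∈ Set.Icc (-(3 * d)) (3 * d) := ⟨by linarith, by linarith⟩
    rw [← neg_sub d s, (M.modeE.even M.R_pos M.E'_zero hmem).2,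
      (M.modeo.odd M.R_pos M.o_zero hmem).2, neg_div]
  rw [hodd] at hratio
  -- The quotient increases beyond `1/h` and vanishes at `d`. By oddness its value at `d - s` is the
  -- opposite number, hence negative, which puts `d - s` on the positive side.
  have hMpos : 0 < E' (d + s) / o' (d + s) := by
    have := M.ratio_strictMonoOn (a := d) (b := d + s) ⟨hinvd.le, by linarith⟩
      ⟨by linarith, by linarith⟩ (by linarith)
    simpa [M.E'_end] using this
  have hneg : E' (d - s) / o' (d - s) < 0 := by linarith
  have hE'neg : E' (d - s) < 0 := by
    have := M.o'_pos (x := d - s) ⟨by linarith, by linarith⟩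
    by_contra! hcon
    exact absurd (div_nonneg hcon this.le) (not_le.2 hneg)
  have hds : 0 < d - s := by
    by_contra! hcon
    have h1 := M.E'_nonpos (x := s - d) (by linarith) (by linarith)
    have h2 := (M.modeE.even M.R_pos M.E'_zero
      (show d - s ∈ Set.Icc (-(3 * d)) (3 * d) from ⟨by linarith, by linarith⟩)).2
    rw [neg_sub] at h2
    linarith
  refine ⟨?_, by linarith⟩
  -- The integral condition equates two boundary terms; positivity at the right end forces a
  -- positive potential at the left end as well.
  have hL : 0 < ((h * d + h * s) ^ 2 - 1) * ψ d ^ 2 := by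
    have h1 : 0 < h * s := mul_pos hh hs0
    have h2 : 0 < (h * d + h * s) ^ 2 - 1 := by nlinarith
    have := hpos d ⟨by linarith, le_rfl⟩
    positivity
  rw [hvir] at hL
  have h3 : 0 < (h * (-d) + h * s) ^ 2 - 1 := by
    by_contra! hcon
    exact absurd (mul_nonpos_of_nonpos_of_nonneg hcon (sq_nonneg _)) (not_le.2 hL)
  have h4 : 1 < h * (d - s) := by
    have h5 : 0 < h * (d - s) := mul_pos hh hds
    by_contra! hcon
    nlinarith
  rw [div_lt_iff₀ hh]
  linarith

/-- Monotonicity of `κ² (h² x² - 1) / o'²` decides the sign of the sum of the ratios at `d ± s`. -/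
lemma hasDerivAt_ratio_add (M : CriticalModes κ h d (3 * d) E E' o o') {s : ℝ}
    (hs : s ∈ Set.Icc 0 d) :
    HasDerivAt (fun s => E' (d + s) / o' (d + s) + E' (d - s) / o' (d - s))
      (κ ^ 2 * (h ^ 2 * (d + s) ^ 2 - 1) / o' (d + s) ^ 2 -
        κ ^ 2 * (h ^ 2 * (d - s) ^ 2 - 1) / o' (d - s) ^ 2) s := by
  have hd := M.d_pos
  have h1 := (M.hasDerivAt_ratio (x := d + s) ⟨by linarith [hs.1], by linarith [hs.2]⟩)
  have h2 := (M.hasDerivAt_ratio (x := d - s) ⟨by linarith [hs.2], by linarith [hs.1]⟩)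
  have h1' := h1.comp_const_add d s
  have h2' := h2.comp_const_sub d s
  exact (h1'.add h2').congr_deriv (by ring)

/-! ### Short slabs -/

/-- In a short slab `1/2 ≤ E ≤ 1`, so `E'' ≥ κ²h²x²/2 - κ²`. Integrating and using `E'(d) = 0`
bounds `h²d²`. -/
lemma sq_field_mul_le (M : CriticalModes κ h d R E E' o o') (hs : κ * d < 1 / 100) :
    h ^ 2 * d ^ 2 ≤ 6 := by
  have hd := M.d_pos
  have hκ := M.kappa_pos
  have hsub : ∀ x ∈ Set.Icc 0 d, x ∈ Set.Icc (-R) R := fun x hx => M.mem_of_nonneg hx.1 hx.2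
  have hpos : ∀ x ∈ Set.Icc 0 d, 0 < E x := fun x hx => M.E_pos x ⟨by linarith [hx.1], hx.2⟩
  have hE1 : ∀ x ∈ Set.Icc 0 d, E x ≤ 1 := fun x hx => by
    have := monotoneOn_Icc_of_hasDerivWithinAt (a := 0) (b := d) (f := fun x => -E x)
      (fun x hx => (M.modeE x (hsub x hx)).1.neg.hasDerivWithinAt)
      (fun x hx => neg_nonneg.2 (M.E'_nonpos hx.1.le hx.2.le))
    have := this ⟨le_rfl, hd.le⟩ hx hx.1
    simp only [M.E_zero] at this
    linarith
  have hE2 : ∀ x ∈ Set.Icc 0 d, -(κ ^ 2 * x) ≤ E' x := fun x hx => by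
    have := monotoneOn_Icc_of_hasDerivWithinAt (a := 0) (b := d) (f := fun x => E' x + κ ^ 2 * x)
      (fun x hx => ((M.modeE x (hsub x hx)).2.add
        ((hasDerivAt_id x).const_mul (κ ^ 2))).hasDerivWithinAt)
      (fun x hx => by
        have h1 := hE1 x (Set.Ioo_subset_Icc_self hx)
        have h2 := hpos x (Set.Ioo_subset_Icc_self hx)
        have h3 : 0 ≤ κ ^ 2 * (h ^ 2 * x ^ 2) * E x := by positivity
        have h4 : κ ^ 2 * E x ≤ κ ^ 2 * 1 := mul_le_mul_of_nonneg_left h1 (sq_nonneg κ)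
        nlinarith)
    have := this ⟨le_rfl, hd.le⟩ hx hx.1
    simp only [M.E'_zero] at this
    linarith
  have hE3 : ∀ x ∈ Set.Icc 0 d, 1 - κ ^ 2 * x ^ 2 / 2 ≤ E x := fun x hx => by
    have := monotoneOn_Icc_of_hasDerivWithinAt (a := 0) (b := d)
      (f := fun x => E x + κ ^ 2 * x ^ 2 / 2)
      (fun x hx => ((M.modeE x (hsub x hx)).1.add
        (((hasDerivAt_pow 2 x).const_mul (κ ^ 2)).div_const 2)).hasDerivWithinAt)
      (fun x hx => by
        have := hE2 x (Set.Ioo_subset_Icc_self hx)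
        simp
        linarith)
    have := this ⟨le_rfl, hd.le⟩ hx hx.1
    simp only [M.E_zero] at this
    linarith
  have hhalf : ∀ x ∈ Set.Icc 0 d, 1 / 2 ≤ E x := fun x hx => by
    have h1 : κ * x ≤ κ * d := mul_le_mul_of_nonneg_left hx.2 hκ.le
    have h2 : 0 ≤ κ * x := mul_nonneg hκ.le hx.1
    have := hE3 x hx
    nlinarith
  have hfin := monotoneOn_Icc_of_hasDerivWithinAt (a := 0) (b := d)
      (f := fun x => E' x - (κ ^ 2 * h ^ 2 * x ^ 3 / 6 - κ ^ 2 * x))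
      (fun x hx => ((M.modeE x (hsub x hx)).2.sub
        ((((hasDerivAt_pow 3 x).const_mul (κ ^ 2 * h ^ 2)).div_const 6).sub
          ((hasDerivAt_id x).const_mul (κ ^ 2)))).hasDerivWithinAt)
      (fun x hx => by
        have h1 := hE1 x (Set.Ioo_subset_Icc_self hx)
        have h2 := hhalf x (Set.Ioo_subset_Icc_self hx)
        have h3 : κ ^ 2 * (h ^ 2 * x ^ 2) * (1 / 2) ≤ κ ^ 2 * (h ^ 2 * x ^ 2) * E x :=
          mul_le_mul_of_nonneg_left h2 (by positivity)
        have h4 : κ ^ 2 * E x ≤ κ ^ 2 * 1 := mul_le_mul_of_nonneg_left h1 (sq_nonneg κ)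
        simp
        nlinarith)
  have h1 := hfin ⟨le_rfl, hd.le⟩ ⟨hd.le, le_rfl⟩ hd.le
  simp only [M.E'_zero, M.E'_end] at h1
  have h2 : κ ^ 2 * d * (h ^ 2 * d ^ 2) ≤ κ ^ 2 * d * 6 := by nlinarith
  exact le_of_mul_le_mul_left h2 (by positivity)

/-- This is the sign of `G'` for `G = κ²(h²x² - 1)/o'²`. The Wronskian with `x - κ²x³/2` gives `o ≤
2 x o'`. Together with `h²x² ≤ 24`, from the bound `h²d² ≤ 6` and `x ≤ 2d`, and with `κx ≤ 1/50`,
this makes the left side small. -/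
lemma nondegenerate_of_short (M : CriticalModes κ h d R E E' o o') (hs : κ * d < 1 / 100)
    {x : ℝ} (hx1 : 1 / h ≤ x) (hx2 : x ≤ 2 * d) (hxR : x ≤ R) :
    κ ^ 2 * (h ^ 2 * x ^ 2 - 1) ^ 2 * o x < h ^ 2 * x * o' x := by
  have hd := M.d_pos
  have hκ := M.kappa_pos
  have hh := M.field_pos
  have hx0 : 0 < x := (one_div_pos.2 hh).trans_le hx1
  have hκx : κ * x ≤ 1 / 50 := by
    have : κ * x ≤ κ * (2 * d) := mul_le_mul_of_nonneg_left hx2 hκ.le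
    linarith
  have hW := monotoneOn_Icc_of_hasDerivWithinAt (a := 0) (b := x)
    (f := fun x => o' x * (x - κ ^ 2 * x ^ 3 / 2) - o x * (1 - 3 * κ ^ 2 * x ^ 2 / 2))
    (f' := fun x => o x * (κ ^ 2 * (h ^ 2 * x ^ 2 - 1) * (x - κ ^ 2 * x ^ 3 / 2) + 3 * κ ^ 2 * x))
    (fun y hy => by
      obtain ⟨o0, o1⟩ := M.modeo y ⟨by linarith [hy.1, M.R_pos], hy.2.trans hxR⟩
      have g0 : HasDerivAt (fun x : ℝ => x - κ ^ 2 * x ^ 3 / 2) (1 - 3 * κ ^ 2 * y ^ 2 / 2) y := by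
        have := (hasDerivAt_id y).sub (((hasDerivAt_pow 3 y).const_mul (κ ^ 2)).div_const 2)
        exact this.congr_deriv (by simp; ring)
      have g1 : HasDerivAt (fun x : ℝ => 1 - 3 * κ ^ 2 * x ^ 2 / 2) (-(3 * κ ^ 2 * y)) y := by
        have := (((hasDerivAt_pow 2 y).const_mul (3 * κ ^ 2)).div_const 2).const_sub 1
        exact this.congr_deriv (by simp; ring)
      exact (((o1.mul g0).sub (o0.mul g1)).congr_deriv (by ring)).hasDerivWithinAt)
    (fun y hy => by
      have hop := (M.o_o'_pos hy.1 (hy.2.le.trans hxR)).1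
      have hκy : κ * y ≤ 1 / 50 := (mul_le_mul_of_nonneg_left hy.2.le hκ.le).trans hκx
      have hκy0 : 0 < κ * y := mul_pos hκ hy.1
      have h1 : 0 ≤ y - κ ^ 2 * y ^ 3 / 2 := by
        have h0 : (κ * y) ^ 2 ≤ 1 := by nlinarith
        have h2 : y - κ ^ 2 * y ^ 3 / 2 = y * (1 - (κ * y) ^ 2 / 2) := by ring
        rw [h2]
        exact mul_nonneg hy.1.le (by linarith)
      have h3 : y - κ ^ 2 * y ^ 3 / 2 ≤ y := by
        have := hy.1
        have : 0 ≤ κ ^ 2 * y ^ 3 / 2 := by positivity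
        linarith
      have h4 : 0 ≤ κ ^ 2 * (h ^ 2 * y ^ 2) * (y - κ ^ 2 * y ^ 3 / 2) := by positivity
      have h5 : κ ^ 2 * (y - κ ^ 2 * y ^ 3 / 2) ≤ κ ^ 2 * y :=
        mul_le_mul_of_nonneg_left h3 (sq_nonneg κ)
      have h6 : 0 ≤ κ ^ 2 * y := by have := hy.1; positivity
      refine mul_nonneg hop.le ?_
      nlinarith)
  have h1 := hW ⟨le_rfl, hx0.le⟩ ⟨hx0.le, le_rfl⟩ hx0.le
  simp only [M.o_zero] at h1
  norm_num at h1
  obtain ⟨hop, hop'⟩ := M.o_o'_pos hx0 hxR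
  have hκx0 : 0 < κ * x := mul_pos hκ hx0
  have h2 : o x / 2 ≤ o' x * x := by
    have e1 : o x * (1 / 2) ≤ o x * (1 - 3 * κ ^ 2 * x ^ 2 / 2) :=
      mul_le_mul_of_nonneg_left (by nlinarith) hop.le
    have e2 : 0 ≤ o' x * (κ ^ 2 * x ^ 3 / 2) := by positivity
    nlinarith
  have h3 : h ^ 2 * x ^ 2 ≤ 24 := by
    have := M.sq_field_mul_le hs
    have : x ^ 2 ≤ 4 * d ^ 2 := by nlinarith
    nlinarith [sq_nonneg h]
  have h4 : 0 ≤ h ^ 2 * x ^ 2 - 1 := by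
    have : 1 ≤ h * x := by
      have := (div_le_iff₀ hh).1 hx1
      linarith
    nlinarith
  have h5 : κ ^ 2 * x ^ 2 ≤ 1 / 2500 := by nlinarith
  have h6 : κ ^ 2 * (h ^ 2 * x ^ 2 - 1) ^ 2 * x ^ 2 < h ^ 2 * x ^ 2 / 2 := by
    have e1 : (h ^ 2 * x ^ 2 - 1) ^ 2 ≤ 24 * (h ^ 2 * x ^ 2) := by nlinarith
    have e2 : κ ^ 2 * x ^ 2 * (h ^ 2 * x ^ 2 - 1) ^ 2 ≤ 1 / 2500 * (24 * (h ^ 2 * x ^ 2)) :=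
      mul_le_mul h5 e1 (sq_nonneg _) (by norm_num)
    have e3 : 0 < h ^ 2 * x ^ 2 := by positivity
    nlinarith
  have h7 : κ ^ 2 * (h ^ 2 * x ^ 2 - 1) ^ 2 < h ^ 2 / 2 := by
    have : κ ^ 2 * (h ^ 2 * x ^ 2 - 1) ^ 2 * x ^ 2 < h ^ 2 / 2 * x ^ 2 := by linarith
    exact lt_of_mul_lt_mul_right this (sq_nonneg x)
  calc κ ^ 2 * (h ^ 2 * x ^ 2 - 1) ^ 2 * o x < h ^ 2 / 2 * o x := mul_lt_mul_of_pos_right h7 hop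
    _ = h ^ 2 * (o x / 2) := by ring
    _ ≤ h ^ 2 * (o' x * x) := mul_le_mul_of_nonneg_left h2 (sq_nonneg h)
    _ = h ^ 2 * x * o' x := by ring

/-- For shifts between `0` and `s` both `d - x` and `d + x` lie in `[1/h, 2d]`, where `G` increases;
so the sum of the quotients increases from its value `0` at shift `0`. -/
lemma ratio_add_pos_of_short (M : CriticalModes κ h d (3 * d) E E' o o') (hs : κ * d < 1 / 100)
    {s : ℝ} (hs0 : 0 < s) (hsd : 1 / h < d - s) :
    0 < E' (d + s) / o' (d + s) + E' (d - s) / o' (d - s) := by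
  have hd := M.d_pos
  have hh := M.field_pos
  have hh' : 0 < 1 / h := one_div_pos.2 hh
  have hG : StrictMonoOn (fun x => κ ^ 2 * (h ^ 2 * x ^ 2 - 1) / o' x ^ 2)
      (Set.Icc (1 / h) (2 * d)) := by
    refine strictMonoOn_Icc_of_hasDerivWithinAt (fun x hx => (M.hasDerivAt_potential_div
      ⟨by linarith [hx.1], by linarith [hx.2]⟩).hasDerivWithinAt) fun x hx => ?_
    have h1 := M.nondegenerate_of_short hs hx.1.le hx.2.le (by linarith [hx.2])
    have h2 := M.o'_pos (x := x) ⟨by linarith [hx.1], by linarith [hx.2]⟩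
    have h3 := M.kappa_pos
    have h4 := sub_pos.2 h1
    positivity
  have hm := strictMonoOn_Icc_of_hasDerivWithinAt (a := 0) (b := s)
    (fun x hx => (M.hasDerivAt_ratio_add (s := x) ⟨hx.1, by linarith [hx.2]⟩).hasDerivWithinAt)
    (fun x hx => sub_pos.2 (hG ⟨by linarith [hx.2], by linarith [hx.1]⟩
      ⟨by linarith [hx.1, hx.2], by linarith [hx.2]⟩ (by linarith [hx.1])))
  have := hm ⟨le_rfl, hs0.le⟩ ⟨hs0.le, le_rfl⟩ hs0
  simpa [M.E'_end] using this

/-! ### Long slabs -/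

/-- Comparison with `x exp(κhx²/2)`, which grows faster than `o`, gives `x o' ≤ (1 + κhx²) o`. With
`t = κhx² ≥ 4` it remains to use `1 + t < (t - 1)²`. -/
lemma nondegenerate_of_long (M : CriticalModes κ h d R E E' o o') {x : ℝ} (hx0 : 0 < x)
    (hx : 4 ≤ κ * h * x ^ 2) (hxR : x ≤ R) :
    h ^ 2 * x * o' x < κ ^ 2 * (h ^ 2 * x ^ 2 - 1) ^ 2 * o x := by
  have hκ := M.kappa_pos
  have hh := M.field_pos
  have hW := monotoneOn_Icc_of_hasDerivWithinAt (a := 0) (b := x)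
    (f := fun x => (o x * (1 + κ * h * x ^ 2) - o' x * x) * Real.exp (-((-(κ * h)) * x ^ 2 / 2)))
    (f' := fun x => (3 * κ * h + κ ^ 2) * (o x * x) * Real.exp (-((-(κ * h)) * x ^ 2 / 2)))
    (fun y hy => by
      obtain ⟨o0, o1⟩ := M.modeo y ⟨by linarith [hy.1, M.R_pos], hy.2.trans hxR⟩
      have g0 : HasDerivAt (fun x : ℝ => 1 + κ * h * x ^ 2) (2 * (κ * h) * y) y := by
        have := ((hasDerivAt_pow 2 y).const_mul (κ * h)).const_add 1
        exact this.congr_deriv (by simp; ring)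
      have g1 := hasDerivAt_gaussian (-(κ * h)) y
      exact ((((o0.mul g0).sub (o1.mul (hasDerivAt_id y))).mul g1).congr_deriv (by
        simp; ring)).hasDerivWithinAt)
    (fun y hy => by
      have := (M.o_o'_pos hy.1 (hy.2.le.trans hxR)).1
      have := hy.1
      positivity)
  have h1 := hW ⟨le_rfl, hx0.le⟩ ⟨hx0.le, le_rfl⟩ hx0.le
  simp only [M.o_zero] at h1
  norm_num at h1
  have h2 : o' x * x ≤ o x * (1 + κ * h * x ^ 2) :=
    sub_nonneg.1 (nonneg_of_mul_nonneg_left h1 (Real.exp_pos _))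
  obtain ⟨hop, -⟩ := M.o_o'_pos hx0 hxR
  have h3 : h ^ 2 * (1 + κ * h * x ^ 2) < κ ^ 2 * (h ^ 2 * x ^ 2 - 1) ^ 2 := by
    have e1 : κ * h * x ^ 2 * h - h ≤ κ * (h ^ 2 * x ^ 2 - 1) := by
      have := M.kappa_lt
      nlinarith
    have e2 : 0 ≤ κ * h * x ^ 2 * h - h := by nlinarith
    have e3 : (κ * h * x ^ 2 * h - h) ^ 2 ≤ (κ * (h ^ 2 * x ^ 2 - 1)) ^ 2 :=
      pow_le_pow_left₀ e2 e1 2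
    have e4 : 1 + κ * h * x ^ 2 < (κ * h * x ^ 2 - 1) ^ 2 := by nlinarith
    have e5 : h ^ 2 * (1 + κ * h * x ^ 2) < h ^ 2 * (κ * h * x ^ 2 - 1) ^ 2 :=
      mul_lt_mul_of_pos_left e4 (by positivity)
    nlinarith
  calc h ^ 2 * x * o' x = h ^ 2 * (o' x * x) := by ring
    _ ≤ h ^ 2 * (o x * (1 + κ * h * x ^ 2)) := mul_le_mul_of_nonneg_left h2 (sq_nonneg h)
    _ = h ^ 2 * (1 + κ * h * x ^ 2) * o x := by ring
    _ < _ := mul_lt_mul_of_pos_right h3 hop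

lemma potential_div_antitone (M : CriticalModes κ h d R E E' o o') {c : ℝ} (hc : 0 < c)
    (hc4 : 4 ≤ κ * h * c ^ 2) :
    StrictAntiOn (fun x => κ ^ 2 * (h ^ 2 * x ^ 2 - 1) / o' x ^ 2) (Set.Icc c R) := by
  have hκ := M.kappa_pos
  have hh := M.field_pos
  have hm := strictMonoOn_Icc_of_hasDerivWithinAt (a := c) (b := R)
    (fun x hx => ((M.hasDerivAt_potential_div
      ⟨by linarith [hx.1, M.R_pos], hx.2⟩).neg).hasDerivWithinAt) (fun x hx => by
      have hx0 := hc.trans hx.1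
      have h1 : c ^ 2 ≤ x ^ 2 := by nlinarith [hx.1]
      have h2 : 4 ≤ κ * h * x ^ 2 :=
        hc4.trans (mul_le_mul_of_nonneg_left h1 (by positivity))
      have h3 := sub_neg.2 (M.nondegenerate_of_long hx0 h2 hx.2.le)
      have h4 := (M.o_o'_pos hx0 hx.2.le).2
      rw [neg_pos]
      exact div_neg_of_neg_of_pos (mul_neg_of_pos_of_neg (by positivity) h3) (by positivity))
  exact fun x hx y hy hxy => neg_lt_neg_iff.1 (hm hx hy hxy)

lemma ratio_add_neg_of_long_of_le (M : CriticalModes κ h d (3 * d) E E' o o') {s : ℝ}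
    (hs0 : 0 < s) (hsd : 0 < d - s) (hs4 : 4 ≤ κ * h * (d - s) ^ 2) :
    E' (d + s) / o' (d + s) + E' (d - s) / o' (d - s) < 0 := by
  have hd := M.d_pos
  have hG := M.potential_div_antitone hsd hs4
  have hm := strictMonoOn_Icc_of_hasDerivWithinAt (a := 0) (b := s)
    (fun x hx => ((M.hasDerivAt_ratio_add (s := x)
      ⟨hx.1, by linarith [hx.2]⟩).neg).hasDerivWithinAt)
    (fun x hx => by
      rw [neg_pos, sub_neg]
      exact hG ⟨by linarith [hx.2], by linarith [hx.1]⟩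
        ⟨by linarith [hx.1], by linarith [hx.2]⟩ (by linarith [hx.1]))
  have := hm ⟨le_rfl, hs0.le⟩ ⟨hs0.le, le_rfl⟩ hs0
  simp [M.E'_end] at this
  linarith

/-- In units of the length `c = 1/√(κh)`: the potential is at most `64κh` at `8c` and at least
`15κh` on `[4c, 8c]`, while convexity gives `o'(8c) ≥ 3 o'(4c)`. The conclusion is `2 · 64/9 < 15`.
-/
lemma two_mul_potential_div_lt (M : CriticalModes κ h d R E E' o o') {c : ℝ} (hc0 : 0 < c)
    (hkc : κ * h * c ^ 2 = 1) (h8 : 8 * c ≤ R) :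
    2 * (κ ^ 2 * (h ^ 2 * (8 * c) ^ 2 - 1) / o' (8 * c) ^ 2) <
      κ ^ 2 * (h ^ 2 * (4 * c) ^ 2 - 1) / o' (4 * c) ^ 2 := by
  have hκ := M.kappa_pos
  have hh := M.field_pos
  have hkh : 0 < κ * h := mul_pos hκ hh
  have p4 := M.o_o'_pos (x := 4 * c) (by linarith) (by linarith)
  have p8 := M.o_o'_pos (x := 8 * c) (by linarith) (by linarith)
  have hq : ∀ x ∈ Set.Icc (4 * c) (8 * c), 15 * (κ * h) ≤ κ ^ 2 * (h ^ 2 * x ^ 2 - 1) :=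
    fun x hx => by
      have : (4 * c) ^ 2 ≤ x ^ 2 := by nlinarith [hx.1]
      have h16 : 16 ≤ κ * h * x ^ 2 := by nlinarith
      have : κ * h * 16 ≤ κ * h * (κ * h * x ^ 2) := mul_le_mul_of_nonneg_left h16 hkh.le
      nlinarith [M.kappa_lt]
  have hmem' : ∀ x ∈ Set.Icc (4 * c) (8 * c), x ∈ Set.Icc (-R) R := fun x hx =>
    ⟨by linarith [hx.1, M.R_pos], by linarith [hx.2]⟩
  have q1 : ∀ x ∈ Set.Icc (4 * c) (8 * c), o' (4 * c) ≤ o' x := fun x hx =>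
    monotoneOn_Icc_of_hasDerivWithinAt (fun x hx => (M.modeo x (hmem' x hx)).2.hasDerivWithinAt)
      (fun x hx => by
        have := hq x (Set.Ioo_subset_Icc_self hx)
        have := (M.o_o'_pos (x := x) (by linarith [hx.1]) (by linarith [hx.2])).1
        have : 0 < κ ^ 2 * (h ^ 2 * x ^ 2 - 1) := by linarith
        positivity) ⟨le_rfl, by linarith⟩ hx hx.1
  have q2 : ∀ x ∈ Set.Icc (4 * c) (8 * c), o' (4 * c) * (x - 4 * c) ≤ o x := fun x hx => by
    have := monotoneOn_Icc_of_hasDerivWithinAt (a := 4 * c) (b := 8 * c)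
      (f := fun x => o x - o' (4 * c) * (x - 4 * c))
      (fun x hx => ((M.modeo x (hmem' x hx)).1.sub
        (((hasDerivAt_id x).sub_const _).const_mul _)).hasDerivWithinAt)
      (fun x hx => by
        have := q1 x (Set.Ioo_subset_Icc_self hx)
        simpa using this)
    have := this ⟨le_rfl, by linarith⟩ hx hx.1
    simp only [sub_self, mul_zero, sub_zero] at this
    linarith [p4.1]
  have q3 : o' (4 * c) * 3 ≤ o' (8 * c) := by
    have := monotoneOn_Icc_of_hasDerivWithinAt (a := 4 * c) (b := 8 * c)
      (f := fun x => o' x - 15 * (κ * h) * o' (4 * c) * (x - 4 * c) ^ 2 / 2)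
      (fun x hx => ((M.modeo x (hmem' x hx)).2.sub
        (((((hasDerivAt_id x).sub_const _).pow 2).const_mul _).div_const 2)).hasDerivWithinAt)
      (fun x hx => by
        have h1 := q2 x (Set.Ioo_subset_Icc_self hx)
        have h2 := hq x (Set.Ioo_subset_Icc_self hx)
        have h3 : 0 ≤ o' (4 * c) * (x - 4 * c) := mul_nonneg p4.2.le (by linarith [hx.1])
        have h4 : 15 * (κ * h) * (o' (4 * c) * (x - 4 * c)) ≤
            κ ^ 2 * (h ^ 2 * x ^ 2 - 1) * o x :=
          mul_le_mul h2 h1 h3 (by linarith)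
        simp
        linarith)
    have := this ⟨le_rfl, by linarith⟩ ⟨by linarith, le_rfl⟩ (by linarith : 4 * c ≤ 8 * c)
    simp only [sub_self] at this
    have h5 : 15 * (κ * h) * o' (4 * c) * (8 * c - 4 * c) ^ 2 / 2 =
        120 * (κ * h * c ^ 2) * o' (4 * c) := by ring
    rw [h5, hkc] at this
    norm_num at this
    linarith [p4.2]
  have hG8 : κ ^ 2 * (h ^ 2 * (8 * c) ^ 2 - 1) / o' (8 * c) ^ 2 ≤ 64 * (κ * h) / o' (8 * c) ^ 2 := by
    have : κ ^ 2 * (h ^ 2 * (8 * c) ^ 2 - 1) ≤ 64 * (κ * h) := by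
      have : κ ^ 2 * (h ^ 2 * (8 * c) ^ 2 - 1) = 64 * (κ * h) * (κ * h * c ^ 2) - κ ^ 2 := by ring
      rw [this, hkc]
      nlinarith [sq_nonneg κ]
    exact div_le_div_of_nonneg_right this (by positivity)
  have hG4 : 15 * (κ * h) / o' (4 * c) ^ 2 ≤
      κ ^ 2 * (h ^ 2 * (4 * c) ^ 2 - 1) / o' (4 * c) ^ 2 :=
    div_le_div_of_nonneg_right (hq _ ⟨le_rfl, by linarith⟩) (by positivity)
  have h9 : 64 * (κ * h) / o' (8 * c) ^ 2 ≤ 64 * (κ * h) / (o' (4 * c) * 3) ^ 2 := by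
    have := p4.2
    exact div_le_div_of_nonneg_left (by positivity) (by positivity)
      (pow_le_pow_left₀ (by positivity) q3 2)
  have h10 : 2 * (64 * (κ * h) / (o' (4 * c) * 3) ^ 2) < 15 * (κ * h) / o' (4 * c) ^ 2 := by
    have h11 : 2 * (64 * (κ * h) / (o' (4 * c) * 3) ^ 2) =
        (128 / 9) * (κ * h) / o' (4 * c) ^ 2 := by
      have := p4.2.ne'
      field_simp
      norm_num
    rw [h11]
    have := p4.2
    exact div_lt_div_of_pos_right (by linarith) (by positivity)
  linarith

/-- If `d - s` is at least two lengths `c = 1/√(κh)`, monotonicity of `G` suffices. Otherwise the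
sum is compared with the one for the shift `d - 4c`, already known to be negative: going from `4c`
down to `2c` loses at least `2c G(4c)`, going from `2d - 4c` up to `2d` gains at most `4c G(8c)`,
and the gain is smaller. -/
lemma ratio_add_neg_of_long (M : CriticalModes κ h d (3 * d) E E' o o') (hl : 6 < κ * d)
    {s : ℝ} (hs0 : 0 < s) (hsd : 1 / h < d - s) :
    E' (d + s) / o' (d + s) + E' (d - s) / o' (d - s) < 0 := by
  have hd := M.d_pos
  have hκ := M.kappa_pos
  have hh := M.field_pos
  have hh' : 0 < 1 / h := one_div_pos.2 hh
  rcases le_or_gt 4 (κ * h * (d - s) ^ 2) with h4 | h4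
  · exact M.ratio_add_neg_of_long_of_le hs0 (by linarith) h4
  set l := Real.sqrt (κ * h) with hldef
  have hkh : 0 < κ * h := mul_pos hκ hh
  have hl0 : 0 < l := Real.sqrt_pos.2 hkh
  have hl2 : l ^ 2 = κ * h := Real.sq_sqrt hkh.le
  have hld : 6 < l * d := by
    have : κ ≤ l := Real.le_sqrt_of_sq_le (by nlinarith [M.kappa_lt])
    nlinarith
  set c := 1 / l with hcdef
  have hlc : l * c = 1 := by rw [hcdef]; field_simp
  have hc0 : 0 < c := one_div_pos.2 hl0
  have hcd : 6 * c < d := by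
    have : l * (6 * c) < l * d := by linarith
    exact lt_of_mul_lt_mul_left this hl0.le
  have hkc : κ * h * c ^ 2 = 1 := by rw [← hl2]; nlinarith
  have hmem : ∀ {x : ℝ}, 0 ≤ x → x ≤ 3 * d → x ∈ Set.Icc (-(3 * d)) (3 * d) := fun h1 h2 =>
    ⟨by linarith, h2⟩
  have hG := M.potential_div_antitone (c := 2 * c) (by linarith) (by nlinarith)
  have hhc : 1 / h ≤ 2 * c := by
    rw [div_le_iff₀ hh]
    have : l ≤ h := Real.sqrt_le_iff.2 ⟨hh.le, by nlinarith [M.kappa_lt]⟩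
    nlinarith
  have hds : d - s < 2 * c := by
    by_contra! hcon
    have : (2 * c) ^ 2 ≤ (d - s) ^ 2 := by nlinarith
    nlinarith
  have hmono := M.ratio_strictMonoOn
  -- values at the four comparison points
  set r : ℝ → ℝ := fun x => E' x / o' x with hr
  set G : ℝ → ℝ := fun x => κ ^ 2 * (h ^ 2 * x ^ 2 - 1) / o' x ^ 2 with hGdef
  have e1 : r (d - s) < r (2 * c) := hmono ⟨hsd.le, by linarith⟩ ⟨hhc, by linarith⟩ hds
  have e2 : r (d + s) ≤ r (2 * d) :=
    hmono.monotoneOn ⟨by linarith, by linarith⟩ ⟨by linarith, by linarith⟩ (by linarith)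
  have e3 : r (d + (d - 4 * c)) + r (d - (d - 4 * c)) < 0 :=
    M.ratio_add_neg_of_long_of_le (by linarith) (by linarith) (by nlinarith)
  have e4 : r (2 * c) ≤ r (4 * c) - G (4 * c) * (2 * c) := by
    have := monotoneOn_Icc_of_hasDerivWithinAt (a := 2 * c) (b := 4 * c)
      (f := fun x => r x - G (4 * c) * x) (fun x hx => (((M.hasDerivAt_ratio
        (hmem (by linarith [hx.1]) (by linarith [hx.2]))).sub
        ((hasDerivAt_id x).const_mul _)).hasDerivWithinAt)) (fun x hx => by
        have := hG.antitoneOn (a := x) (b := 4 * c) ⟨hx.1.le, by linarith [hx.2]⟩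
          ⟨by linarith, by linarith⟩ hx.2.le
        simp only [mul_one, sub_nonneg]
        exact this)
    have := this ⟨le_rfl, by linarith⟩ ⟨by linarith, le_rfl⟩ (by linarith)
    simp only at this
    linarith
  have e5 : r (2 * d) ≤ r (2 * d - 4 * c) + G (8 * c) * (4 * c) := by
    have := monotoneOn_Icc_of_hasDerivWithinAt (a := 2 * d - 4 * c) (b := 2 * d)
      (f := fun x => G (8 * c) * x - r x) (fun x hx => ((((hasDerivAt_id x).const_mul _).sub
        (M.hasDerivAt_ratio (hmem (by linarith [hx.1]) (by linarith [hx.2])))).hasDerivWithinAt))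
      (fun x hx => by
        have := hG.antitoneOn (a := 8 * c) (b := x) ⟨by linarith, by linarith⟩
          ⟨by linarith [hx.1], by linarith [hx.2]⟩ (by linarith [hx.1])
        simp only [mul_one, sub_nonneg]
        exact this)
    have := this ⟨le_rfl, by linarith⟩ ⟨by linarith, le_rfl⟩ (by linarith)
    simp only at this
    linarith
  have e6 : 2 * G (8 * c) < G (4 * c) :=
    M.two_mul_potential_div_lt hc0 hkc (by linarith)
  have e7 : d + (d - 4 * c) = 2 * d - 4 * c := by ring
  have e8 : d - (d - 4 * c) = 4 * c := by ring
  rw [e7, e8] at e3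
  have e9 : 2 * G (8 * c) * (2 * c) < G (4 * c) * (2 * c) :=
    mul_lt_mul_of_pos_right e6 (by linarith)
  show r (d + s) + r (d - s) < 0
  linarith

/-- For short and for long slabs, the only shift at the critical field that is compatible with the
vanishing of the bifurcation integral is zero. -/
theorem shift_eq_zero (M : CriticalModes κ h d (3 * d) E E' o o')
    (hreg : κ * d < 1 / 100 ∨ 6 < κ * d) {q : ℝ} {ψ ψ' : ℝ → ℝ}
    (hψ : ∀ x ∈ Set.Icc (-d) d, HasDerivAt ψ (ψ' x) x ∧
      HasDerivAt ψ' (κ ^ 2 * ((h * x + q) ^ 2 - 1) * ψ x) x)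
    (hpos : ∀ x ∈ Set.Icc (-d) d, 0 < ψ x) (hl : ψ' (-d) = 0) (hr : ψ' d = 0)
    (hvir : ((h * d + q) ^ 2 - 1) * ψ d ^ 2 = ((h * (-d) + q) ^ 2 - 1) * ψ (-d) ^ 2) :
    q = 0 := by
  have hd := M.d_pos
  have hh := M.field_pos
  have key : ∀ (s : ℝ) (ψ ψ' : ℝ → ℝ), 0 < s → (∀ x ∈ Set.Icc (-d) d, HasDerivAt ψ (ψ' x) x ∧
      HasDerivAt ψ' (κ ^ 2 * ((h * x + h * s) ^ 2 - 1) * ψ x) x) →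
      (∀ x ∈ Set.Icc (-d) d, 0 < ψ x) → ψ' (-d) = 0 → ψ' d = 0 →
      ((h * d + h * s) ^ 2 - 1) * ψ d ^ 2 = ((h * (-d) + h * s) ^ 2 - 1) * ψ (-d) ^ 2 → False := by
    intro s ψ ψ' hs hψ hpos hl hr hvir
    obtain ⟨h1, h2⟩ := M.shift_bounds hs hψ hpos hl hr hvir
    rcases hreg with hreg | hreg
    · exact (M.ratio_add_pos_of_short hreg hs h1).ne' h2
    · exact (M.ratio_add_neg_of_long hreg hs h1).ne h2
  have hq : h * (q / h) = q := by field_simp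
  -- A negative shift is turned into a positive one by reflecting `ψ`.
  rcases lt_trichotomy q 0 with hneg | h0 | hpos'
  · exfalso
    have hq' : h * (-q / h) = -q := by field_simp
    refine key (-q / h) (fun x => ψ (-x)) (fun x => -ψ' (-x)) (div_pos (neg_pos.2 hneg) hh) ?_
      (fun x hx => hpos _ (neg_mem_slab hx)) (by simp [hr]) (by simp [hl]) ?_
    · intro x hx
      obtain ⟨p0, p1⟩ := hψ (-x) (neg_mem_slab hx)
      refine ⟨(p0.scomp x (hasDerivAt_neg x)).congr_deriv (by simp),
        ((p1.scomp x (hasDerivAt_neg x)).neg).congr_deriv ?_⟩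
      rw [hq']
      simp only [smul_eq_mul]
      ring
    · rw [hq']
      simp only [neg_neg]
      linear_combination -hvir
  · exact h0
  · exfalso
    refine key (q / h) ψ ψ' (div_pos hpos' hh) ?_ hpos hl hr ?_
    · rw [hq]; exact hψ
    · rw [hq]; exact hvir

/-- For short and for long slabs the bifurcation integral has a nonzero derivative at zero. -/
theorem nondegenerate (M : CriticalModes κ h d R E E' o o')
    (hreg : κ * d < 1 / 100 ∨ 6 < κ * d) :
    κ ^ 2 * (h ^ 2 * d ^ 2 - 1) ^ 2 * o d ≠ h ^ 2 * d * o' d := by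
  have hd := M.d_pos
  have hκ := M.kappa_pos
  rcases hreg with hreg | hreg
  · have : 1 / h ≤ d := by
      rw [div_le_iff₀ M.field_pos]; linarith [M.one_lt]
    exact (M.nondegenerate_of_short hreg this (by linarith) M.le).ne
  · refine (M.nondegenerate_of_long hd ?_ M.le).ne'
    have h1 : κ * d < h * d := mul_lt_mul_of_pos_right M.kappa_lt hd
    nlinarith

end CriticalModes

/-! ### Implicit functions and dependence of the end slope on the field. -/

/-- Implicit function theorem at a point of strict differentiability, with local uniqueness. -/
theorem exists_implicit_function {P Z : Type*} [NormedAddCommGroup P] [NormedSpace ℝ P]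
    [FiniteDimensional ℝ P] [NormedAddCommGroup Z] [NormedSpace ℝ Z] [FiniteDimensional ℝ Z]
    {F : P × Z → Z} {L : P × Z →L[ℝ] Z} {p₀ : P} {z₀ : Z}
    (hF : HasStrictFDerivAt F L (p₀, z₀)) (hL : ∀ z, L (0, z) = 0 → z = 0) :
    ∃ (g : P → Z) (U : Set P), IsOpen U ∧ p₀ ∈ U ∧ ContinuousOn g U ∧ g p₀ = z₀ ∧
      (∀ p ∈ U, F (p, g p) = F (p₀, z₀)) ∧
      ∀ᶠ x : P × Z in 𝓝 (p₀, z₀), F x = F (p₀, z₀) → x.2 = g x.1 := by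
  have : CompleteSpace (P × Z) := FiniteDimensional.complete ℝ _
  -- The derivative of `(p, z) ↦ (p, F(p, z))` is injective, hence invertible in finite dimension;
  -- the inverse function theorem then needs strict differentiability at one point only.
  let T : P × Z →L[ℝ] P × Z := (ContinuousLinearMap.fst ℝ P Z).prod L
  have hT : Function.Injective (T : P × Z →ₗ[ℝ] P × Z) := by
    refine (injective_iff_map_eq_zero _).2 ?_
    rintro ⟨p, z⟩ h
    obtain ⟨h1, h2⟩ := Prod.mk_inj.1 (show (p, L (p, z)) = (0, 0) from h)
    subst h1
    rw [hL z h2]; rfl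
  let e' : (P × Z) ≃L[ℝ] (P × Z) := (LinearEquiv.ofInjectiveEndo _ hT).toContinuousLinearEquiv
  have he' : (e' : P × Z →L[ℝ] P × Z) = T := by ext x <;> rfl
  have hG : HasStrictFDerivAt (fun x : P × Z => (x.1, F x)) (e' : P × Z →L[ℝ] P × Z) (p₀, z₀) := by
    rw [he']
    exact hasStrictFDerivAt_fst.prodMk hF
  let e := hG.toOpenPartialHomeomorph
  have hecoe : ∀ x, e x = (x.1, F x) := fun x => rfl
  have hmem : (p₀, z₀) ∈ e.source := hG.mem_toOpenPartialHomeomorph_source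
  have hpair : Continuous fun p : P => (p, F (p₀, z₀)) := by fun_prop
  have htgt : ∀ p, (p, F (p₀, z₀)) ∈ e.target →
      (e.symm (p, F (p₀, z₀))).1 = p ∧ F (e.symm (p, F (p₀, z₀))) = F (p₀, z₀) := fun p hp => by
    have := e.right_inv hp
    rw [hecoe] at this
    exact Prod.mk_inj.1 this
  refine ⟨fun p => (e.symm (p, F (p₀, z₀))).2, (fun p => (p, F (p₀, z₀))) ⁻¹' e.target,
    e.open_target.preimage hpair, ?_, ?_, ?_, ?_, ?_⟩
  · have := e.map_source hmem
    exact this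
  · exact continuous_snd.comp_continuousOn
      (e.continuousOn_symm.comp hpair.continuousOn fun p hp => hp)
  · have := e.left_inv hmem
    rw [hecoe] at this
    exact congrArg Prod.snd this
  · intro p hp
    obtain ⟨h1, h2⟩ := htgt p hp
    have h3 : (p, (e.symm (p, F (p₀, z₀))).2) = e.symm (p, F (p₀, z₀)) := Prod.ext h1.symm rfl
    show F (p, (e.symm (p, F (p₀, z₀))).2) = _
    rw [h3, h2]
  · filter_upwards [e.open_source.mem_nhds hmem] with x hx hFx
    have := e.left_inv hx
    rw [hecoe, hFx] at this
    exact (congrArg Prod.snd this).symm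

namespace CriticalModes

variable {κ h d R : ℝ} {E E' o o' : ℝ → ℝ}

lemma mem_d (M : CriticalModes κ h d R E E' o o') : d ∈ Set.Icc (-d) d :=
  ⟨by linarith [M.d_pos], le_rfl⟩

lemma profile_eq (M : CriticalModes κ h d R E E' o o') (ρ q : ℝ) {x : ℝ}
    (hx : x ∈ Set.Icc (-d) d) :
    profile (centreState h ρ q) ![0, 0, κ, d] x = linearProfile κ h ρ q E E' o o' x :=
  profile_eq_linearProfile M.kappa_pos.ne' M.field_pos.ne' M.d_pos ρ q (M.modeE.mono M.le)
    (M.modeo.mono M.le) M.E_zero M.E'_zero M.o_zero M.o'_zero x hx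

lemma endState_eq (M : CriticalModes κ h d R E E' o o') (ρ q : ℝ) :
    endState (centreState h ρ q) ![0, 0, κ, d] = linearProfile κ h ρ q E E' o o' d := by
  rw [GinzburgLandau.endState_eq (by simpa using M.d_pos.ne')]
  exact M.profile_eq ρ q M.mem_d

/-- The end slope of the even solution increases at a definite rate with the field. -/
lemma le_even_deriv_end (M : CriticalModes κ h d R E E' o o') {b : ℝ} (hb : h < b)
    {F F' : ℝ → ℝ} (hF : IsLinearMode κ b d F F') (h0 : F 0 = 1) (h1 : F' 0 = 0) :
    κ ^ 2 * (2 * h) * E d * d ^ 3 / 3 * (b - h) ≤ F' d := by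
  have hd := M.d_pos
  have hκ := M.kappa_pos
  have hh := M.field_pos
  have hsub : ∀ x ∈ Set.Icc 0 d, x ∈ Set.Icc (-d) d := fun x hx => ⟨by linarith [hx.1], hx.2⟩
  have hEm : IsLinearMode κ h d E E' := M.modeE.mono M.le
  have hst := fun x (hx : x ∈ Set.Icc 0 d) => sturm_comparison (a := 0) (b := d) (y := F) (y' := F')
    (g := E) (g' := E') (Q := fun x => κ ^ 2 * (b ^ 2 * x ^ 2 - 1))
    (q := fun x => κ ^ 2 * (h ^ 2 * x ^ 2 - 1))
    (fun x hx => (hF x (hsub x hx)).1.hasDerivWithinAt)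
    (fun x hx => (hF x (hsub x hx)).2.hasDerivWithinAt)
    (fun x hx => (hEm x (hsub x hx)).1.hasDerivWithinAt)
    (fun x hx => (hEm x (hsub x hx)).2.hasDerivWithinAt)
    (fun x _ => by
      have h2 : h ^ 2 ≤ b ^ 2 := by nlinarith
      have := mul_le_mul_of_nonneg_right h2 (sq_nonneg x)
      exact mul_le_mul_of_nonneg_left (by linarith) (sq_nonneg κ))
    (fun x hx => M.E_pos x (hsub x hx)) (by rw [h0]; exact one_pos)
    (by simp [h1, M.E'_zero]) hx
  simp only [h0, h1, M.E_zero, M.E'_zero, zero_mul, mul_zero, sub_zero] at hst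
  -- The nonnegative Wronskian makes `F / E` nondecreasing from the value `1`.
  have hratio : ∀ x ∈ Set.Icc 0 d, E x ≤ F x := fun x hx => by
    have := monotoneOn_Icc_of_hasDerivWithinAt (a := 0) (b := d) (f := fun x => F x / E x)
      (fun x hx => ((hF x (hsub x hx)).1.div (hEm x (hsub x hx)).1
        (M.E_pos x (hsub x hx)).ne').hasDerivWithinAt)
      (fun x hx => div_nonneg (hst x (Set.Ioo_subset_Icc_self hx)).2 (sq_nonneg _))
    have := this ⟨le_rfl, hd.le⟩ hx hx.1
    simp only [h0, M.E_zero, div_one] at this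
    rwa [le_div_iff₀ (M.E_pos x (hsub x hx)), one_mul] at this
  have hEd : ∀ x ∈ Set.Icc 0 d, E d ≤ E x := fun x hx => by
    have := monotoneOn_Icc_of_hasDerivWithinAt (a := 0) (b := d) (f := fun x => -E x)
      (fun x hx => (hEm x (hsub x hx)).1.neg.hasDerivWithinAt)
      (fun x hx => neg_nonneg.2 (M.E'_nonpos hx.1.le hx.2.le))
    exact neg_le_neg_iff.1 (this hx ⟨hd.le, le_rfl⟩ hx.2)
  have hEdp := M.E_pos d M.mem_d
  -- The Wronskian grows at rate `κ²(b² - h²)x² F E`, which is at least `2κ²h(b - h)x² E(d)²`; the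
  -- cubic subtracted is its primitive.
  have hfin := monotoneOn_Icc_of_hasDerivWithinAt (a := 0) (b := d)
    (f := fun x => F' x * E x - F x * E' x - κ ^ 2 * (2 * h * (b - h)) * E d ^ 2 * x ^ 3 / 3)
    (fun x hx => (((((hF x (hsub x hx)).2.mul (hEm x (hsub x hx)).1).sub
      ((hF x (hsub x hx)).1.mul (hEm x (hsub x hx)).2)).sub
      (((hasDerivAt_pow 3 x).const_mul (κ ^ 2 * (2 * h * (b - h)) * E d ^ 2)).div_const
        3))).hasDerivWithinAt)
    (fun x hx => by
      have hx' := Set.Ioo_subset_Icc_self hx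
      have e1 : E d * E d ≤ F x * E x := mul_le_mul ((hEd x hx').trans (hratio x hx'))
        (hEd x hx') hEdp.le (hEdp.le.trans ((hEd x hx').trans (hratio x hx')))
      have e2 : 2 * h * (b - h) ≤ b ^ 2 - h ^ 2 := by nlinarith
      have e3 : 0 ≤ 2 * h * (b - h) := by
        have := sub_pos.2 hb
        positivity
      have e4 : 2 * h * (b - h) * (E d * E d) ≤ (b ^ 2 - h ^ 2) * (F x * E x) :=
        mul_le_mul e2 e1 (by positivity) (by linarith)
      have e5 : κ ^ 2 * x ^ 2 * (2 * h * (b - h) * (E d * E d)) ≤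
          κ ^ 2 * x ^ 2 * ((b ^ 2 - h ^ 2) * (F x * E x)) :=
        mul_le_mul_of_nonneg_left e4 (by positivity)
      simp
      nlinarith)
  have hlast := hfin ⟨le_rfl, hd.le⟩ ⟨hd.le, le_rfl⟩ hd.le
  simp only [h0, h1, M.E_zero, M.E'_zero, M.E'_end] at hlast
  norm_num at hlast
  have : κ ^ 2 * (2 * h) * E d * d ^ 3 / 3 * (b - h) * E d ≤ F' d * E d := by nlinarith
  exact le_of_mul_le_mul_right this hEdp

/-- The end slope vanishes at `b = h`, and its difference quotients from the right are at least the
positive constant `c`. This transversality drives both applications of the implicit function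
theorem. -/
lemma deriv_even_end_pos (M : CriticalModes κ h d R E E' o o') (ρ q : ℝ) {T' : ℝ}
    (hT : HasDerivAt (fun b => endState (centreState b ρ q) ![0, 0, κ, d] 1) T' h) : 0 < T' := by
  have hd := M.d_pos
  have hκ := M.kappa_pos
  have hh := M.field_pos
  set c := κ ^ 2 * (2 * h) * E d * d ^ 3 / 3 with hc
  have hcpos : 0 < c := by
    have := M.E_pos d M.mem_d
    positivity
  have h0 : endState (centreState h ρ q) ![0, 0, κ, d] 1 = 0 := by
    rw [M.endState_eq]; simp [linearProfile, M.E'_end]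
  have hlim := (hasDerivWithinAt_iff_tendsto_slope' (Set.self_notMem_Ioi)).1
    (hT.hasDerivWithinAt (s := Set.Ioi h))
  refine hcpos.trans_le (ge_of_tendsto hlim ?_)
  filter_upwards [self_mem_nhdsWithin] with b hb
  have hb' : h < b := hb
  have hb0 : b ≠ 0 := (hh.trans hb').ne'
  obtain ⟨F, F', f0, f1, hF⟩ := exists_isLinearMode κ b d 1 0
  obtain ⟨w, w', w0, w1, hw⟩ := exists_isLinearMode κ b d 0 1
  have hE : endState (centreState b ρ q) ![0, 0, κ, d] 1 = F' d := by
    rw [GinzburgLandau.endState_eq (by simpa using hd.ne')]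
    have := profile_eq_linearProfile hκ.ne' hb0 hd ρ q hF hw f0 f1 w0 w1 d M.mem_d
    simp [this, linearProfile]
  rw [slope_def_field, h0, sub_zero, hE, le_div_iff₀ (sub_pos.2 hb')]
  exact M.le_even_deriv_end hb' hF f0 f1

end CriticalModes

/-- The data from which the endpoint map is computed depend smoothly on parameters. -/
lemma hasStrictFDerivAt_endState_comp {X : Type*} [NormedAddCommGroup X] [NormedSpace ℝ X]
    {w : X → (Fin 8 → ℝ) × (Fin 4 → ℝ)} {x : X} (hw : ContDiff ℝ 1 w)
    (h : FlowsFrom timeField (w x)) :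
    ∃ L : X →L[ℝ] (Fin 8 → ℝ), HasStrictFDerivAt (fun x => endState (w x).1 (w x).2) L x := by
  obtain ⟨L, hL⟩ := hasStrictFDerivAt_endState (y := (w x).1) (p := (w x).2) h
  exact ⟨_, HasStrictFDerivAt.comp (g := fun w : (Fin 8 → ℝ) × (Fin 4 → ℝ) => endState w.1 w.2)
    (f := w) x hL (hw.contDiffAt.hasStrictFDerivAt one_ne_zero)⟩

lemma continuousAt_flow_apply {X : Type*} [TopologicalSpace X]
    {w : X → (Fin 8 → ℝ) × (Fin 4 → ℝ)} {x : X} (hw : ContinuousAt w x)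
    (h : FlowsFrom timeField (w x)) (s : TimeInterval) :
    ContinuousAt (fun z : X × TimeInterval => flow timeField (w z.1) z.2) (x, s) := by
  have h1 : ContinuousAt (fun z : X × TimeInterval => (flow timeField (w z.1), z.2)) (x, s) := by
    refine ContinuousAt.prodMk ?_ continuousAt_snd
    have h2 : ContinuousAt (fun z : X => flow timeField (w z)) x :=
      ContinuousAt.comp (g := flow timeField) (h.continuousAt contDiff_timeField) hw
    exact ContinuousAt.comp (f := Prod.fst) (g := fun z : X => flow timeField (w z))
      (x := (x, s)) h2 continuousAt_fst
  exact ContinuousAt.comp (g := fun z : C(TimeInterval, (Fin 8 → ℝ) × (Fin 4 → ℝ)) × TimeInterval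
    => z.1 z.2) continuous_eval.continuousAt h1

/-- An open condition on the values of a flow, uniformly over the time interval, persists under
small changes of the data. -/
lemma eventually_forall_flow {X Y : Type*} [TopologicalSpace X] [TopologicalSpace Y]
    {w : X → (Fin 8 → ℝ) × (Fin 4 → ℝ)} {x : X} (hw : ContinuousAt w x)
    (h : FlowsFrom timeField (w x)) {S : Set Y} (hS : IsOpen S)
    {Φ : X × TimeInterval × (Fin 8 → ℝ) → Y}
    (hΦ : ∀ s, ContinuousAt Φ (x, s, (flow timeField (w x) s).1))
    (hx : ∀ s, Φ (x, s, (flow timeField (w x) s).1) ∈ S) :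
    ∀ᶠ z in 𝓝 x, ∀ s, Φ (z, s, (flow timeField (w z) s).1) ∈ S := by
  have := isCompact_univ.eventually_forall_of_forall_eventually (x₀ := x) (K := Set.univ)
    (P := fun z s => Φ (z, s, (flow timeField (w z) s).1) ∈ S) fun s _ => by
    have h1 : ContinuousAt (fun z : X × TimeInterval =>
        (z.1, z.2, (flow timeField (w z.1) z.2).1)) (x, s) :=
      continuousAt_fst.prodMk (continuousAt_snd.prodMk
        (continuous_fst.continuousAt.comp (continuousAt_flow_apply hw h s)))
    exact (ContinuousAt.comp (g := Φ) (f := fun z : X × TimeInterval =>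
      (z.1, z.2, (flow timeField (w z.1) z.2).1)) (x := (x, s)) (hΦ s) h1).eventually (hS.mem_nhds (hx s))
  simpa using this

lemma centreState_contDiff {X : Type*} [NormedAddCommGroup X] [NormedSpace ℝ X]
    {b ρ q σ ζ κ d : X → ℝ} (hb : ContDiff ℝ 1 b) (hρ : ContDiff ℝ 1 ρ) (hq : ContDiff ℝ 1 q)
    (hσ : ContDiff ℝ 1 σ) (hζ : ContDiff ℝ 1 ζ) (hκ : ContDiff ℝ 1 κ) (hd : ContDiff ℝ 1 d) :
    ContDiff ℝ 1 fun x => (centreState (b x) (ρ x) (q x),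
      (![σ x, ζ x, κ x, d x] : Fin 4 → ℝ)) := by
  refine ContDiff.prodMk (contDiff_pi.2 fun i => ?_) (contDiff_pi.2 fun i => ?_)
  · fin_cases i <;> simp [centreState] <;> first | assumption | exact contDiff_const
  · fin_cases i <;> simp <;> assumption

/-! ### The branch of symmetric solutions. -/

/-- Initial data at the centre for symmetric solutions, in terms of the squared amplitude and the
slope of the potential there. -/
def symmetricData (κ d : ℝ) (z : ℝ × ℝ) : (Fin 8 → ℝ) × (Fin 4 → ℝ) :=
  (centreState z.2 0 0, ![z.1, 0, κ, d])

/-- The end state of the symmetric solution. -/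
noncomputable def symmetricEnd (κ d : ℝ) (z : ℝ × ℝ) : Fin 8 → ℝ :=
  endState (symmetricData κ d z).1 (symmetricData κ d z).2

lemma contDiff_symmetricData (κ d : ℝ) : ContDiff ℝ 1 (symmetricData κ d) :=
  centreState_contDiff contDiff_snd contDiff_const contDiff_const contDiff_fst contDiff_const
    contDiff_const contDiff_const

/-- Data of a symmetric solution with squared amplitude `τ` at the ends of the slab. -/
structure IsSymmetricState (κ d τ : ℝ) (z : ℝ × ℝ) : Prop where
  flows : FlowsFrom timeField (symmetricData κ d z)
  pos : ∀ s, 0 < (flow timeField (symmetricData κ d z) s).1 0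
  field_pos : 0 < symmetricEnd κ d z 5
  amplitude : z.1 * symmetricEnd κ d z 0 ^ 2 = τ
  neumann : symmetricEnd κ d z 1 = 0

/-- Replacing the asymmetric components by zero gives another profile with the same centre state. -/
lemma IsSymmetricState.profile_vanish {κ d τ : ℝ} {z : ℝ × ℝ} (hd : 0 < d)
    (hz : IsSymmetricState κ d τ z) {x : ℝ} (hx : x ∈ Set.Icc (-d) d) :
    profile (centreState z.2 0 0) ![z.1, 0, κ, d] x 2 = 0 ∧
      profile (centreState z.2 0 0) ![z.1, 0, κ, d] x 3 = 0 ∧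
      profile (centreState z.2 0 0) ![z.1, 0, κ, d] x 6 = 0 ∧
      profile (centreState z.2 0 0) ![z.1, 0, κ, d] x 7 = 0 := by
  set P := profile (centreState z.2 0 0) ![z.1, 0, κ, d]
  have hP : IsProfile ![z.1, 0, κ, d] P := isProfile_profile (p := ![z.1, 0, κ, d]) hd hz.flows
  have h0 : P 0 = centreState z.2 0 0 := profile_zero hz.flows
  have hQ : IsProfile ![z.1, 0, κ, d] fun x => ![P x 0, P x 1, 0, 0, P x 4, P x 5, 0, 0] := by
    intro x hx
    have h (i : Fin 8) := hP.apply i hx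
    have hc := hasDerivWithinAt_const x
      (Set.Icc (-(![z.1, 0, κ, d] : Fin 4 → ℝ) 3) ((![z.1, 0, κ, d] : Fin 4 → ℝ) 3)) (0 : ℝ)
    refine hasDerivWithinAt_pi.2 fun i => ?_
    fin_cases i
    · exact (h 0).congr_deriv (by simp [partsField])
    · exact (h 1).congr_deriv (by simp [partsField])
    · exact hc.congr_deriv (by simp [partsField])
    · exact hc.congr_deriv (by simp [partsField])
    · exact (h 4).congr_deriv (by simp [partsField])
    · exact (h 5).congr_deriv (by simp [partsField])
    · exact hc.congr_deriv (by simp [partsField])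
    · exact hc.congr_deriv (by simp [partsField])
  have := hP.eqOn hd hQ (by
    ext i
    fin_cases i <;> simp [h0, centreState]) hx
  rw [this]
  simp

/-- The unknowns `(σ, b)` are determined by `σ E(d)² = τ` and `E'(d) = 0`. At `σ = 0` the
linearization is triangular, with diagonal entries `E(d)²` and the derivative of the end slope in
`b`, both positive. Using `τ = α²` as parameter avoids the square root in `α = √σ E(d)`. -/
theorem exists_symmetric_branch {κ d : ℝ} (hκ : 0 < κ) (hd : 0 < d) :
    ∃ (g : ℝ → ℝ × ℝ) (U : Set ℝ), IsOpen U ∧ 0 ∈ U ∧ ContinuousOn g U ∧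
      g 0 = (0, criticalField κ d 0) ∧ (∀ τ ∈ U, IsSymmetricState κ d τ (g τ)) ∧
      ∀ᶠ x : ℝ × (ℝ × ℝ) in 𝓝 (0, (0, criticalField κ d 0)),
        x.2.1 * symmetricEnd κ d x.2 0 ^ 2 = x.1 → symmetricEnd κ d x.2 1 = 0 → x.2 = g x.1 := by
  obtain ⟨E, E', o, o', M⟩ := exists_criticalModes hκ hd le_rfl
  set h := criticalField κ d 0
  have hh := M.field_pos
  have hflow : FlowsFrom timeField (symmetricData κ d (0, h)) :=
    flowsFrom_of_zero_amplitude hκ.ne' hh.ne' hd 0 0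
  obtain ⟨L, hL⟩ := hasStrictFDerivAt_endState_comp (contDiff_symmetricData κ d) hflow
  have hL : HasStrictFDerivAt (symmetricEnd κ d) L (0, h) := hL
  have hend : symmetricEnd κ d (0, h) = linearProfile κ h 0 0 E E' o o' d := M.endState_eq 0 0
  have he0 : symmetricEnd κ d (0, h) 0 = E d := by rw [hend]; rfl
  have he1 : symmetricEnd κ d (0, h) 1 = 0 := by rw [hend]; exact M.E'_end
  have he5 : symmetricEnd κ d (0, h) 5 = h := by rw [hend]; rfl
  have hEd : 0 < E d := M.E_pos d M.mem_d
  have hLi (i : Fin 8) : HasStrictFDerivAt (fun z => symmetricEnd κ d z i)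
      ((ContinuousLinearMap.proj i).comp L) (0, h) :=
    (ContinuousLinearMap.proj (R := ℝ) (φ := fun _ : Fin 8 => ℝ) i).hasStrictFDerivAt.comp _ hL
  let F : ℝ × (ℝ × ℝ) → ℝ × ℝ := fun x =>
    (x.2.1 * symmetricEnd κ d x.2 0 ^ 2 - x.1, symmetricEnd κ d x.2 1)
  have hsnd : HasStrictFDerivAt (fun x : ℝ × (ℝ × ℝ) => x.2) (ContinuousLinearMap.snd ℝ ℝ (ℝ × ℝ))
      (0, (0, h)) := hasStrictFDerivAt_snd
  have hi (i : Fin 8) := HasStrictFDerivAt.comp (g := fun z => symmetricEnd κ d z i)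
    (f := fun x : ℝ × (ℝ × ℝ) => x.2) (0, (0, h)) (hLi i) hsnd
  have hσ : HasStrictFDerivAt (fun x : ℝ × (ℝ × ℝ) => x.2.1)
      ((ContinuousLinearMap.fst ℝ ℝ ℝ).comp (ContinuousLinearMap.snd ℝ ℝ (ℝ × ℝ))) (0, (0, h)) :=
    ((ContinuousLinearMap.fst ℝ ℝ ℝ).comp (ContinuousLinearMap.snd ℝ ℝ (ℝ × ℝ))).hasStrictFDerivAt
  have hF := ((hσ.mul ((hi 0).pow 2)).sub (hasStrictFDerivAt_fst (𝕜 := ℝ)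
    (p := ((0 : ℝ), ((0 : ℝ), h))))).prodMk (hi 1)
  obtain ⟨g, U, hUo, hU0, hgc, hg0, hgU, hloc⟩ := exists_implicit_function
    (F := F) (p₀ := (0 : ℝ)) (z₀ := ((0 : ℝ), h)) hF (by
      rintro ⟨s, c⟩ hz
      obtain ⟨z1, z2⟩ := Prod.mk_inj.1 hz
      have hs : s = 0 := by
        simp [he0] at z1
        rcases z1 with h | h
        · exact absurd h hEd.ne'
        · exact h
      subst hs
      have hline : HasDerivAt (fun b : ℝ => symmetricEnd κ d (0, b) 1) (L (0, 1) 1) h := by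
        have hl : HasDerivAt (fun b : ℝ => ((0 : ℝ), b)) ((0 : ℝ), (1 : ℝ)) h :=
          (hasDerivAt_const h (0 : ℝ)).prodMk (hasDerivAt_id h)
        exact HasFDerivAt.comp_hasDerivAt (f := fun b : ℝ => ((0 : ℝ), b)) h
          (hLi 1).hasFDerivAt hl
      have hpos := M.deriv_even_end_pos 0 0 hline
      have hlin : L (0, c) = c • L (0, 1) := by rw [← map_smul]; simp
      have z2' : L (0, c) 1 = 0 := z2
      rw [hlin, Pi.smul_apply, smul_eq_mul, mul_eq_zero] at z2'
      rcases z2' with h | h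
      · rw [h]; rfl
      · exact absurd h hpos.ne')
  have hF0 : F (0, (0, h)) = 0 := by simp [F, he1]
  have hev : ∀ᶠ z in 𝓝 ((0 : ℝ), h), FlowsFrom timeField (symmetricData κ d z) ∧
      (∀ s, 0 < (flow timeField (symmetricData κ d z) s).1 0) ∧ 0 < symmetricEnd κ d z 5 := by
    have hcont := (contDiff_symmetricData κ d).continuous.continuousAt (x := ((0 : ℝ), h))
    refine (hcont.eventually (hflow.eventually contDiff_timeField)).and (Filter.Eventually.and ?_ ?_)
    · refine eventually_forall_flow hcont hflow (S := Set.Ioi (0 : ℝ)) isOpen_Ioi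
        (Φ := fun y => y.2.2 0) (fun s => by fun_prop) (fun s => ?_)
      have h1 : (flow timeField (symmetricData κ d (0, h)) s).1 =
          profile (centreState h 0 0) ![0, 0, κ, d] (d * s) := by
        rw [profile]
        show _ = (flow timeField _ (clampTime (d * s / d))).1
        rw [mul_div_cancel_left₀ _ hd.ne', clampTime_coe]
        rfl
      show 0 < (flow timeField (symmetricData κ d (0, h)) s).1 0
      rw [h1, M.profile_eq 0 0 (mul_mem_Icc hd s.2)]
      exact M.E_pos _ (mul_mem_Icc hd s.2)
    · exact (hLi 5).continuousAt.eventually (lt_mem_nhds (by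
        show 0 < symmetricEnd κ d (0, h) 5
        rw [he5]
        exact hh))
  have hgcont : ContinuousAt g 0 := hgc.continuousAt (hUo.mem_nhds hU0)
  have hev' := hgcont.eventually (by rw [hg0]; exact hev)
  obtain ⟨W, hWs, hWo, hW0⟩ := eventually_nhds_iff.1 hev'
  refine ⟨g, U ∩ W, hUo.inter hWo, ⟨hU0, hW0⟩, hgc.mono Set.inter_subset_left, hg0,
    fun τ hτ => ?_, ?_⟩
  · obtain ⟨h1, h2, h3⟩ := hWs τ hτ.2
    have h4 := hgU τ hτ.1
    rw [hF0] at h4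
    obtain ⟨h5, h6⟩ := Prod.mk_inj.1 h4
    exact ⟨h1, h2, h3, sub_eq_zero.1 h5, h6⟩
  · filter_upwards [hloc] with x hx h1 h2
    refine hx ?_
    rw [hF0]
    exact Prod.ext (sub_eq_zero.2 h1) h2

/-- The symmetric solution belonging to symmetric data of positive amplitude. -/
lemma IsSymmetricState.isSolution {κ d α : ℝ} {z : ℝ × ℝ} (hd : 0 < d) (hα : 0 < α)
    (hz : IsSymmetricState κ d (α ^ 2) z) :
    IsSolution κ d (symmetricEnd κ d z 5)
        (fun x => √z.1 * profile (centreState z.2 0 0) ![z.1, 0, κ, d] x 0)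
        (fun x => profile (centreState z.2 0 0) ![z.1, 0, κ, d] x 4) ∧
      IsSymmetric d (fun x => √z.1 * profile (centreState z.2 0 0) ![z.1, 0, κ, d] x 0)
        (fun x => profile (centreState z.2 0 0) ![z.1, 0, κ, d] x 4) ∧
      √z.1 * profile (centreState z.2 0 0) ![z.1, 0, κ, d] (-d) 0 = α := by
  have hdd : d ∈ Set.Icc (-d) d := ⟨by linarith, le_rfl⟩
  have hσ : 0 < z.1 := by
    have h1 : 0 < z.1 * symmetricEnd κ d z 0 ^ 2 := by rw [hz.amplitude]; positivity
    exact pos_of_mul_pos_left h1 (sq_nonneg _)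
  have hs2 : √z.1 ^ 2 = z.1 := Real.sq_sqrt hσ.le
  have hP : IsProfile ![z.1, 0, κ, d] (profile (centreState z.2 0 0) ![z.1, 0, κ, d]) :=
    isProfile_profile (p := ![z.1, 0, κ, d]) hd hz.flows
  have h0 : profile (centreState z.2 0 0) ![z.1, 0, κ, d] 0 = centreState z.2 0 0 :=
    profile_zero hz.flows
  have hend : symmetricEnd κ d z = profile (centreState z.2 0 0) ![z.1, 0, κ, d] d :=
    endState_eq (p := ![z.1, 0, κ, d]) hd.ne'
  have hpos : ∀ x ∈ Set.Icc (-d) d, 0 < profile (centreState z.2 0 0) ![z.1, 0, κ, d] x 0 :=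
    fun x _ => hz.pos _
  have hneg : ∀ x ∈ Set.Icc (-d) d, profile (centreState z.2 0 0) ![z.1, 0, κ, d] (-x) =
      reflectState (profile (centreState z.2 0 0) ![z.1, 0, κ, d] x) := fun x hx =>
    hP.apply_neg hd h0 hx
  have hv := hz.profile_vanish hd hdd
  have hP' : IsProfile ![√z.1 ^ 2, 0 ^ 2, κ, d]
      (profile (centreState z.2 0 0) ![z.1, 0, κ, d]) := by
    rw [hs2]; simpa using hP
  have hsol := (hP'.isSolution hd (Real.sqrt_pos.2 hσ) h0 (by rw [← hend]; exact hz.neumann)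
    hv.2.1 hv.2.2.2 (by rw [← hend]; exact hz.field_pos)
    (fun x hx => by simpa using hpos x hx)).1
  simp only [zero_mul, add_zero, ← hend] at hsol
  refine ⟨hsol, fun x hx => ?_, ?_⟩
  · simp [hneg x hx, reflectState]
  · have hα2 : (√z.1 * symmetricEnd κ d z 0) ^ 2 = α ^ 2 := by
      rw [mul_pow, hs2, hz.amplitude]
    have hnn : 0 ≤ √z.1 * symmetricEnd κ d z 0 := by
      rw [hend]; exact mul_nonneg (Real.sqrt_nonneg _) (hpos d hdd).le
    rw [hneg d hdd, ← hend]
    exact (pow_left_inj₀ hnn hα.le two_ne_zero).1 hα2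

/-- The field is `H(α) = A'(d)` and the order parameter is `√σ E`, evaluated on the branch at `τ =
α²`; continuity down to `α = 0` follows from that of the square root and of the flow. -/
theorem symmetricBifurcation {κ d : ℝ} (hκ : 0 < κ) (hd : 0 < d) : SymmetricBifurcation κ d := by
  obtain ⟨g, U, hUo, hU0, hgc, hg0, hgU, -⟩ := exists_symmetric_branch hκ hd
  obtain ⟨r, hr, hrU⟩ := Metric.isOpen_iff.1 hUo 0 hU0
  have hmem : ∀ α ∈ Set.Ico 0 (√r), α ^ 2 ∈ U := fun α hα => hrU (by
    have : α ^ 2 < r := by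
      have := pow_lt_pow_left₀ hα.2 hα.1 two_ne_zero
      rwa [Real.sq_sqrt hr.le] at this
    rw [Metric.mem_ball, Real.dist_eq, sub_zero, abs_of_nonneg (sq_nonneg α)]
    exact this)
  have hgα : ContinuousOn (fun α : ℝ => g (α ^ 2)) (Set.Ico 0 (√r)) :=
    hgc.comp (by fun_prop) hmem
  have hjoint : ∀ y ∈ Set.Ico 0 (√r) ×ˢ Set.Icc (-d) d, ContinuousWithinAt
      (fun y : ℝ × ℝ => flow timeField (symmetricData κ d (g (y.1 ^ 2))) (clampTime (y.2 / d)))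
      (Set.Ico 0 (√r) ×ˢ Set.Icc (-d) d) y := by
    intro y hy
    have h1 := continuousAt_flow_apply (contDiff_symmetricData κ d).continuous.continuousAt
      (hgU _ (hmem _ hy.1)).flows (clampTime (y.2 / d))
    have h2 : ContinuousWithinAt (fun y : ℝ × ℝ => (g (y.1 ^ 2), clampTime (y.2 / d)))
        (Set.Ico 0 (√r) ×ˢ Set.Icc (-d) d) y :=
      ((hgα y.1 hy.1).comp continuousWithinAt_fst fun z hz => hz.1).prodMk
        (continuous_clampTime.comp (by fun_prop)).continuousWithinAt
    exact ContinuousAt.comp_continuousWithinAt (f := fun y : ℝ × ℝ =>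
      (g (y.1 ^ 2), clampTime (y.2 / d))) h1 h2
  have hjoint' (i : Fin 8) : ContinuousOn (fun y : ℝ × ℝ =>
      profile (centreState (g (y.1 ^ 2)).2 0 0) ![(g (y.1 ^ 2)).1, 0, κ, d] y.2 i)
      (Set.Ico 0 (√r) ×ˢ Set.Icc (-d) d) := fun y hy =>
    (continuous_apply i).continuousAt.comp_continuousWithinAt
      (continuous_fst.continuousAt.comp_continuousWithinAt (hjoint y hy))
  have hdd : d ∈ Set.Icc (-d) d := ⟨by linarith, le_rfl⟩
  have hend : ∀ z, symmetricEnd κ d z = profile (centreState z.2 0 0) ![z.1, 0, κ, d] d :=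
    fun z => endState_eq (p := ![z.1, 0, κ, d]) hd.ne'
  obtain ⟨E, E', o, o', M⟩ := exists_criticalModes hκ hd le_rfl
  refine ⟨√r, Real.sqrt_pos.2 hr, fun α => symmetricEnd κ d (g (α ^ 2)) 5,
    fun α x => √(g (α ^ 2)).1 *
      profile (centreState (g (α ^ 2)).2 0 0) ![(g (α ^ 2)).1, 0, κ, d] x 0,
    fun α x => profile (centreState (g (α ^ 2)).2 0 0) ![(g (α ^ 2)).1, 0, κ, d] x 4,
    ?_, ?_, hjoint' 4, ?_, ?_, ?_⟩
  · simp only [hend]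
    exact (hjoint' 5).comp (f := fun α : ℝ => (α, d)) (by fun_prop) fun α hα => ⟨hα, hdd⟩
  · have hs : ContinuousOn (fun y : ℝ × ℝ => √(g (y.1 ^ 2)).1)
        (Set.Ico 0 (√r) ×ˢ Set.Icc (-d) d) :=
      Real.continuous_sqrt.comp_continuousOn (continuous_fst.comp_continuousOn
        (hgα.comp continuousOn_fst fun y hy => hy.1))
    exact hs.mul (hjoint' 0)
  · have : symmetricEnd κ d (0, criticalField κ d 0) = _ := M.endState_eq 0 0
    simp only [ne_eq, OfNat.ofNat_ne_zero, not_false_eq_true, zero_pow, hg0, this]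
    rfl
  · intro x hx
    simp only [ne_eq, OfNat.ofNat_ne_zero, not_false_eq_true, zero_pow, hg0, Real.sqrt_zero,
      zero_mul, M.profile_eq 0 0 hx, true_and]
    rfl
  · intro α hα
    exact (hgU _ (hmem α ⟨hα.1.le, hα.2⟩)).isSolution hd hα.1

/-! ### The branch of normalized asymmetric data. -/

/-- Initial data at the centre, with the asymmetry normalized by `e = 1`. -/
def asymmetricData (x : (Fin 4 → ℝ) × (ℝ × ℝ)) : (Fin 8 → ℝ) × (Fin 4 → ℝ) :=
  (centreState x.2.1 x.2.2 1, x.1)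

/-- The end state belonging to normalized asymmetric data. -/
noncomputable def asymmetricEnd (x : (Fin 4 → ℝ) × (ℝ × ℝ)) : Fin 8 → ℝ :=
  endState (asymmetricData x).1 (asymmetricData x).2

lemma contDiff_asymmetricData : ContDiff ℝ 1 asymmetricData := by
  refine ContDiff.prodMk (contDiff_pi.2 fun i => ?_) contDiff_fst
  fin_cases i <;> simp [centreState] <;> fun_prop

/-- The data at which asymmetric solutions may bifurcate from the symmetric normal state. -/
noncomputable def asymmetricBase (κ d : ℝ) : ℝ × ℝ :=
  (criticalField κ d 0, Classical.epsilon fun ρ =>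
    asymmetricEnd (![0, 0, κ, d], (criticalField κ d 0, ρ)) 3 = 0)

section Base

variable {κ d : ℝ} {E E' o o' : ℝ → ℝ}

lemma CriticalModes.asymmetricEnd_eq (M : CriticalModes κ (criticalField κ d 0) d d E E' o o')
    (ρ : ℝ) : asymmetricEnd (![0, 0, κ, d], (criticalField κ d 0, ρ)) =
      linearProfile κ (criticalField κ d 0) ρ 1 E E' o o' d :=
  M.endState_eq ρ 1

/-- At zero amplitude the end slope of the odd part is affine in `ρ`, and its coefficient, the slope
of the odd mode at `d`, is not zero. -/
lemma asymmetricBase_unique (hκ : 0 < κ) (hd : 0 < d) {ρ : ℝ} :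
    asymmetricEnd (![0, 0, κ, d], (criticalField κ d 0, ρ)) 3 = 0 ↔
      (criticalField κ d 0, ρ) = asymmetricBase κ d := by
  obtain ⟨E, E', o, o', M⟩ := exists_criticalModes hκ hd le_rfl
  have ho := (M.o'_pos M.mem_d).ne'
  have hex : ∃ ρ, asymmetricEnd (![0, 0, κ, d], (criticalField κ d 0, ρ)) 3 = 0 := by
    refine ⟨-(1 / criticalField κ d 0 * (κ ^ 2 * (criticalField κ d 0 ^ 2 * d ^ 2 - 1) * E d)) / o' d
      - 1 / criticalField κ d 0 * κ ^ 2, ?_⟩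
    rw [M.asymmetricEnd_eq]
    simp only [linearProfile]
    simp
    field_simp
    ring
  have hspec := Classical.epsilon_spec hex
  constructor
  · intro h
    refine Prod.ext rfl ?_
    show ρ = Classical.epsilon _
    rw [M.asymmetricEnd_eq] at h hspec
    simp only [linearProfile] at h hspec
    simp at h hspec
    have h3 := h.trans hspec.symm
    have h4 := mul_right_cancel₀ ho (add_left_cancel h3)
    linarith
  · intro h
    rw [(Prod.mk_inj.1 h).2]
    exact hspec

lemma asymmetricEnd_base (hκ : 0 < κ) (hd : 0 < d) :
    asymmetricEnd (![0, 0, κ, d], asymmetricBase κ d) 1 = 0 ∧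
      asymmetricEnd (![0, 0, κ, d], asymmetricBase κ d) 3 = 0 := by
  obtain ⟨E, E', o, o', M⟩ := exists_criticalModes hκ hd le_rfl
  refine ⟨?_, (asymmetricBase_unique hκ hd (ρ := (asymmetricBase κ d).2)).2 rfl⟩
  have := congrFun (M.asymmetricEnd_eq (asymmetricBase κ d).2) 1
  exact this.trans (by simp [linearProfile, M.E'_end])

lemma flowsFrom_asymmetricBase (hκ : 0 < κ) (hd : 0 < d) :
    FlowsFrom timeField (asymmetricData (![0, 0, κ, d], asymmetricBase κ d)) := by
  obtain ⟨E, E', o, o', M⟩ := exists_criticalModes hκ hd le_rfl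
  exact flowsFrom_of_zero_amplitude hκ.ne' M.field_pos.ne' hd _ _

lemma continuousAt_asymmetricEnd (hκ : 0 < κ) (hd : 0 < d) :
    ContinuousAt asymmetricEnd (![0, 0, κ, d], asymmetricBase κ d) := by
  obtain ⟨L, hL⟩ := hasStrictFDerivAt_endState_comp contDiff_asymmetricData
    (flowsFrom_asymmetricBase hκ hd)
  exact hL.continuousAt

lemma flow_asymmetricBase (M : CriticalModes κ (criticalField κ d 0) d d E E' o o')
    (s : TimeInterval) :
    (flow timeField (asymmetricData (![0, 0, κ, d], asymmetricBase κ d)) s).1 =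
      linearProfile κ (criticalField κ d 0) (asymmetricBase κ d).2 1 E E' o o' (d * s) := by
  rw [← M.profile_eq _ 1 (mul_mem_Icc M.d_pos s.2), profile]
  show _ = (flow timeField _ (clampTime (d * s / d))).1
  rw [mul_div_cancel_left₀ _ M.d_pos.ne', clampTime_coe]
  rfl

/-- The Jacobian of the end values `E'(d)`, `o'(d)` in `(b, ρ)` is triangular at the base: the first
does not depend on `ρ` and has positive derivative in `b`, the second has as derivative in `ρ` the
positive end slope of the odd mode. -/
theorem exists_asymmetric_branch (hκ : 0 < κ) (hd : 0 < d) :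
    ∃ (g : (Fin 4 → ℝ) → ℝ × ℝ) (U : Set (Fin 4 → ℝ)), IsOpen U ∧ ![0, 0, κ, d] ∈ U ∧
      ContinuousOn g U ∧ g ![0, 0, κ, d] = asymmetricBase κ d ∧
      (∀ p ∈ U, asymmetricEnd (p, g p) 1 = 0 ∧ asymmetricEnd (p, g p) 3 = 0) ∧
      ∀ᶠ x in 𝓝 (![0, 0, κ, d], asymmetricBase κ d),
        asymmetricEnd x 1 = 0 → asymmetricEnd x 3 = 0 → x.2 = g x.1 := by
  obtain ⟨E, E', o, o', M⟩ := exists_criticalModes hκ hd le_rfl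
  obtain ⟨L, hL⟩ := hasStrictFDerivAt_endState_comp contDiff_asymmetricData
    (flowsFrom_asymmetricBase hκ hd)
  have hL : HasStrictFDerivAt asymmetricEnd L (![0, 0, κ, d], asymmetricBase κ d) := hL
  have hLi (i : Fin 8) : HasStrictFDerivAt (fun z => asymmetricEnd z i)
      ((ContinuousLinearMap.proj i).comp L) (![0, 0, κ, d], asymmetricBase κ d) :=
    (ContinuousLinearMap.proj (R := ℝ) (φ := fun _ : Fin 8 => ℝ) i).hasStrictFDerivAt.comp _ hL
  obtain ⟨b1, b3⟩ := asymmetricEnd_base hκ hd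
  have hdir (i : Fin 8) (u v : ℝ) : HasDerivAt (fun t : ℝ => asymmetricEnd
      (![0, 0, κ, d], ((asymmetricBase κ d).1 + t * u, (asymmetricBase κ d).2 + t * v)) i)
      (L (0, (u, v)) i) 0 := by
    have hl : HasDerivAt (fun t : ℝ => ((![0, 0, κ, d] : Fin 4 → ℝ),
        ((asymmetricBase κ d).1 + t * u, (asymmetricBase κ d).2 + t * v)))
        ((0 : Fin 4 → ℝ), (u, v)) 0 := by
      refine (hasDerivAt_const _ _).prodMk (HasDerivAt.prodMk ?_ ?_)
      · simpa using ((hasDerivAt_id (0 : ℝ)).mul_const u).const_add (asymmetricBase κ d).1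
      · simpa using ((hasDerivAt_id (0 : ℝ)).mul_const v).const_add (asymmetricBase κ d).2
    have hd' : HasFDerivAt (fun z => asymmetricEnd z i) ((ContinuousLinearMap.proj i).comp L)
        ((![0, 0, κ, d] : Fin 4 → ℝ),
          ((asymmetricBase κ d).1 + 0 * u, (asymmetricBase κ d).2 + 0 * v)) := by
      simpa using (hLi i).hasFDerivAt
    exact HasFDerivAt.comp_hasDerivAt (f := fun t : ℝ => ((![0, 0, κ, d] : Fin 4 → ℝ),
      ((asymmetricBase κ d).1 + t * u, (asymmetricBase κ d).2 + t * v))) 0 hd' hl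
  have hv (i : Fin 8) {c₀ c₁ : ℝ} (hi : ∀ ρ, asymmetricEnd
      (![0, 0, κ, d], (criticalField κ d 0, ρ)) i = c₀ + c₁ * ρ) : L (0, (0, 1)) i = c₁ := by
    refine (hdir i 0 1).unique ?_
    have : (fun t : ℝ => asymmetricEnd (![0, 0, κ, d],
        ((asymmetricBase κ d).1 + t * 0, (asymmetricBase κ d).2 + t * 1)) i) =
        fun t => c₀ + c₁ * ((asymmetricBase κ d).2 + t) := by
      funext t
      simpa [asymmetricBase] using hi ((asymmetricBase κ d).2 + t)
    rw [this]
    simpa using (((hasDerivAt_id (0 : ℝ)).const_add (asymmetricBase κ d).2).const_mul c₁).const_add c₀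
  have h1v : L (0, (0, 1)) 1 = 0 := hv 1 (c₀ := 0) fun ρ => by
    rw [M.asymmetricEnd_eq]; simp [linearProfile, M.E'_end]
  have h3v : L (0, (0, 1)) 3 = o' d := hv 3 (c₀ := 1 / criticalField κ d 0 *
      (κ ^ 2 * (criticalField κ d 0 ^ 2 * d ^ 2 - 1) * E d) +
      1 / criticalField κ d 0 * κ ^ 2 * o' d) fun ρ => by
    rw [M.asymmetricEnd_eq]; simp [linearProfile]; ring
  have h1u : 0 < L (0, (1, 0)) 1 := by
    refine M.deriv_even_end_pos (asymmetricBase κ d).2 1 ?_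
    have h1 := hdir 1 1 0
    have h2 : HasDerivAt (fun b : ℝ => b - criticalField κ d 0) 1 (criticalField κ d 0) := by
      simpa using (hasDerivAt_id (criticalField κ d 0)).sub_const (criticalField κ d 0)
    have h3 := HasDerivAt.comp (criticalField κ d 0) (h₂ := fun t : ℝ => asymmetricEnd
      (![0, 0, κ, d], ((asymmetricBase κ d).1 + t * 1, (asymmetricBase κ d).2 + t * 0)) 1)
      (by simpa using h1) h2
    rw [mul_one] at h3
    refine h3.congr_of_eventuallyEq (Filter.Eventually.of_forall fun b => ?_)
    simp [asymmetricBase, asymmetricEnd, asymmetricData]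
  have hlin : ∀ u v : ℝ, L (0, (u, v)) = u • L (0, (1, 0)) + v • L (0, (0, 1)) := fun u v => by
    rw [← map_smul, ← map_smul, ← map_add]; simp
  obtain ⟨g, U, hUo, hU0, hgc, hg0, hgU, hloc⟩ := exists_implicit_function
    (F := fun x => (asymmetricEnd x 1, asymmetricEnd x 3)) ((hLi 1).prodMk (hLi 3)) (by
      rintro ⟨u, v⟩ hz
      obtain ⟨z1, z3⟩ := Prod.mk_inj.1 hz
      have z1 : L (0, (u, v)) 1 = 0 := z1
      have z3 : L (0, (u, v)) 3 = 0 := z3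
      rw [hlin] at z1 z3
      simp [h1v, h1u.ne'] at z1
      subst z1
      simp [h3v, (M.o'_pos M.mem_d).ne'] at z3
      rw [z3]; rfl)
  refine ⟨g, U, hUo, hU0, hgc, hg0, fun p hp => ?_, ?_⟩
  · obtain ⟨e1, e3⟩ := Prod.mk_inj.1 (hgU p hp)
    exact ⟨e1.trans b1, e3.trans b3⟩
  · filter_upwards [hloc] with x hx h1 h3
    exact hx (Prod.ext (h1.trans b1.symm) (h3.trans b3.symm))

end Base

section BaseContinuity

variable {κ d : ℝ}

/-- The normalized asymmetric data depend continuously on the parameters. -/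
lemma continuousAt_asymmetricBase (hκ : 0 < κ) (hd : 0 < d) :
    ContinuousAt (fun p : ℝ × ℝ => asymmetricBase p.1 p.2) (κ, d) := by
  obtain ⟨g, U, hUo, hU0, hgc, hg0, hgU, -⟩ := exists_asymmetric_branch hκ hd
  obtain ⟨E, E', o, o', M⟩ := exists_criticalModes hκ hd le_rfl
  have hp : Continuous fun p : ℝ × ℝ => (![0, 0, p.1, p.2] : Fin 4 → ℝ) := by
    refine continuous_pi fun i => ?_
    fin_cases i <;> simp <;> fun_prop
  have hgp : ContinuousAt (fun p : ℝ × ℝ => g ![0, 0, p.1, p.2]) (κ, d) :=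
    ContinuousAt.comp (g := g) (hgc.continuousAt (hUo.mem_nhds hU0)) hp.continuousAt
  refine hgp.congr ?_
  have hdata : ContinuousAt (fun p : ℝ × ℝ => ((![0, 0, p.1, p.2] : Fin 4 → ℝ),
      g ![0, 0, p.1, p.2])) (κ, d) := hp.continuousAt.prodMk hgp
  have hpos : ∀ᶠ x in 𝓝 ((![0, 0, κ, d] : Fin 4 → ℝ), asymmetricBase κ d),
      (∀ s, 0 < (flow timeField (asymmetricData x) s).1 0) ∧ 0 < x.2.1 := by
    refine Filter.Eventually.and ?_ ?_
    · refine eventually_forall_flow contDiff_asymmetricData.continuous.continuousAt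
        (flowsFrom_asymmetricBase hκ hd) (S := Set.Ioi (0 : ℝ)) isOpen_Ioi
        (Φ := fun y => y.2.2 0) (fun s => by fun_prop) (fun s => ?_)
      rw [flow_asymmetricBase M]
      exact M.E_pos _ (mul_mem_Icc hd s.2)
    · exact (continuous_fst.comp continuous_snd).continuousAt.eventually (lt_mem_nhds M.field_pos)
  have hpos' := hdata.eventually (by simpa only [hg0] using hpos)
  -- At `σ = ζ = 0` the branch yields a positive even Neumann mode, so by uniqueness of the normal
  -- mode its field is the critical one and the branch coincides with the base.
  filter_upwards [hpos', hp.continuousAt.eventually (hUo.mem_nhds hU0),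
    continuous_fst.continuousAt.eventually (lt_mem_nhds hκ),
    continuous_snd.continuousAt.eventually (lt_mem_nhds hd)] with p ⟨h1, h2⟩ h3 hκ' hd'
  obtain ⟨e1, e3⟩ := hgU _ h3
  set z := g ![0, 0, p.1, p.2]
  have h2 : 0 < z.1 := h2
  obtain ⟨F, F', f0, f1, hF⟩ := exists_isLinearMode p.1 z.1 p.2 1 0
  obtain ⟨w, w', w0, w1, hw⟩ := exists_isLinearMode p.1 z.1 p.2 0 1
  have hprof := profile_eq_linearProfile hκ'.ne' h2.ne' hd' z.2 1 hF hw f0 f1 w0 w1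
  have hFpos : ∀ x ∈ Set.Icc (-p.2) p.2, 0 < F x := fun x hx => by
    have h4 := h1 (clampTime (x / p.2))
    have h5 : profile (centreState z.1 z.2 1) ![0, 0, p.1, p.2] x 0 = F x := by
      rw [hprof x hx]; rfl
    rw [← h5]
    exact h4
  have hF' : F' p.2 = 0 := by
    rw [← e1]
    show _ = endState (centreState z.1 z.2 1) ![0, 0, p.1, p.2] 1
    rw [endState_eq (by simpa using hd'.ne')]
    show _ = profile (centreState z.1 z.2 1) ![0, 0, p.1, p.2] p.2 1
    rw [hprof _ ⟨by linarith, le_rfl⟩]; rfl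
  have hcrit := ((hF.isNormalMode hd' f1 hFpos hF').normalPair_eq hκ' hd' h2).1
  have hz : z = (criticalField p.1 p.2 0, z.2) := Prod.ext hcrit.symm rfl
  rw [hz] at e3 ⊢
  exact (asymmetricBase_unique hκ' hd').1 e3

end BaseContinuity

/-! ### From normalized data to asymmetric solutions. -/

section NearbySolutions

variable {κ d : ℝ} {E E' o o' : ℝ → ℝ}

lemma eventually_forall_flow_small (hκ : 0 < κ) (hd : 0 < d) {ε : ℝ} (hε : 0 < ε)
    {Φ : ((Fin 4 → ℝ) × (ℝ × ℝ)) × TimeInterval × (Fin 8 → ℝ) → ℝ}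
    (hΦ : ∀ s, ContinuousAt Φ ((![0, 0, κ, d], asymmetricBase κ d), s,
      (flow timeField (asymmetricData (![0, 0, κ, d], asymmetricBase κ d)) s).1))
    (h0 : ∀ s, Φ ((![0, 0, κ, d], asymmetricBase κ d), s,
      (flow timeField (asymmetricData (![0, 0, κ, d], asymmetricBase κ d)) s).1) = 0) :
    ∀ᶠ x in 𝓝 ((![0, 0, κ, d] : Fin 4 → ℝ), asymmetricBase κ d), ∀ s,
      |Φ (x, s, (flow timeField (asymmetricData x) s).1)| < ε := by
  have := eventually_forall_flow contDiff_asymmetricData.continuous.continuousAt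
    (flowsFrom_asymmetricBase hκ hd) (S := Set.Ioo (-ε) ε) isOpen_Ioo hΦ
    (fun s => by rw [h0]; exact ⟨by linarith, hε⟩)
  filter_upwards [this] with x hx s
  exact abs_lt.2 (hx s)

/-- Data close to the base with vanishing end conditions give asymmetric solutions close to the
normal state. -/
theorem eventually_exists_asymmetric (hκ : 0 < κ) (hd : 0 < d) {ε : ℝ} (hε : 0 < ε) :
    ∀ᶠ x in 𝓝 ((![0, 0, κ, d] : Fin 4 → ℝ), asymmetricBase κ d),
      0 < x.1 0 → 0 < x.1 1 → asymmetricEnd x 1 = 0 → asymmetricEnd x 3 = 0 →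
      asymmetricEnd x 7 = 0 → ∃ (h : ℝ) (φ a : ℝ → ℝ), |h - criticalField κ d 0| < ε ∧
        IsSolution (x.1 2) (x.1 3) h φ a ∧ ¬ IsSymmetric (x.1 3) φ a ∧
        NearNormalState (x.1 3) (criticalField κ d 0) ε φ a ∧
        NearlySymmetric (x.1 3) ε φ a := by
  obtain ⟨E, E', o, o', M⟩ := exists_criticalModes hκ hd le_rfl
  have hEd := M.E_pos d M.mem_d
  have hcE := continuousAt_asymmetricEnd hκ hd
  have hend : asymmetricEnd (![0, 0, κ, d], asymmetricBase κ d) =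
    linearProfile κ (criticalField κ d 0) (asymmetricBase κ d).2 1 E E' o o' d :=
    M.asymmetricEnd_eq _
  have hci (i : Fin 8) : ContinuousAt (fun x => asymmetricEnd x i)
      (![0, 0, κ, d], asymmetricBase κ d) := (continuous_apply i).continuousAt.comp hcE
  have hpos : ∀ᶠ x in 𝓝 ((![0, 0, κ, d] : Fin 4 → ℝ), asymmetricBase κ d),
      ∀ s, 0 < (flow timeField (asymmetricData x) s).1 0 +
        √(x.1 1) * (flow timeField (asymmetricData x) s).1 2 := by
    refine eventually_forall_flow contDiff_asymmetricData.continuous.continuousAt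
      (flowsFrom_asymmetricBase hκ hd) (S := Set.Ioi (0 : ℝ)) isOpen_Ioi
      (Φ := fun y => y.2.2 0 + √(y.1.1 1) * y.2.2 2) (fun s => by fun_prop) (fun s => ?_)
    simp [flow_asymmetricBase M, linearProfile]
    exact M.E_pos _ (mul_mem_Icc hd s.2)
  have n1 := eventually_forall_flow_small hκ hd hε
    (Φ := fun y => √(y.1.1 0) * (y.2.2 0 + √(y.1.1 1) * y.2.2 2)) (fun s => by fun_prop)
    (fun s => by simp)
  have n2 := eventually_forall_flow_small hκ hd hε
    (Φ := fun y => √(y.1.1 0) * (y.2.2 1 + √(y.1.1 1) * y.2.2 3)) (fun s => by fun_prop)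
    (fun s => by simp)
  have n3 := eventually_forall_flow_small hκ hd hε (Φ := fun y => y.2.2 4 + √(y.1.1 1) * y.2.2 6 -
    criticalField κ d 0 * (y.1.1 3 * y.2.1)) (fun s => by fun_prop)
    (fun s => by simp [flow_asymmetricBase M, linearProfile])
  have n4 := eventually_forall_flow_small hκ hd hε (Φ := fun y => y.2.2 5 + √(y.1.1 1) *
    (√(y.1.1 0) ^ 2 * y.2.2 7) - criticalField κ d 0) (fun s => by fun_prop)
    (fun s => by simp [flow_asymmetricBase M, linearProfile])
  -- Up to sign this is `(φ(-x) - φ(x)) / φ(-d)` in terms of the parts: the amplitude cancels, and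
  -- the denominator tends to `E(d) > 0`.
  have n5 := eventually_forall_flow_small hκ hd hε (Φ := fun y => 2 * √(y.1.1 1) * y.2.2 2 /
    (asymmetricEnd y.1 0 - √(y.1.1 1) * asymmetricEnd y.1 2)) (fun s => by
      have h0 : ContinuousAt (fun y : ((Fin 4 → ℝ) × (ℝ × ℝ)) × TimeInterval × (Fin 8 → ℝ) =>
        asymmetricEnd y.1 0) ((![0, 0, κ, d], asymmetricBase κ d), s,
        (flow timeField (asymmetricData (![0, 0, κ, d], asymmetricBase κ d)) s).1) :=
        ContinuousAt.comp (g := fun x => asymmetricEnd x 0) (f := Prod.fst) (hci 0) continuousAt_fst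
      have h2 : ContinuousAt (fun y : ((Fin 4 → ℝ) × (ℝ × ℝ)) × TimeInterval × (Fin 8 → ℝ) =>
        asymmetricEnd y.1 2) ((![0, 0, κ, d], asymmetricBase κ d), s,
        (flow timeField (asymmetricData (![0, 0, κ, d], asymmetricBase κ d)) s).1) :=
        ContinuousAt.comp (g := fun x => asymmetricEnd x 2) (f := Prod.fst) (hci 2) continuousAt_fst
      refine ContinuousAt.div (by fun_prop) (h0.sub (ContinuousAt.mul (by fun_prop) h2)) ?_
      simp [hend, linearProfile, hEd.ne'])
    (fun s => by simp)
  have n6 := eventually_forall_flow_small hκ hd hε (Φ := fun y => 2 * √(y.1.1 1) * y.2.2 6)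
    (fun s => by fun_prop) (fun s => by simp)
  have n7 : ∀ᶠ x in 𝓝 ((![0, 0, κ, d] : Fin 4 → ℝ), asymmetricBase κ d),
      asymmetricEnd x 5 ∈ Metric.ball (criticalField κ d 0) ε ∩ Set.Ioi 0 := by
    refine (hci 5).eventually ((Metric.isOpen_ball.inter isOpen_Ioi).mem_nhds ?_)
    simp [hend, linearProfile, hε, M.field_pos]
  have n8 : ∀ᶠ x in 𝓝 ((![0, 0, κ, d] : Fin 4 → ℝ), asymmetricBase κ d), 0 < x.1 3 := by
    have : ContinuousAt (fun x : (Fin 4 → ℝ) × (ℝ × ℝ) => x.1 3)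
      ((![0, 0, κ, d] : Fin 4 → ℝ), asymmetricBase κ d) := by fun_prop
    exact this.eventually (lt_mem_nhds (by simpa using hd))
  filter_upwards [hpos, n1, n2, n3, n4, n5, n6, n7, n8,
    contDiff_asymmetricData.continuous.continuousAt.eventually
      ((flowsFrom_asymmetricBase hκ hd).eventually contDiff_timeField)]
    with x hpos n1 n2 n3 n4 n5 n6 n7 hd' hfl hσ hζ e1 e3 e7
  set δ := x.1 3 with hδ
  set β := √(x.1 0) with hβ
  set η := √(x.1 1) with hη
  have hβ0 : 0 < β := Real.sqrt_pos.2 hσ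
  have hη0 : 0 < η := Real.sqrt_pos.2 hζ
  set P := profile (centreState x.2.1 x.2.2 1) x.1 with hPdef
  have hp : x.1 = ![β ^ 2, η ^ 2, x.1 2, δ] := by
    rw [Real.sq_sqrt hσ.le, Real.sq_sqrt hζ.le]
    ext i
    fin_cases i <;> rfl
  have hP : IsProfile ![β ^ 2, η ^ 2, x.1 2, δ] P := by
    rw [← hp]
    exact isProfile_profile (p := x.1) hd' hfl
  have h0 : P 0 = centreState x.2.1 x.2.2 1 := profile_zero hfl
  have hPd : asymmetricEnd x = P δ := endState_eq (p := x.1) hd'.ne'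
  have hPx : ∀ y, P y = (flow timeField (asymmetricData x) (clampTime (y / δ))).1 := fun y => rfl
  have hcl : ∀ y ∈ Set.Icc (-δ) δ, δ * (clampTime (y / δ) : ℝ) = y := fun y hy => by
    rw [clampTime_of_mem (div_mem_Icc hd' hy)]
    exact mul_div_cancel₀ y hd'.ne'
  have hneg : ∀ y ∈ Set.Icc (-δ) δ, P (-y) = reflectState (P y) := fun y hy =>
    hP.apply_neg (p := ![β ^ 2, η ^ 2, x.1 2, δ]) hd' h0 hy
  rw [hPd] at e1 e3 e7 n7
  have hdd : δ ∈ Set.Icc (-δ) δ := ⟨by linarith, le_rfl⟩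
  obtain ⟨hsol, hder⟩ := hP.isSolution hd' hβ0 h0 e1 e3 e7 n7.2 (fun y _ => hpos _)
  refine ⟨P δ 5, _, _, n7.1, hsol, fun hsym => ?_, fun y hy => ⟨n1 _, ?_, ?_, ?_⟩,
    fun y hy => ⟨?_, ?_⟩⟩
  -- An odd potential vanishes at the centre, whereas here its value is `η > 0`.
  · have := (hsym 0 ⟨by linarith, hd'.le⟩).2
    simp [h0, centreState] at this
    linarith
  · rw [(hder y hy).1]; exact n2 _
  · have := n3 (clampTime (y / δ))
    simp only [hcl y hy] at this
    exact this
  · rw [(hder y hy).2]; exact n4 _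
  · have := n5 (clampTime (y / δ))
    simp only [hPd, ← hPx] at this
    rw [abs_sub_comm] at *
    refine lt_of_eq_of_lt (congrArg _ ?_) this
    simp only [hneg y hy, hneg δ hdd, reflectState]
    simp
    rw [mul_div_mul_left _ _ hβ0.ne', mul_div_mul_left _ _ hβ0.ne']
    ring
  · have := n6 (clampTime (y / δ))
    simp only [← hPx] at this
    refine lt_of_eq_of_lt (congrArg _ ?_) this
    simp only [hneg y hy, reflectState]
    simp
    ring

end NearbySolutions

/-! ### The bifurcation integral and the last end value. -/

/-- The integral `I(c)` is expressed through the end value of the last component of a linear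
profile with normalized asymmetry. -/
lemma bifurcationIntegral_eq {κ d b ρ η : ℝ} (hκ : 0 < κ) (hd : 0 < d) (hb : 0 < b)
    {P : ℝ → Fin 8 → ℝ} (hP : IsProfile ![0, η ^ 2, κ, d] P) (h0 : P 0 = centreState b ρ 1)
    (h1 : P d 1 = 0) (h3 : P d 3 = 0) (hpos : ∀ x ∈ Set.Icc (-d) d, 0 < P x 0 + η * P x 2) :
    bifurcationIntegral κ d (η / b) = 2 * (η / b) * P d 7 / (P d 0 - η * P d 2) ^ 2 := by
  have hdd : d ∈ Set.Icc (-d) d := ⟨by linarith, le_rfl⟩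
  have hdn : -d ∈ Set.Icc (-d) d := neg_mem_slab hdd
  have h00 : (0 : ℝ) ∈ Set.Icc (-d) d := ⟨by linarith, hd.le⟩
  have hneg : ∀ x ∈ Set.Icc (-d) d, P (-x) = reflectState (P x) := fun x hx =>
    hP.apply_neg (p := ![0, η ^ 2, κ, d]) hd h0 hx
  have hder (i : Fin 8) {x : ℝ} (hx : x ∈ Set.Icc (-d) d) :
      HasDerivWithinAt (fun x => P x i) (partsField ![0, η ^ 2, κ, d] (P x) i)
        (Set.Icc (-d) d) x := hP.apply i hx
  have c5 : ∀ x ∈ Set.Icc (-d) d, P x 5 = b := fun x hx => by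
    have := eq_of_hasDerivWithinAt_zero (f := fun x => P x 5) (f' := fun _ => 0)
      (fun x hx => (hder 5 hx).congr_deriv (by simp [partsField])) (fun _ _ => rfl) hx h00
    simpa [h0, centreState] using this
  have c6 : ∀ x ∈ Set.Icc (-d) d, P x 6 = 1 := fun x hx => by
    have := eq_of_hasDerivWithinAt_zero (f := fun x => P x 6) (f' := fun _ => 0)
      (fun x hx => (hder 6 hx).congr_deriv (by simp [partsField])) (fun _ _ => rfl) hx h00
    simpa [h0, centreState] using this
  have c4 : ∀ x ∈ Set.Icc (-d) d, P x 4 = b * x := fun x hx => by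
    have := eq_of_hasDerivWithinAt_zero (f := fun x => P x 4 - b * x) (f' := fun _ => 0)
      (fun x hx => ((hder 4 hx).sub ((hasDerivWithinAt_id x _).const_mul b)).congr_deriv (by
        simp [partsField, c5 x hx])) (fun _ _ => rfl) hx h00
    have h2 : P x 4 - b * x = 0 := by simpa [h0, centreState] using this
    linarith
  set N := P d 0 - η * P d 2 with hN
  have hNpos : 0 < N := by
    have := hpos _ hdn
    rw [hneg d hdd] at this
    simpa [reflectState, hN, sub_eq_add_neg] using this
  obtain ⟨s1, s2⟩ := hasSecondDeriv_of_hasDerivWithinAt hd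
    (f := fun x => (P x 0 + η * P x 2) / N) (g := fun x => (P x 1 + η * P x 3) / N)
    (F := fun x => κ ^ 2 * (b ^ 2 * (x + η / b) ^ 2 - 1) * ((P x 0 + η * P x 2) / N))
    (fun x hx => (((hder 0 hx).add ((hder 2 hx).const_mul η)).div_const N).congr_deriv (by
      simp [partsField]))
    (fun x hx => (((hder 1 hx).add ((hder 3 hx).const_mul η)).div_const N).congr_deriv (by
      simp [partsField, c4 x hx, c6 x hx]; field_simp; ring))
  have hmode : IsNormalMode κ d (η / b) b fun x => (P x 0 + η * P x 2) / N := by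
    refine ⟨fun x hx => div_pos (hpos x hx) hNpos, s1, ?_, ?_, ?_⟩
    · show (P (-d) 0 + η * P (-d) 2) / N = 1
      rw [hneg d hdd, div_eq_one_iff_eq hNpos.ne']
      simp [reflectState, hN, sub_eq_add_neg]
    · rw [s2 _ hdn, hneg d hdd]; simp [reflectState, h1, h3]
    · rw [s2 _ hdd]; simp [h1, h3]
  obtain ⟨-, hpsi⟩ := hmode.normalPair_eq hκ hd hb
  set f : ℝ → ℝ := fun x => (x + η / b) * ((P x 0 + η * P x 2) / N) ^ 2 with hf
  have hI : bifurcationIntegral κ d (η / b) = ∫ x in (-d)..d, f x := by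
    refine intervalIntegral.integral_congr fun x hx => ?_
    rw [Set.uIcc_of_le (by linarith)] at hx
    simp only [hpsi hx, hf]
  have hfc : ContinuousOn f (Set.Icc (-d) d) := fun x hx =>
    ((continuousWithinAt_id.add continuousWithinAt_const).mul
      ((((hder 0 hx).continuousWithinAt.add
        (continuousWithinAt_const.mul (hder 2 hx).continuousWithinAt)).div_const N).pow 2))
  have hfi : IntervalIntegrable f volume (-d) d := by
    refine ContinuousOn.intervalIntegrable ?_
    rwa [Set.uIcc_of_le (by linarith)]
  have hfi' : IntervalIntegrable (fun x => f (-x)) volume (-d) d := by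
    refine ContinuousOn.intervalIntegrable ?_
    rw [Set.uIcc_of_le (by linarith)]
    exact hfc.comp continuousOn_neg fun x hx => neg_mem_slab hx
  -- Folding the integral about the centre leaves twice the even part of the integrand, which is a
  -- constant multiple of the derivative of the last component.
  have hsum : ∀ x ∈ Set.Icc (-d) d, f x + f (-x) =
      2 * (η / b) / N ^ 2 * (partsField ![0, η ^ 2, κ, d] (P x) 7) := fun x hx => by
    simp only [hf, hneg x hx]
    simp [partsField, reflectState, c4 x hx, c6 x hx]
    field_simp
    ring
  have hd7 : ∀ x ∈ Set.Icc (-d) d, HasDerivWithinAt (fun x => 2 * (η / b) / N ^ 2 * P x 7)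
      (f x + f (-x)) (Set.Icc (-d) d) x := fun x hx =>
    ((hder 7 hx).const_mul _).congr_deriv (hsum x hx).symm
  have hFTC := intervalIntegral.integral_eq_sub_of_hasDerivAt_of_le (a := -d) (b := d)
    (by linarith) (fun x hx => (hd7 x hx).continuousWithinAt)
    (fun x hx => (hd7 x (Set.Ioo_subset_Icc_self hx)).hasDerivAt (Icc_mem_nhds hx.1 hx.2))
    (hfi.add hfi')
  rw [intervalIntegral.integral_add hfi hfi', intervalIntegral.integral_comp_neg, neg_neg,
    hneg d hdd] at hFTC
  rw [hI]
  have : 2 * ∫ x in (-d)..d, f x = 2 * (2 * (η / b) / N ^ 2 * P d 7) := by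
    rw [two_mul, hFTC]
    simp [reflectState]
    ring
  have h2 := mul_left_cancel₀ two_ne_zero this
  rw [h2]
  ring

/-- The derivative of `I` at `0`, where it is not zero. -/
theorem deriv_bifurcationIntegral {κ d : ℝ} (hκ : 0 < κ) (hd : 0 < d)
    (hne : deriv (bifurcationIntegral κ d) 0 ≠ 0) :
    ∃ C : ℝ, 0 < C ∧ deriv (bifurcationIntegral κ d) 0 =
      C * asymmetricEnd (![0, 0, κ, d], asymmetricBase κ d) 7 := by
  obtain ⟨g, U, hUo, hU0, hgc, hg0, hgU, -⟩ := exists_asymmetric_branch hκ hd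
  obtain ⟨E, E', o, o', M⟩ := exists_criticalModes hκ hd le_rfl
  have hEd := M.E_pos d M.mem_d
  have hp : Continuous fun η : ℝ => (![0, η ^ 2, κ, d] : Fin 4 → ℝ) := by
    refine continuous_pi fun i => ?_
    fin_cases i <;> simp <;> fun_prop
  have hp0 : (![0, (0 : ℝ) ^ 2, κ, d] : Fin 4 → ℝ) = ![0, 0, κ, d] := by simp
  have hgp : ContinuousAt (fun η : ℝ => g ![0, η ^ 2, κ, d]) 0 :=
    ContinuousAt.comp (g := g) (by rw [hp0]; exact hgc.continuousAt (hUo.mem_nhds hU0))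
      hp.continuousAt
  let w : ℝ → (Fin 4 → ℝ) × (ℝ × ℝ) := fun η => (![0, η ^ 2, κ, d], g ![0, η ^ 2, κ, d])
  have hw : ContinuousAt w 0 := hp.continuousAt.prodMk hgp
  have hw0 : w 0 = (![0, 0, κ, d], asymmetricBase κ d) := by simp only [w, hp0, hg0]
  have hdata : ContinuousAt (fun η => asymmetricData (w η)) 0 :=
    contDiff_asymmetricData.continuous.continuousAt.comp hw
  have hflow : FlowsFrom timeField (asymmetricData (w 0)) := by
    rw [hw0]; exact flowsFrom_asymmetricBase hκ hd
  have hpos : ∀ᶠ η in 𝓝 (0 : ℝ), ∀ s, 0 < (flow timeField (asymmetricData (w η)) s).1 0 +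
      η * (flow timeField (asymmetricData (w η)) s).1 2 := by
    refine eventually_forall_flow hdata hflow (S := Set.Ioi (0 : ℝ)) isOpen_Ioi
      (Φ := fun y => y.2.2 0 + y.1 * y.2.2 2) (fun s => by fun_prop) (fun s => ?_)
    show (0 : ℝ) < _
    rw [hw0, flow_asymmetricBase M]
    simp [linearProfile]
    exact M.E_pos _ (mul_mem_Icc hd s.2)
  have hb : ∀ᶠ η in 𝓝 (0 : ℝ), 0 < (w η).2.1 := by
    have : ContinuousAt (fun η => (w η).2.1) 0 :=
      (continuous_fst.comp continuous_snd).continuousAt.comp hw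
    refine this.eventually (lt_mem_nhds ?_)
    show 0 < (w 0).2.1
    rw [hw0]
    exact M.field_pos
  have hform : ∀ᶠ η in 𝓝 (0 : ℝ), bifurcationIntegral κ d (η / (w η).2.1) =
      (η / (w η).2.1) * (2 * asymmetricEnd (w η) 7 /
        (asymmetricEnd (w η) 0 - η * asymmetricEnd (w η) 2) ^ 2) := by
    filter_upwards [hpos, hb, hdata.eventually (hflow.eventually contDiff_timeField),
      hp.continuousAt.eventually_mem (hUo.mem_nhds (by simpa using hU0))] with η h1 h2 h3 h4
    obtain ⟨e1, e3⟩ := hgU _ h4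
    have hend : asymmetricEnd (w η) = profile (centreState (w η).2.1 (w η).2.2 1)
      ![0, η ^ 2, κ, d] d := endState_eq (p := ![0, η ^ 2, κ, d]) hd.ne'
    have e1 : asymmetricEnd (w η) 1 = 0 := e1
    have e3 : asymmetricEnd (w η) 3 = 0 := e3
    rw [hend] at e1 e3
    rw [bifurcationIntegral_eq (ρ := (w η).2.2) hκ hd h2
      (isProfile_profile (p := ![0, η ^ 2, κ, d]) hd h3) (profile_zero h3) e1 e3
      (fun x _ => h1 _), ← hend]
    ring
  have hI0 : bifurcationIntegral κ d 0 = 0 := by simpa using hform.self_of_nhds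
  have hD := (differentiableAt_of_deriv_ne_zero hne).hasDerivAt
  rw [hasDerivAt_iff_tendsto_slope] at hD
  have hb0 : (w 0).2.1 = criticalField κ d 0 := by rw [hw0]; rfl
  have hbc : ContinuousAt (fun η => (w η).2.1) 0 :=
    (continuous_fst.comp continuous_snd).continuousAt.comp hw
  -- The formula for `I` holds only at the points `c = η / b(η)`. They tend to `0` through positive
  -- values, which suffices to identify a derivative already known to exist because it is nonzero.
  have hc : Tendsto (fun η => η / (w η).2.1) (𝓝[>] 0) (𝓝[≠] 0) := by
    refine tendsto_nhdsWithin_iff.2 ⟨?_, ?_⟩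
    · have : ContinuousAt (fun η => η / (w η).2.1) 0 :=
        continuousAt_id.div hbc (by rw [hb0]; exact M.field_pos.ne')
      have := this.tendsto
      rw [zero_div] at this
      exact this.mono_left nhdsWithin_le_nhds
    · filter_upwards [self_mem_nhdsWithin, nhdsWithin_le_nhds hb] with η h1 h2
      exact (div_pos h1 h2).ne'
  have hlim := hD.comp hc
  have hce : ContinuousAt (fun η => asymmetricEnd (w η)) 0 :=
    ContinuousAt.comp (g := asymmetricEnd) (by rw [hw0]; exact continuousAt_asymmetricEnd hκ hd) hw
  have hci (i : Fin 8) : ContinuousAt (fun η => asymmetricEnd (w η) i) 0 :=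
    (continuous_apply i).continuousAt.comp hce
  have hend0 : asymmetricEnd (w 0) 0 = E d := by
    rw [hw0]
    exact congrFun (M.asymmetricEnd_eq _) 0
  have hcont : ContinuousAt (fun η => 2 * asymmetricEnd (w η) 7 /
        (asymmetricEnd (w η) 0 - η * asymmetricEnd (w η) 2) ^ 2) 0 :=
    ((hci 7).const_mul 2).div (((hci 0).sub (continuousAt_id.mul (hci 2))).pow 2) (by
      simp [hend0, hEd.ne'])
  have hlim2 := (hcont.tendsto.mono_left (nhdsWithin_le_nhds (s := Set.Ioi 0)))
  have huniq := tendsto_nhds_unique hlim (hlim2.congr' (by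
    filter_upwards [self_mem_nhdsWithin, nhdsWithin_le_nhds hb, nhdsWithin_le_nhds hform]
      with η h1 h2 h3
    have hcne : η / (w η).2.1 ≠ 0 := (div_pos h1 h2).ne'
    simp only [Function.comp, slope_def_field, hI0, h3, sub_zero]
    rw [mul_div_cancel_left₀ _ hcne]))
  refine ⟨2 / E d ^ 2, by positivity, ?_⟩
  rw [huniq, hend0, hw0]
  simp
  ring

/-! ### Sign changes along a curve of parameters. -/

/-- The parameters `(σ, ζ, t)` and the data `(b, ρ)` on a curve `t ↦ (κ t, d t)`. -/
def curveData (κ d : ℝ → ℝ) (y : (ℝ × ℝ × ℝ) × (ℝ × ℝ)) : (Fin 4 → ℝ) × (ℝ × ℝ) :=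
  (![y.1.1, y.1.2.1, κ y.1.2.2, d y.1.2.2], y.2)

/-- The normal state on a curve. -/
noncomputable def curveBase (κ d : ℝ → ℝ) (t : ℝ) : (ℝ × ℝ × ℝ) × (ℝ × ℝ) :=
  ((0, 0, t), asymmetricBase (κ t) (d t))

/-- The end conditions for the two parts of the order parameter. -/
def EndsVanish (κ d : ℝ → ℝ) (y : (ℝ × ℝ × ℝ) × (ℝ × ℝ)) : Prop :=
  0 < y.1.1 ∧ 0 < y.1.2.1 ∧ asymmetricEnd (curveData κ d y) 1 = 0 ∧
    asymmetricEnd (curveData κ d y) 3 = 0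

section Curve

variable {κ d : ℝ → ℝ}

lemma continuous_curveData (hκ : Continuous κ) (hd : Continuous d) :
    Continuous (curveData κ d) := by
  refine Continuous.prodMk (continuous_pi fun i => ?_) continuous_snd
  fin_cases i <;> simp <;> fun_prop

lemma continuous_curveBase (hκ : Continuous κ) (hd : Continuous d) (hκ0 : ∀ t, 0 < κ t)
    (hd0 : ∀ t, 0 < d t) : Continuous (curveBase κ d) := by
  refine Continuous.prodMk (by fun_prop) (continuous_iff_continuousAt.2 fun t => ?_)
  exact ContinuousAt.comp (f := fun t => (κ t, d t)) (g := fun p : ℝ × ℝ => asymmetricBase p.1 p.2)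
    (continuousAt_asymmetricBase (hκ0 t) (hd0 t)) (hκ.prodMk hd).continuousAt

lemma continuousAt_end_curve (hκ : Continuous κ) (hd : Continuous d) (hκ0 : ∀ t, 0 < κ t)
    (hd0 : ∀ t, 0 < d t) (t : ℝ) (i : Fin 8) :
    ContinuousAt (fun y => asymmetricEnd (curveData κ d y) i) (curveBase κ d t) :=
  (continuous_apply i).continuousAt.comp (ContinuousAt.comp (g := asymmetricEnd)
    (continuousAt_asymmetricEnd (hκ0 t) (hd0 t)) (continuous_curveData hκ hd).continuousAt)

/-- The branch of normalized asymmetric data near a point of the curve. -/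
lemma exists_curve_branch (hκ : Continuous κ) (hd : Continuous d) (hκ0 : ∀ t, 0 < κ t)
    (hd0 : ∀ t, 0 < d t) (t : ℝ) :
    ∃ (G : ℝ × ℝ × ℝ → ℝ × ℝ), ContinuousAt G (0, 0, t) ∧ G (0, 0, t) = (curveBase κ d t).2 ∧
      (∀ᶠ v in 𝓝 ((0 : ℝ), (0 : ℝ), t), ContinuousAt G v ∧
        asymmetricEnd (curveData κ d (v, G v)) 1 = 0 ∧
        asymmetricEnd (curveData κ d (v, G v)) 3 = 0) ∧
      ∀ᶠ y in 𝓝 (curveBase κ d t), EndsVanish κ d y → y.2 = G y.1 := by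
  obtain ⟨g, U, hUo, hU0, hgc, hg0, hgU, hloc⟩ := exists_asymmetric_branch (hκ0 t) (hd0 t)
  have hp : Continuous fun v : ℝ × ℝ × ℝ => (![v.1, v.2.1, κ v.2.2, d v.2.2] : Fin 4 → ℝ) := by
    refine continuous_pi fun i => ?_
    fin_cases i <;> simp <;> fun_prop
  have hev : ∀ᶠ v in 𝓝 ((0 : ℝ), (0 : ℝ), t), ![v.1, v.2.1, κ v.2.2, d v.2.2] ∈ U :=
    hp.continuousAt.eventually_mem (hUo.mem_nhds hU0)
  have hcont : ∀ v : ℝ × ℝ × ℝ, ![v.1, v.2.1, κ v.2.2, d v.2.2] ∈ U →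
      ContinuousAt (fun v : ℝ × ℝ × ℝ => g ![v.1, v.2.1, κ v.2.2, d v.2.2]) v := fun v hv =>
    ContinuousAt.comp (g := g) (hgc.continuousAt (hUo.mem_nhds hv)) hp.continuousAt
  refine ⟨fun v => g ![v.1, v.2.1, κ v.2.2, d v.2.2], hcont _ hU0, hg0, ?_, ?_⟩
  · filter_upwards [hev] with v hv
    exact ⟨hcont v hv, hgU _ hv⟩
  · have := (continuous_curveData hκ hd).continuousAt (x := curveBase κ d t) |>.eventually hloc
    filter_upwards [this] with y hy h
    exact hy h.2.2.1 h.2.2.2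

lemma tendsto_graph {G : ℝ × ℝ × ℝ → ℝ × ℝ} {t : ℝ} (hG : ContinuousAt G (0, 0, t))
    (hG0 : G (0, 0, t) = (curveBase κ d t).2) :
    Tendsto (fun v => (v, G v)) (𝓝 (0, 0, t)) (𝓝 (curveBase κ d t)) := by
  have h : ContinuousAt (fun v => (v, G v)) (0, 0, t) := continuousAt_id.prodMk hG
  have h' := h.tendsto
  rwa [hG0] at h'

/-- If the end value of the last component has opposite signs at the two ends of a curve, it
vanishes at solutions of the other end conditions near the normal state. -/
theorem exists_frequently_end_eq_zero (hκ : Continuous κ) (hd : Continuous d)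
    (hκ0 : ∀ t, 0 < κ t) (hd0 : ∀ t, 0 < d t)
    (hleft : asymmetricEnd (![0, 0, κ 0, d 0], asymmetricBase (κ 0) (d 0)) 7 < 0)
    (hright : 0 < asymmetricEnd (![0, 0, κ 1, d 1], asymmetricBase (κ 1) (d 1)) 7) :
    ∃ t ∈ Set.Ioo (0 : ℝ) 1, ∃ᶠ y in 𝓝 (curveBase κ d t),
      EndsVanish κ d y ∧ asymmetricEnd (curveData κ d y) 7 = 0 := by
  by_contra! hcon
  let m : (ℝ × ℝ × ℝ) × (ℝ × ℝ) → ℝ := fun y => asymmetricEnd (curveData κ d y) 7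
  -- Times at which the last end value takes values in `A` at all nearby data meeting the other end
  -- conditions. If no zeros accumulate, the sets for the two signs form an open cover of the
  -- interval.
  let S : Set ℝ → Set ℝ := fun A => {t | ∀ᶠ y in 𝓝 (curveBase κ d t), EndsVanish κ d y → m y ∈ A}
  have hbase := continuous_curveBase hκ hd hκ0 hd0
  have hopen : ∀ A, IsOpen (S A) := fun A => isOpen_iff_mem_nhds.2 fun t ht =>
    hbase.continuousAt.eventually (eventually_eventually_nhds.2 ht)
  have hmc : ∀ t, ContinuousAt m (curveBase κ d t) := fun t =>
    continuousAt_end_curve hκ hd hκ0 hd0 t 7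
  have h0 : (0 : ℝ) ∈ S (Set.Iio 0) :=
    ((hmc 0).eventually_mem (isOpen_Iio.mem_nhds hleft)).mono fun y hy _ => hy
  have h1 : (1 : ℝ) ∈ S (Set.Ioi 0) :=
    ((hmc 1).eventually_mem (isOpen_Ioi.mem_nhds hright)).mono fun y hy _ => hy
  have hcover : Set.Icc (0 : ℝ) 1 ⊆ S (Set.Iio 0) ∪ S (Set.Ioi 0) := by
    intro t ht
    rcases ht.1.eq_or_lt with rfl | ht0
    · exact Or.inl h0
    rcases ht.2.eq_or_lt with rfl | ht1
    · exact Or.inr h1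
    have hne := hcon t ⟨ht0, ht1⟩
    obtain ⟨G, hG, hG0, hGv, hGu⟩ := exists_curve_branch hκ hd hκ0 hd0 t
    have hgraph := tendsto_graph hG hG0
    have hev : ∀ᶠ v in 𝓝 ((0 : ℝ), (0 : ℝ), t), ContinuousAt G v ∧
        asymmetricEnd (curveData κ d (v, G v)) 1 = 0 ∧
        asymmetricEnd (curveData κ d (v, G v)) 3 = 0 ∧
        ContinuousAt m (v, G v) ∧
        (EndsVanish κ d (v, G v) → asymmetricEnd (curveData κ d (v, G v)) 7 ≠ 0) := by
      have e2 := hgraph.eventually hne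
      have e3 : ∀ᶠ y in 𝓝 (curveBase κ d t), ContinuousAt m y := by
        have hc := contDiff_asymmetricData.continuous.comp (continuous_curveData hκ hd)
        filter_upwards [hc.continuousAt.eventually ((flowsFrom_asymmetricBase (hκ0 t)
          (hd0 t)).eventually contDiff_timeField)] with y hy
        obtain ⟨L, hL⟩ := hasStrictFDerivAt_endState_comp contDiff_asymmetricData hy
        exact (continuous_apply 7).continuousAt.comp (ContinuousAt.comp (g := asymmetricEnd)
          hL.continuousAt (continuous_curveData hκ hd).continuousAt)
      filter_upwards [hGv, e2, hgraph.eventually e3] with v h1 h2 h3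
      exact ⟨h1.1, h1.2.1, h1.2.2, h3, h2⟩
    obtain ⟨r, hr, hrs⟩ := Metric.eventually_nhds_iff_ball.1 hev
    -- The part of a ball with `σ, ζ > 0` is convex, and the branch is a graph over it; a
    -- nonvanishing continuous function there has constant sign.
    set V : Set (ℝ × ℝ × ℝ) := Metric.ball (0, 0, t) r ∩ {v | 0 < v.1 ∧ 0 < v.2.1} with hV
    have hVc : IsPreconnected V := by
      refine Convex.isPreconnected ((convex_ball _ _).inter ?_)
      intro v hv w hw a b ha hb hab
      have hlin : ∀ x y : ℝ, 0 < x → 0 < y → 0 < a * x + b * y := fun x y hx hy => by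
        rcases ha.eq_or_lt with rfl | ha
        · have : b = 1 := by linarith
          subst this; linarith
        · have := mul_pos ha hx
          have := mul_nonneg hb hy.le
          linarith
      exact ⟨hlin _ _ hv.1 hw.1, hlin _ _ hv.2 hw.2⟩
    have hmV : ContinuousOn (fun v => m (v, G v)) V := fun v hv => by
      obtain ⟨h1, -, -, h4, -⟩ := hrs v hv.1
      exact (ContinuousAt.comp (g := m) (f := fun v => (v, G v)) h4
        (continuousAt_id.prodMk h1)).continuousWithinAt
    have hmne : ∀ v ∈ V, m (v, G v) ≠ 0 := fun v hv h7 => by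
      obtain ⟨-, h1, h3, -, h5⟩ := hrs v hv.1
      exact h5 ⟨hv.2.1, hv.2.2, h1, h3⟩ h7
    have hsign : (∀ v ∈ V, m (v, G v) < 0) ∨ ∀ v ∈ V, 0 < m (v, G v) := by
      by_contra! hc
      obtain ⟨⟨v, hv, h1⟩, w, hw, h2⟩ := hc
      obtain ⟨z, hz, hz0⟩ := hVc.intermediate_value hw hv hmV ⟨h2, h1⟩
      exact hmne z hz hz0
    have hball : ∀ᶠ y in 𝓝 (curveBase κ d t), y.1 ∈ Metric.ball ((0 : ℝ), (0 : ℝ), t) r :=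
      continuous_fst.continuousAt.eventually_mem (Metric.ball_mem_nhds _ hr)
    rcases hsign with hs | hs
    · left
      filter_upwards [hball, hGu] with y hy h2 h3
      have := hs y.1 ⟨hy, h3.1, h3.2.1⟩
      rwa [← h2 h3] at this
    · right
      filter_upwards [hball, hGu] with y hy h2 h3
      have := hs y.1 ⟨hy, h3.1, h3.2.1⟩
      rwa [← h2 h3] at this
  obtain ⟨t, -, hn, hp⟩ := isPreconnected_Icc _ _ (hopen _) (hopen _) hcover
    ⟨0, ⟨le_rfl, zero_le_one⟩, h0⟩ ⟨1, ⟨zero_le_one, le_rfl⟩, h1⟩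
  obtain ⟨G, hG, hG0, hGv, -⟩ := exists_curve_branch hκ hd hκ0 hd0 t
  -- At a time belonging to both sets, a point of the branch with `σ = ζ = s > 0` small would carry
  -- both signs.
  have hline : ContinuousAt (fun s : ℝ => (s, s, t)) 0 := by fun_prop
  have hgraph := tendsto_graph hG hG0
  have e1 := hline.eventually (hgraph.eventually (hn.and hp))
  have e2 := hline.eventually hGv
  obtain ⟨s, ⟨⟨h1, h2⟩, h3⟩, h4⟩ := (((e1.and e2).filter_mono nhdsWithin_le_nhds).and
    (self_mem_nhdsWithin (s := Set.Ioi (0 : ℝ)))).exists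
  have hv : EndsVanish κ d ((s, s, t), G (s, s, t)) := ⟨h4, h4, h3.2.1, h3.2.2⟩
  have hneg : m ((s, s, t), G (s, s, t)) < 0 := h1 hv
  have hpos : 0 < m ((s, s, t), G (s, s, t)) := h2 hv
  exact lt_asymm hneg hpos

end Curve

/-- The curve is extended to all times by constants beyond the end points, so that neighbourhoods of
any time make sense; the solutions found have times in the open interval, where nothing has changed.
-/
theorem exists_asymmetric_of_sign_change {κ d : ℝ → ℝ} (hκ : ContinuousOn κ (Set.Icc 0 1))
    (hd : ContinuousOn d (Set.Icc 0 1)) (hpos : ∀ t ∈ Set.Icc (0 : ℝ) 1, 0 < κ t ∧ 0 < d t)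
    (hleft : deriv (bifurcationIntegral (κ 0) (d 0)) 0 < 0)
    (hright : 0 < deriv (bifurcationIntegral (κ 1) (d 1)) 0) :
    ∃ t₀ ∈ Set.Ioo (0 : ℝ) 1, ∀ ε : ℝ, 0 < ε →
      ∃ t ∈ Set.Ioo (0 : ℝ) 1, |t - t₀| < ε ∧ |κ t - κ t₀| < ε ∧ |d t - d t₀| < ε ∧
        ∃ (h : ℝ) (φ a : ℝ → ℝ), |h - criticalField (κ t₀) (d t₀) 0| < ε ∧
          IsSolution (κ t) (d t) h φ a ∧ ¬ IsSymmetric (d t) φ a ∧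
          NearNormalState (d t) (criticalField (κ t₀) (d t₀) 0) ε φ a ∧
          NearlySymmetric (d t) ε φ a := by
  let κ' : ℝ → ℝ := fun t => κ (Set.projIcc 0 1 zero_le_one t)
  let d' : ℝ → ℝ := fun t => d (Set.projIcc 0 1 zero_le_one t)
  have hκ' : Continuous κ' := (continuousOn_iff_continuous_domRestrict.1 hκ).comp continuous_projIcc
  have hd' : Continuous d' := (continuousOn_iff_continuous_domRestrict.1 hd).comp continuous_projIcc
  have hκ0 : ∀ t, 0 < κ' t := fun t => (hpos _ (Set.projIcc 0 1 zero_le_one t).2).1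
  have hd0 : ∀ t, 0 < d' t := fun t => (hpos _ (Set.projIcc 0 1 zero_le_one t).2).2
  have eκ : ∀ t ∈ Set.Icc (0 : ℝ) 1, κ' t = κ t := fun t ht => by
    simp only [κ', Set.projIcc_of_mem _ ht]
  have ed : ∀ t ∈ Set.Icc (0 : ℝ) 1, d' t = d t := fun t ht => by
    simp only [d', Set.projIcc_of_mem _ ht]
  have m0 : (0 : ℝ) ∈ Set.Icc (0 : ℝ) 1 := ⟨le_rfl, zero_le_one⟩
  have m1 : (1 : ℝ) ∈ Set.Icc (0 : ℝ) 1 := ⟨zero_le_one, le_rfl⟩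
  obtain ⟨t₀, ht₀, hfreq⟩ := exists_frequently_end_eq_zero hκ' hd' hκ0 hd0
    (by
      rw [eκ 0 m0, ed 0 m0]
      obtain ⟨C, hC, h⟩ := deriv_bifurcationIntegral (hpos 0 m0).1 (hpos 0 m0).2 hleft.ne
      rw [h] at hleft
      exact neg_of_mul_neg_right hleft hC.le)
    (by
      rw [eκ 1 m1, ed 1 m1]
      obtain ⟨C, hC, h⟩ := deriv_bifurcationIntegral (hpos 1 m1).1 (hpos 1 m1).2 hright.ne'
      rw [h] at hright
      exact pos_of_mul_pos_right hright hC.le)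
  refine ⟨t₀, ht₀, fun ε hε => ?_⟩
  have ht₀' := Set.Ioo_subset_Icc_self ht₀
  have hsol := (continuous_curveData hκ' hd').continuousAt (x := curveBase κ' d' t₀) |>.eventually
    (eventually_exists_asymmetric (hκ0 t₀) (hd0 t₀) hε)
  have htc : Continuous fun y : (ℝ × ℝ × ℝ) × (ℝ × ℝ) => y.1.2.2 := by fun_prop
  have hball {f : ℝ → ℝ} (hf : Continuous f) : ∀ᶠ y in 𝓝 (curveBase κ' d' t₀),
      |f y.1.2.2 - f t₀| < ε :=
    (hf.comp htc).continuousAt.eventually_mem (Metric.ball_mem_nhds _ hε)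
  have htI : ∀ᶠ y in 𝓝 (curveBase κ' d' t₀), y.1.2.2 ∈ Set.Ioo (0 : ℝ) 1 :=
    htc.continuousAt.eventually_mem (isOpen_Ioo.mem_nhds ht₀)
  obtain ⟨y, ⟨hv, h7⟩, h1, h2, h3, h4, h5⟩ := (hfreq.and_eventually (hsol.and ((hball continuous_id).and
    ((hball hκ').and ((hball hd').and htI))))).exists
  have hy := Set.Ioo_subset_Icc_self h5
  have h6 := h1 hv.1 hv.2.1 hv.2.2.1 hv.2.2.2 h7
  simp only [eκ _ hy, ed _ hy, eκ _ ht₀', ed _ ht₀'] at h3 h4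
  have e2 : (curveData κ' d' y).1 2 = κ y.1.2.2 := eκ _ hy
  have e3 : (curveData κ' d' y).1 3 = d y.1.2.2 := ed _ hy
  rw [e2, e3, eκ _ ht₀', ed _ ht₀'] at h6
  exact ⟨y.1.2.2, h5, h2, h3, h4, h6⟩

/-! ### A priori bounds for the scaled problem. -/

/-- A maximum principle for the Neumann problem. -/
lemma le_one_of_neumann {d : ℝ} (hd : 0 < d) {f f' F : ℝ → ℝ}
    (hf : ∀ x ∈ Set.Icc (-d) d, HasDerivWithinAt f (f' x) (Set.Icc (-d) d) x)
    (hf' : ∀ x ∈ Set.Icc (-d) d, HasDerivWithinAt f' (F x) (Set.Icc (-d) d) x)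
    (hl : f' (-d) = 0) (hr : f' d = 0) (hF : ∀ x ∈ Set.Icc (-d) d, 1 < f x → 0 < F x)
    {x : ℝ} (hx : x ∈ Set.Icc (-d) d) : f x ≤ 1 := by
  have hdd : d ∈ Set.Icc (-d) d := ⟨by linarith, le_rfl⟩
  have hdn : -d ∈ Set.Icc (-d) d := neg_mem_slab hdd
  have hg : ∀ y, HasDerivAt expNegInvGlue (deriv expNegInvGlue y) y := fun y =>
    ((expNegInvGlue.contDiff (n := 1)).differentiable one_ne_zero y).hasDerivAt
  -- The smooth cutoff `expNegInvGlue` is positive exactly where `f > 1`. The product `f' ·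
  -- expNegInvGlue (f - 1)` is nondecreasing and vanishes at both ends, so it is zero; its
  -- derivative would be positive at a point with `f > 1`.
  have hG : ∀ x ∈ Set.Icc (-d) d, HasDerivWithinAt (fun x => f' x * expNegInvGlue (f x - 1))
      (F x * expNegInvGlue (f x - 1) + f' x * (deriv expNegInvGlue (f x - 1) * f' x))
      (Set.Icc (-d) d) x := fun x hx =>
    (hf' x hx).mul (HasDerivAt.comp_hasDerivWithinAt (h₂ := expNegInvGlue) (h := fun x => f x - 1) x
      (hg (f x - 1)) ((hf x hx).sub_const 1))
  have h1 : ∀ x ∈ Set.Icc (-d) d, 0 ≤ F x * expNegInvGlue (f x - 1) := fun x hx => by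
    rcases le_or_gt (f x) 1 with h | h
    · rw [expNegInvGlue.zero_of_nonpos (by linarith), mul_zero]
    · exact mul_nonneg (hF x hx h).le (expNegInvGlue.nonneg _)
  have h2 : ∀ x, 0 ≤ f' x * (deriv expNegInvGlue (f x - 1) * f' x) := fun x => by
    have := expNegInvGlue.monotone.deriv_nonneg (x := f x - 1)
    have := mul_nonneg this (mul_self_nonneg (f' x))
    linarith
  have hmono := monotoneOn_Icc_of_hasDerivWithinAt hG fun x hx =>
    add_nonneg (h1 x (Set.Ioo_subset_Icc_self hx)) (h2 x)
  have hconst : ∀ x ∈ Set.Icc (-d) d, f' x * expNegInvGlue (f x - 1) = 0 := fun x hx => by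
    have e1 := hmono hdn hx hx.1
    have e2 := hmono hx hdd hx.2
    simp only [hl, hr, zero_mul] at e1 e2
    exact le_antisymm e2 e1
  by_contra! hcon
  have h3 := (hasDerivWithinAt_const x (Set.Icc (-d) d) (0 : ℝ)).congr hconst (hconst x hx)
  have h4 := (uniqueDiffOn_Icc (by linarith) x hx).eq_deriv _ (hG x hx) h3
  have h5 := mul_pos (hF x hx hcon) (expNegInvGlue.pos_of_pos (sub_pos.2 hcon))
  linarith [h2 x]

namespace IsScaledSolution

variable {κ d α h : ℝ} {ψ a : ℝ → ℝ}

/-- The maximum principle for `αψ`: where `αψ > 1` the right-hand side is positive. -/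
lemma amplitude_le (hs : IsScaledSolution κ d α h ψ a) (hκ : 0 < κ) (hd : 0 < d) (hα : 0 < α)
    {x : ℝ} (hx : x ∈ Set.Icc (-d) d) : α ^ 2 * ψ x ^ 2 ≤ 1 := by
  have := le_one_of_neumann (f := fun x => α * ψ x) (f' := fun x => α * slabDeriv d ψ x)
    (F := fun x => α * (κ ^ 2 * (α ^ 2 * ψ x ^ 2 + a x ^ 2 - 1) * ψ x)) hd
    (fun x hx => (hs.eq_psi.hasDerivWithinAt hx).const_mul α)
    (fun x hx => (hs.eq_psi.2 x hx).const_mul α) (by simp [hs.psi_left]) (by simp [hs.psi_right])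
    (fun x hx h1 => by
      have h2 := hs.pos x hx
      have h3 : 0 < α ^ 2 * ψ x ^ 2 + a x ^ 2 - 1 := by nlinarith [sq_nonneg (a x)]
      positivity) hx
  have h0 := mul_pos hα (hs.pos x hx)
  have : (α * ψ x) ^ 2 ≤ 1 := pow_le_one₀ h0.le this
  linarith [mul_pow α (ψ x) 2]

/-- If `a` kept one sign, so would `a'' = α²ψ²a`, which contradicts the equality of `a'` at the two
ends. -/
lemma exists_zero (hs : IsScaledSolution κ d α h ψ a) (hd : 0 < d) (hα : 0 < α) :
    ∃ c ∈ Set.Icc (-d) d, a c = 0 := by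
  have hlt : -d < d := by linarith
  have hac : ContinuousOn a (Set.Icc (-d) d) := hs.eq_a.1.continuousOn
  by_contra! hcon
  have key : ∀ s : ℝ, (∀ x ∈ Set.Icc (-d) d, 0 < s * a x) → False := fun s hpos => by
    have := strictMonoOn_Icc_of_hasDerivWithinAt (fun x hx => (hs.eq_a.2 x hx).const_mul s)
      (fun x hx => by
        have hx' := Set.Ioo_subset_Icc_self hx
        have h1 := hs.pos x hx'
        have h2 := hpos x hx'
        have h3 : s * (α ^ 2 * ψ x ^ 2 * a x) = α ^ 2 * ψ x ^ 2 * (s * a x) := by ring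
        rw [h3]
        positivity)
    have := this (Set.left_mem_Icc.2 hlt.le) (Set.right_mem_Icc.2 hlt.le) hlt
    simp only [hs.a_left, hs.a_right] at this
    exact lt_irrefl _ this
  have hdm := Set.left_mem_Icc.2 hlt.le
  rcases lt_or_gt_of_ne (hcon _ hdm) with h0 | h0
  · refine key (-1) fun x hx => ?_
    by_contra! h1
    obtain ⟨z, hz, hz0⟩ := isPreconnected_Icc.intermediate_value hdm hx hac
      ⟨h0.le, by linarith⟩
    exact hcon z hz hz0
  · refine key 1 fun x hx => ?_
    by_contra! h1
    obtain ⟨z, hz, hz0⟩ := isPreconnected_Icc.intermediate_value hx hdm hac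
      ⟨by linarith, h0.le⟩
    exact hcon z hz hz0

/-- The product `a a'` is nondecreasing and vanishes at a zero of `a`. Hence `a'²`, whose derivative
is `2α²ψ² a a'`, grows away from that zero and is largest at the ends, where it equals `h²`. -/
lemma abs_deriv_potential_le (hs : IsScaledSolution κ d α h ψ a) (hd : 0 < d) (hα : 0 < α)
    {x : ℝ} (hx : x ∈ Set.Icc (-d) d) : |slabDeriv d a x| ≤ h := by
  obtain ⟨c, hc, hc0⟩ := hs.exists_zero hd hα
  have hlt : -d < d := by linarith
  have hprod : ∀ x ∈ Set.Icc (-d) d, HasDerivWithinAt (fun x => a x * slabDeriv d a x)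
      (slabDeriv d a x * slabDeriv d a x + a x * (α ^ 2 * ψ x ^ 2 * a x)) (Set.Icc (-d) d) x :=
    fun x hx => (hs.eq_a.hasDerivWithinAt hx).mul (hs.eq_a.2 x hx)
  have hm := monotoneOn_Icc_of_hasDerivWithinAt hprod fun x hx => by
    have h1 : a x * (α ^ 2 * ψ x ^ 2 * a x) = (α * ψ x * a x) ^ 2 := by ring
    have h2 := mul_self_nonneg (slabDeriv d a x)
    rw [h1]
    positivity
  have hsq : ∀ x ∈ Set.Icc (-d) d, HasDerivWithinAt (fun x => slabDeriv d a x ^ 2)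
      (2 * (α * ψ x) ^ 2 * (a x * slabDeriv d a x)) (Set.Icc (-d) d) x :=
    fun x hx => ((hs.eq_a.2 x hx).pow 2).congr_deriv (by simp; ring)
  have hle : slabDeriv d a x ^ 2 ≤ h ^ 2 := by
    rcases le_total c x with hcx | hcx
    · have hsub : Set.Icc c d ⊆ Set.Icc (-d) d := Set.Icc_subset_Icc_left hc.1
      have := monotoneOn_Icc_of_hasDerivWithinAt (fun x hx => (hsq x (hsub hx)).mono hsub)
        (fun y hy => by
          have h1 := hm hc (hsub (Set.Ioo_subset_Icc_self hy)) hy.1.le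
          simp only [hc0, zero_mul] at h1
          positivity)
      have := this ⟨hcx, hx.2⟩ ⟨hc.2, le_rfl⟩ hx.2
      simpa only [hs.a_right] using this
    · have hsub : Set.Icc (-d) c ⊆ Set.Icc (-d) d := Set.Icc_subset_Icc_right hc.2
      have := monotoneOn_Icc_of_hasDerivWithinAt (fun x hx => ((hsq x (hsub hx)).mono hsub).neg)
        (fun y hy => by
          have h1 := hm (hsub (Set.Ioo_subset_Icc_self hy)) hc hy.2.le
          simp only [hc0, zero_mul] at h1
          exact neg_nonneg.2 (mul_nonpos_of_nonneg_of_nonpos (by positivity) h1))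
      have := this ⟨le_rfl, hc.1⟩ ⟨hx.1, hcx⟩ hx.1
      simpa only [Pi.neg_apply, hs.a_left, neg_le_neg_iff] using this
  exact abs_le_of_sq_le_sq hle hs.field_pos.le

lemma abs_potential_le (hs : IsScaledSolution κ d α h ψ a) (hd : 0 < d) (hα : 0 < α)
    {x : ℝ} (hx : x ∈ Set.Icc (-d) d) : |a x| ≤ 2 * d * h := by
  obtain ⟨c, hc, hc0⟩ := hs.exists_zero hd hα
  have := (convex_Icc (-d) d).norm_image_sub_le_of_norm_hasDerivWithin_le
    (fun x hx => hs.eq_a.hasDerivWithinAt hx) (C := h)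
    (fun x hx => hs.abs_deriv_potential_le hd hα hx) hc hx
  rw [hc0, sub_zero, Real.norm_eq_abs, Real.norm_eq_abs] at this
  have h2 : |x - c| ≤ 2 * d := abs_le.2 ⟨by linarith [hx.1, hc.2], by linarith [hx.2, hc.1]⟩
  calc |a x| ≤ h * |x - c| := this
    _ ≤ h * (2 * d) := mul_le_mul_of_nonneg_left h2 hs.field_pos.le
    _ = 2 * d * h := by ring

/-- The bound for the logarithmic derivative of the order parameter. -/
lemma abs_log_deriv_le (hs : IsScaledSolution κ d α h ψ a) (hκ : 0 < κ) (hd : 0 < d) (hα : 0 < α)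
    {x : ℝ} (hx : x ∈ Set.Icc (-d) d) :
    |slabDeriv d ψ x / ψ x| ≤ 2 * d * (κ ^ 2 * (2 * d * h) ^ 2) := by
  set C := κ ^ 2 * (2 * d * h) ^ 2 with hC
  have hC0 : 0 ≤ C := by positivity
  have hdd : d ∈ Set.Icc (-d) d := ⟨by linarith, le_rfl⟩
  -- The quotient `w = ψ'/ψ` satisfies the Riccati equation `w' = V - w²` with `V ≤ C`, so `Cx - w`
  -- is nondecreasing; `w` vanishes at both ends.
  have hm := monotoneOn_Icc_of_hasDerivWithinAt (a := -d) (b := d)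
    (f := fun x => C * x - slabDeriv d ψ x / ψ x)
    (f' := fun x => C - (κ ^ 2 * (α ^ 2 * ψ x ^ 2 + a x ^ 2 - 1) - (slabDeriv d ψ x / ψ x) ^ 2))
    (fun x hx => (((hasDerivWithinAt_id x _).const_mul C).sub ((hs.eq_psi.2 x hx).div
      (hs.eq_psi.hasDerivWithinAt hx) (hs.pos x hx).ne')).congr_deriv (by
        have := (hs.pos x hx).ne'
        field_simp))
    (fun x hx => by
      have hx' := Set.Ioo_subset_Icc_self hx
      have h1 := hs.amplitude_le hκ hd hα hx'
      have h2 := sq_le_sq' (abs_le.1 (hs.abs_potential_le hd hα hx')).1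
        (abs_le.1 (hs.abs_potential_le hd hα hx')).2
      have h3 : κ ^ 2 * (α ^ 2 * ψ x ^ 2 + a x ^ 2 - 1) ≤ C :=
        mul_le_mul_of_nonneg_left (by linarith) (sq_nonneg κ)
      have h4 := sq_nonneg (slabDeriv d ψ x / ψ x)
      linarith)
  have e1 := hm (neg_mem_slab hdd) hx hx.1
  have e2 := hm hx hdd hx.2
  simp only [hs.psi_left, hs.psi_right, zero_div] at e1 e2
  exact abs_le.2 ⟨by nlinarith [hx.1, hx.2], by nlinarith [hx.1, hx.2]⟩

/-- A Harnack-type inequality: a bound on the logarithmic derivative makes all values of `ψ`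
comparable, the value at `-d` being `1`. -/
lemma le_mul_exp (hs : IsScaledSolution κ d α h ψ a) {W : ℝ}
    (hW : ∀ x ∈ Set.Icc (-d) d, |slabDeriv d ψ x / ψ x| ≤ W) {x y : ℝ}
    (hx : x ∈ Set.Icc (-d) d) (hy : y ∈ Set.Icc (-d) d) : ψ x ≤ ψ y * Real.exp (W * |x - y|) := by
  have hexp : ∀ W x : ℝ, HasDerivAt (fun x => Real.exp (W * x)) (Real.exp (W * x) * W) x :=
    fun W x => by simpa using ((hasDerivAt_id x).const_mul W).exp
  have hb : ∀ x ∈ Set.Icc (-d) d, -(W * ψ x) ≤ slabDeriv d ψ x ∧ slabDeriv d ψ x ≤ W * ψ x :=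
    fun x hx => by
    have h0 := hs.pos x hx
    have h1 := hW x hx
    rw [abs_div, abs_of_pos h0, div_le_iff₀ h0] at h1
    exact abs_le.1 h1
  have hup := monotoneOn_Icc_of_hasDerivWithinAt
    (fun x hx => (hs.eq_psi.hasDerivWithinAt hx).mul (hexp W x).hasDerivWithinAt)
    (fun x hx => by
      have h1 := (hb x (Set.Ioo_subset_Icc_self hx)).1
      have h2 := Real.exp_pos (W * x)
      nlinarith)
  have hdown := monotoneOn_Icc_of_hasDerivWithinAt
    (fun x hx => ((hs.eq_psi.hasDerivWithinAt hx).mul (hexp (-W) x).hasDerivWithinAt).neg)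
    (fun x hx => by
      have h1 := (hb x (Set.Ioo_subset_Icc_self hx)).2
      have h2 := Real.exp_pos (-W * x)
      nlinarith)
  rcases le_total x y with hxy | hxy
  · have h1 := hup hx hy hxy
    simp only [Pi.mul_apply] at h1
    have h2 := mul_le_mul_of_nonneg_right h1 (Real.exp_pos (-(W * x))).le
    rw [mul_assoc, mul_assoc, ← Real.exp_add, ← Real.exp_add, add_neg_cancel, Real.exp_zero,
      mul_one] at h2
    rw [abs_of_nonpos (by linarith), show W * -(x - y) = W * y + -(W * x) by ring]
    exact h2
  · have h1 := neg_le_neg_iff.1 (hdown hy hx hxy)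
    simp only [Pi.mul_apply] at h1
    have h2 := mul_le_mul_of_nonneg_right h1 (Real.exp_pos (W * x)).le
    rw [mul_assoc, mul_assoc, ← Real.exp_add, ← Real.exp_add, neg_mul, neg_add_cancel,
      Real.exp_zero, mul_one] at h2
    rw [abs_of_nonneg (by linarith), show W * (x - y) = -W * y + W * x by ring]
    exact h2

/-- Bounds for the data at the centre that hold uniformly for bounded fields. -/
lemma exists_centre_bound (κ d H : ℝ) (hκ : 0 < κ) (hd : 0 < d) :
    ∃ B : ℝ, 0 < B ∧ ∀ (α h : ℝ) (ψ a : ℝ → ℝ), 0 < α → h ≤ H → IsScaledSolution κ d α h ψ a →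
      |slabDeriv d ψ 0 / ψ 0| ≤ B ∧ |a 0| ≤ B ∧ ψ 0 ≤ B ∧
      (∀ x ∈ Set.Icc (-d) d, 1 ≤ B * (ψ x / ψ 0)) ∧ |slabDeriv d a 0 - h| ≤ α ^ 2 * B := by
  set W := 2 * d * (κ ^ 2 * (2 * d * H) ^ 2) with hW
  set K := 2 * d * |H| with hK
  set X := Real.exp (W * (2 * d)) with hX
  have hW0 : 0 ≤ W := by positivity
  have hK0 : 0 ≤ K := by positivity
  have hX1 : 1 ≤ X := Real.one_le_exp (by positivity)
  refine ⟨W + K + X + X ^ 2 * K * d, by positivity, fun α h ψ a hα hH hs => ?_⟩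
  have h00 : (0 : ℝ) ∈ Set.Icc (-d) d := ⟨by linarith, hd.le⟩
  have hdd : d ∈ Set.Icc (-d) d := ⟨by linarith, le_rfl⟩
  have hh := hs.field_pos
  have hHpos : 0 < H := hh.trans_le hH
  have hwb : ∀ x ∈ Set.Icc (-d) d, |slabDeriv d ψ x / ψ x| ≤ W := fun x hx =>
    (hs.abs_log_deriv_le hκ hd hα hx).trans (by rw [hW]; gcongr)
  have hab : ∀ x ∈ Set.Icc (-d) d, |a x| ≤ K := fun x hx =>
    (hs.abs_potential_le hd hα hx).trans (by
      rw [hK, abs_of_pos hHpos]; gcongr)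
  have hexp : ∀ x ∈ Set.Icc (-d) d, ∀ y ∈ Set.Icc (-d) d, ψ x ≤ ψ y * X := fun x hx y hy => by
    refine (hs.le_mul_exp hwb hx hy).trans (mul_le_mul_of_nonneg_left ?_ (hs.pos y hy).le)
    refine Real.exp_le_exp.2 (mul_le_mul_of_nonneg_left ?_ hW0)
    exact abs_le.2 ⟨by linarith [hx.1, hy.2], by linarith [hx.2, hy.1]⟩
  have hψX : ∀ x ∈ Set.Icc (-d) d, ψ x ≤ X := fun x hx => by
    simpa [hs.psi_init] using hexp x hx _ (neg_mem_slab hdd)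
  have hXK : 0 ≤ X ^ 2 * K * d := by positivity
  refine ⟨(hwb 0 h00).trans (by linarith), (hab 0 h00).trans (by linarith),
    (hψX 0 h00).trans (by linarith), fun x hx => ?_, ?_⟩
  · have h1 := hexp 0 h00 x hx
    have h2 := hs.pos 0 h00
    have h3 := hs.pos x hx
    rw [← mul_div_assoc, le_div_iff₀ h2, one_mul]
    refine h1.trans ?_
    rw [mul_comm]
    exact mul_le_mul_of_nonneg_right (by linarith) h3.le
  · have := (convex_Icc (-d) d).norm_image_sub_le_of_norm_hasDerivWithin_le
      (fun x hx => hs.eq_a.2 x hx) (C := α ^ 2 * X ^ 2 * K)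
      (fun x hx => by
        rw [Real.norm_eq_abs, abs_mul, abs_of_nonneg (by positivity)]
        have h1 : ψ x ^ 2 ≤ X ^ 2 := pow_le_pow_left₀ (hs.pos x hx).le (hψX x hx) 2
        have h2 := hab x hx
        gcongr) hdd h00
    rw [hs.a_right, Real.norm_eq_abs, Real.norm_eq_abs, zero_sub, abs_neg, abs_of_pos hd] at this
    refine this.trans ?_
    have : α ^ 2 * X ^ 2 * K * d = α ^ 2 * (X ^ 2 * K * d) := by ring
    rw [this]
    exact mul_le_mul_of_nonneg_left (by linarith) (sq_nonneg α)

end IsScaledSolution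

/-! ### Limits of small solutions. -/

/-- Solutions of the scaled problem with amplitude tending to `0` and field tending to `h(0)`. -/
structure IsSmallFamily {ι : Type*} (𝓕 : Filter ι) (κ d : ℝ) (α h : ι → ℝ) (ψ a : ι → ℝ → ℝ) :
    Prop where
  sol : ∀ n, IsScaledSolution κ d (α n) (h n) (ψ n) (a n)
  pos : ∀ n, 0 < α n
  le : ∀ n, h n ≤ criticalField κ d 0 + 1
  amplitude : Tendsto α 𝓕 (𝓝 0)
  field : Tendsto h 𝓕 (𝓝 (criticalField κ d 0))

namespace IsSmallFamily

variable {ι : Type*} {𝓕 : Filter ι} {κ d : ℝ} {α h : ι → ℝ} {ψ a : ι → ℝ → ℝ}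

lemma centre_tendsto (S : IsSmallFamily 𝓕 κ d α h ψ a) (hκ : 0 < κ) (hd : 0 < d) :
    Tendsto (fun n => slabDeriv d (a n) 0) 𝓕 (𝓝 (criticalField κ d 0)) ∧
      Tendsto (fun n => α n ^ 2 * ψ n 0 ^ 2) 𝓕 (𝓝 0) := by
  obtain ⟨B, hB, hbd⟩ := IsScaledSolution.exists_centre_bound κ d (criticalField κ d 0 + 1) hκ hd
  have hα2 : Tendsto (fun n => α n ^ 2) 𝓕 (𝓝 0) := by simpa using S.amplitude.pow 2
  constructor
  · have h1 : Tendsto (fun n => α n ^ 2 * B) 𝓕 (𝓝 0) := by simpa using hα2.mul_const B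
    have h2 : Tendsto (fun n => slabDeriv d (a n) 0 - h n) 𝓕 (𝓝 0) :=
      squeeze_zero_norm (fun n => (hbd _ _ _ _ (S.pos n) (S.le n) (S.sol n)).2.2.2.2) h1
    simpa using h2.add S.field
  · have h1 : Tendsto (fun n => α n ^ 2 * B ^ 2) 𝓕 (𝓝 0) := by simpa using hα2.mul_const (B ^ 2)
    refine squeeze_zero (fun n => by positivity) (fun n => ?_) h1
    have h2 := (hbd _ _ _ _ (S.pos n) (S.le n) (S.sol n)).2.2.1
    have h3 := ((S.sol n).pos 0 ⟨by linarith, hd.le⟩).le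
    exact mul_le_mul_of_nonneg_left (pow_le_pow_left₀ h3 h2 2) (sq_nonneg _)

/-- The solutions are profiles whose centre data and parameters converge, so continuity of the flow
carries the convergence to every point. -/
lemma partsOf_tendsto (S : IsSmallFamily 𝓕 κ d α h ψ a) (hκ : 0 < κ) (hd : 0 < d) {η : ι → ℝ}
    (hη : ∀ n, η n ≠ 0) {ρ q ζ : ℝ}
    (hρ : Tendsto (fun n => slabDeriv d (ψ n) 0 / ψ n 0 / η n) 𝓕 (𝓝 ρ))
    (hq : Tendsto (fun n => a n 0 / η n) 𝓕 (𝓝 q)) (hζ : Tendsto (fun n => η n ^ 2) 𝓕 (𝓝 ζ))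
    {P : ℝ → Fin 8 → ℝ} (hP : IsProfile ![0, ζ, κ, d] P)
    (h0 : P 0 = centreState (criticalField κ d 0) ρ q) {x : ℝ} (hx : x ∈ Set.Icc (-d) d)
    (i : Fin 8) :
    Tendsto (fun n => partsOf d (α n ^ 2 * ψ n 0 ^ 2) (η n) (ψ n) (a n) x i) 𝓕 (𝓝 (P x i)) := by
  obtain ⟨hb, hσ⟩ := S.centre_tendsto hκ hd
  have hdata : Tendsto (fun n => (centreState (slabDeriv d (a n) 0)
      (slabDeriv d (ψ n) 0 / ψ n 0 / η n) (a n 0 / η n),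
      (![α n ^ 2 * ψ n 0 ^ 2, η n ^ 2, κ, d] : Fin 4 → ℝ))) 𝓕 (𝓝 (P 0, ![0, ζ, κ, d])) := by
    rw [h0]
    refine Tendsto.prodMk_nhds (tendsto_pi_nhds.2 fun i => ?_) (tendsto_pi_nhds.2 fun i => ?_)
    · fin_cases i <;> simp [centreState] <;> first | assumption | exact tendsto_const_nhds
    · fin_cases i <;> simp <;> first | assumption | exact tendsto_const_nhds
  obtain ⟨hfl, hPx⟩ := hP.flowsFrom (p := ![0, ζ, κ, d]) hd
  have h1 := ((hfl.continuousAt contDiff_timeField).tendsto.comp hdata)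
  have h2 := ((ContinuousMap.evalCLM ℝ (clampTime (x / d))).continuous.continuousAt.tendsto.comp h1)
  have h3 := ((continuous_apply i).comp continuous_fst).continuousAt.tendsto.comp h2
  have h4 : P x i = (flow timeField (P 0, ![0, ζ, κ, d]) (clampTime (x / d))).1 i :=
    congrFun (hPx x hx).symm i
  rw [h4]
  refine h3.congr fun n => ?_
  obtain ⟨e1, e2, -⟩ := (S.sol n).isProfile_partsOf hd (S.pos n) (hη n)
  have := (e1.flowsFrom (p := ![α n ^ 2 * ψ n 0 ^ 2, η n ^ 2, κ, d]) hd).2 x hx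
  rw [e2] at this
  exact congrFun this i

lemma end_eq_zero (S : IsSmallFamily 𝓕 κ d α h ψ a) [𝓕.NeBot] (hκ : 0 < κ) (hd : 0 < d)
    {η : ι → ℝ} (hη : ∀ n, η n ≠ 0) {ρ q ζ : ℝ}
    (hρ : Tendsto (fun n => slabDeriv d (ψ n) 0 / ψ n 0 / η n) 𝓕 (𝓝 ρ))
    (hq : Tendsto (fun n => a n 0 / η n) 𝓕 (𝓝 q)) (hζ : Tendsto (fun n => η n ^ 2) 𝓕 (𝓝 ζ))
    {P : ℝ → Fin 8 → ℝ} (hP : IsProfile ![0, ζ, κ, d] P)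
    (h0 : P 0 = centreState (criticalField κ d 0) ρ q) : P d 1 = 0 ∧ P d 3 = 0 ∧ P d 7 = 0 := by
  have hdd : d ∈ Set.Icc (-d) d := ⟨by linarith, le_rfl⟩
  have h1 (i : Fin 8) := S.partsOf_tendsto hκ hd hη hρ hq hζ hP h0 hdd i
  have h2 := fun n => ((S.sol n).isProfile_partsOf hd (S.pos n) (hη n)).2.2
  refine ⟨tendsto_nhds_unique (h1 1) ?_, tendsto_nhds_unique (h1 3) ?_,
    tendsto_nhds_unique (h1 7) ?_⟩
  · simp only [(h2 _).1]; exact tendsto_const_nhds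
  · simp only [(h2 _).2.1]; exact tendsto_const_nhds
  · simp only [(h2 _).2.2.2]; exact tendsto_const_nhds

/-- Limits of small solutions are symmetric. -/
lemma centre_limit_eq_zero (S : IsSmallFamily 𝓕 κ d α h ψ a) [𝓕.NeBot] (hκ : 0 < κ) (hd : 0 < d)
    (hreg : κ * d < 1 / 100 ∨ 6 < κ * d) {r q : ℝ}
    (hr : Tendsto (fun n => slabDeriv d (ψ n) 0 / ψ n 0) 𝓕 (𝓝 r))
    (hq : Tendsto (fun n => a n 0) 𝓕 (𝓝 q)) : r = 0 ∧ q = 0 := by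
  obtain ⟨E, E', o, o', M⟩ := exists_criticalModes hκ hd (show d ≤ 3 * d by linarith)
  set b := criticalField κ d 0 with hb
  have hbpos : 0 < b := M.field_pos
  have hdd := M.mem_d
  obtain ⟨P, f, f', hP, h0, f0, f1, hf, hPf⟩ :=
    exists_profile_of_zero_amplitude (d := d) hκ.ne' hbpos.ne' r q
  have hζ : Tendsto (fun _ : ι => (1 : ℝ) ^ 2) 𝓕 (𝓝 1) := by simp
  have hr1 : Tendsto (fun n => slabDeriv d (ψ n) 0 / ψ n 0 / 1) 𝓕 (𝓝 r) := by simpa using hr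
  have hq1 : Tendsto (fun n => a n 0 / 1) 𝓕 (𝓝 q) := by simpa using hq
  obtain ⟨p1, p3, p7⟩ := S.end_eq_zero hκ hd (fun _ => one_ne_zero) hr1 hq1 hζ hP h0
  obtain ⟨B, hB, hbd⟩ := IsScaledSolution.exists_centre_bound κ d (b + 1) hκ hd
  -- The uniform lower bound on `ψ / ψ(0)` keeps the limit mode strictly positive.
  have hfpos : ∀ x ∈ Set.Icc (-d) d, 0 < f x := fun x hx => by
    have hlim (i : Fin 8) := S.partsOf_tendsto hκ hd (fun _ => one_ne_zero) hr1 hq1 hζ hP h0 hx i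
    have h1 := ((hlim 0).add (hlim 2)).const_mul B
    rw [(hPf x).1] at h1
    have h2 : 1 ≤ B * f x := ge_of_tendsto' h1 fun n => by
      have h3 := (partsOf_recombine (d := d) (σ := α n ^ 2 * ψ n 0 ^ 2) (ψ := ψ n) (a := a n)
        one_ne_zero x).1
      rw [one_mul] at h3
      rw [h3]
      exact (hbd _ _ _ _ (S.pos n) (S.le n) (S.sol n)).2.2.2.1 x hx
    exact pos_of_mul_pos_right (one_pos.trans_le h2) hB.le
  have hneg := hP.apply_neg (p := ![0, 1, κ, d]) hd h0 hdd
  have hr0 : f' d = 0 := by rw [← (hPf d).2.1, p1, p3, add_zero]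
  have hl0 : f' (-d) = 0 := by
    rw [← (hPf (-d)).2.1, hneg]
    simp [reflectState, p1, p3]
  have hq0 : q = 0 := M.shift_eq_zero hreg hf hfpos hl0 hr0 (by
    have := (hPf d).2.2.2
    rw [p7, hr0, hl0] at this
    simp at this
    linarith)
  refine ⟨?_, hq0⟩
  subst hq0
  have hfm : IsLinearMode κ b d f f' := fun x hx =>
    ⟨(hf x hx).1, (hf x hx).2.congr_deriv (by ring)⟩
  -- With zero shift the limit mode is `E + r o`; since `E'(d) = 0` and `o'(d) > 0`, its Neumann
  -- condition gives `r = 0`.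
  have hcomb : IsLinearMode κ b d (fun x => E x + r * o x) (fun x => E' x + r * o' x) := fun x hx =>
    ⟨(M.modeE.mono M.le x hx).1.add ((M.modeo.mono M.le x hx).1.const_mul r),
      ((M.modeE.mono M.le x hx).2.add ((M.modeo.mono M.le x hx).2.const_mul r)).congr_deriv
        (by ring)⟩
  have h5 := (hfm.unique hd hcomb (by simp [f0, M.E_zero, M.o_zero])
    (by simp [f1, M.E'_zero, M.o'_zero]) hdd).2
  have h6 := M.o'_pos (x := d) ⟨by linarith, by linarith⟩
  rw [hr0, M.E'_end, zero_add] at h5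
  exact (mul_eq_zero.1 h5.symm).resolve_right h6.ne'

/-- Small solutions whose asymmetry tends to zero are symmetric at the centre. -/
lemma not_asymmetric (S : IsSmallFamily 𝓕 κ d α h ψ a) [𝓕.NeBot] (hκ : 0 < κ) (hd : 0 < d)
    (hreg : κ * d < 1 / 100 ∨ 6 < κ * d) {η : ι → ℝ} (hη : ∀ n, η n ≠ 0)
    (hη0 : Tendsto η 𝓕 (𝓝 0)) {ρ q : ℝ}
    (hρ : Tendsto (fun n => slabDeriv d (ψ n) 0 / ψ n 0 / η n) 𝓕 (𝓝 ρ))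
    (hq : Tendsto (fun n => a n 0 / η n) 𝓕 (𝓝 q)) : ρ = 0 ∧ q = 0 := by
  obtain ⟨E, E', o, o', M⟩ := exists_criticalModes hκ hd (show d ≤ 3 * d by linarith)
  set b := criticalField κ d 0 with hb
  have hbpos : 0 < b := M.field_pos
  have hζ : Tendsto (fun n => η n ^ 2) 𝓕 (𝓝 0) := by simpa using hη0.pow 2
  have hP := isProfile_linearProfile (ρ := ρ) (q := q) hκ.ne' hbpos.ne' (M.modeE.mono M.le)
    (M.modeo.mono M.le)
  obtain ⟨-, p3, p7⟩ := S.end_eq_zero hκ hd hη hρ hq hζ hP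
    (linearProfile_zero M.E_zero M.E'_zero M.o_zero M.o'_zero)
  have ho := M.o'_pos (x := d) ⟨by linarith, by linarith⟩
  have hE := M.E_pos d M.mem_d
  simp [linearProfile, M.E'_end] at p3 p7
  set s := ρ + q / b * κ ^ 2 with hs
  have hq0 : q = 0 := by
    -- Eliminating the coefficient `s` of the odd mode between the conditions on `o'(d)` and `m(d)`
    -- leaves `q` times the quantity shown nonzero in `nondegenerate`.
    have h1 : q * E d ^ 2 * (b ^ 2 * d * o' d - κ ^ 2 * (b ^ 2 * d ^ 2 - 1) ^ 2 * o d) = 0 := by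
      have h3 : s * o' d * b = -(q * (κ ^ 2 * (b ^ 2 * d ^ 2 - 1) * E d)) := by
        field_simp at p3
        linarith
      have h7 : q * (d * E d ^ 2) * b + s * ((b ^ 2 * d ^ 2 - 1) * E d * o d) = 0 := by
        field_simp at p7
        linarith
      linear_combination b * o' d * h7 - ((b ^ 2 * d ^ 2 - 1) * E d * o d) * h3
    rcases mul_eq_zero.1 h1 with h2 | h2
    · exact (mul_eq_zero.1 h2).resolve_right (by positivity)
    · exact absurd (by linarith) (M.nondegenerate hreg)
  refine ⟨?_, hq0⟩
  subst hq0
  simp at p3 hs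
  rw [hs] at p3
  exact p3.resolve_right ho.ne'

end IsSmallFamily

/-! ### Uniqueness of small solutions in short and long slabs. -/

/-- The parts are defined with a scale `η` that enters the equations only through `η²`, so `η` may
be replaced by `-η`. -/
lemma IsProfile.flip {p : Fin 4 → ℝ} {P : ℝ → Fin 8 → ℝ} (hP : IsProfile p P) :
    IsProfile p fun x => ![P x 0, P x 1, -P x 2, -P x 3, P x 4, P x 5, -P x 6, -P x 7] := by
  intro x hx
  have h (i : Fin 8) := hP.apply i hx
  refine hasDerivWithinAt_pi.2 fun i => ?_
  fin_cases i
  · exact (h 0).congr_deriv (by simp [partsField])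
  · exact (h 1).congr_deriv (by simp [partsField]; left; ring)
  · exact (h 2).neg.congr_deriv (by simp [partsField])
  · exact (h 3).neg.congr_deriv (by simp [partsField]; ring)
  · exact (h 4).congr_deriv (by simp [partsField])
  · exact (h 5).congr_deriv (by simp [partsField])
  · exact (h 6).neg.congr_deriv (by simp [partsField])
  · exact (h 7).neg.congr_deriv (by simp [partsField]; ring)

/-- Profiles with symmetric data at the centre are symmetric. -/
lemma IsProfile.vanish_of_symmetric {σ ζ κ d b : ℝ} (hd : 0 < d) {P : ℝ → Fin 8 → ℝ}
    (hP : IsProfile ![σ, ζ, κ, d] P) (h0 : P 0 = centreState b 0 0) :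
    (∀ x ∈ Set.Icc (-d) d, P x 2 = 0 ∧ P x 3 = 0 ∧ P x 6 = 0 ∧ P x 7 = 0) ∧
      IsProfile ![σ, 0, κ, d] P := by
  have hv : ∀ x ∈ Set.Icc (-d) d, P x 2 = 0 ∧ P x 3 = 0 ∧ P x 6 = 0 ∧ P x 7 = 0 := fun x hx => by
    have h1 := hP.flip.eqOn (p := ![σ, ζ, κ, d]) hd hP (by
      ext i
      fin_cases i <;> simp [h0, centreState]) hx
    have h2 := congrFun h1 2
    have h3 := congrFun h1 3
    have h6 := congrFun h1 6
    have h7 := congrFun h1 7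
    simp at h2 h3 h6 h7
    exact ⟨by linarith, by linarith, by linarith, by linarith⟩
  refine ⟨hv, fun x hx => (hP x hx).congr_deriv ?_⟩
  obtain ⟨v2, v3, v6, v7⟩ := hv x hx
  ext i
  fin_cases i <;> simp [partsField, v2, v3, v6, v7]

/-- Solutions with symmetric data at the centre are determined by the symmetric branch. -/
lemma IsScaledSolution.symmetric_eq {κ d α h : ℝ} {ψ a : ℝ → ℝ} (hd : 0 < d) (hα : 0 < α)
    (hs : IsScaledSolution κ d α h ψ a) (hr : slabDeriv d ψ 0 = 0) (hq : a 0 = 0) :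
    let z := (α ^ 2 * ψ 0 ^ 2, slabDeriv d a 0)
    z.1 * symmetricEnd κ d z 0 ^ 2 = α ^ 2 ∧ symmetricEnd κ d z 1 = 0 ∧ symmetricEnd κ d z 5 = h ∧
      ∀ x ∈ Set.Icc (-d) d,
        α * ψ x = √z.1 * profile (centreState z.2 0 0) ![z.1, 0, κ, d] x 0 ∧
        a x = profile (centreState z.2 0 0) ![z.1, 0, κ, d] x 4 := by
  intro z
  have hdd : d ∈ Set.Icc (-d) d := ⟨by linarith, le_rfl⟩
  have hψ0 := hs.pos 0 ⟨by linarith, hd.le⟩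
  obtain ⟨hP, h0, h1, -, h5, -⟩ := hs.isProfile_partsOf hd hα one_ne_zero
  generalize hPdef : partsOf d (α ^ 2 * ψ 0 ^ 2) 1 ψ a = P at hP h0 h1 h5
  rw [hr, hq] at h0
  simp only [zero_div] at h0
  obtain ⟨hv, hP0⟩ := hP.vanish_of_symmetric hd h0
  have hprof := (hP0.flowsFrom (p := ![α ^ 2 * ψ 0 ^ 2, 0, κ, d]) hd).2
  rw [h0] at hprof
  have hend : symmetricEnd κ d z = P d := by
    rw [← hprof d hdd]
    exact endState_eq (p := ![α ^ 2 * ψ 0 ^ 2, 0, κ, d]) hd.ne'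
  have hrec : ∀ x ∈ Set.Icc (-d) d, P x 0 = ψ x / ψ 0 ∧ P x 4 = a x := fun x hx => by
    obtain ⟨e1, e2⟩ := partsOf_recombine (d := d) (σ := α ^ 2 * ψ 0 ^ 2) (ψ := ψ) (a := a)
      one_ne_zero x
    rw [hPdef] at e1 e2
    obtain ⟨v2, -, v6, -⟩ := hv x hx
    rw [v2, mul_zero, add_zero] at e1
    rw [v6, mul_zero, add_zero] at e2
    exact ⟨e1, e2⟩
  have hneg := hP.apply_neg (p := ![α ^ 2 * ψ 0 ^ 2, 1 ^ 2, κ, d]) hd h0 hdd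
  have hψd : P d 0 = 1 / ψ 0 := by
    have e0 : ∀ v, reflectState v 0 = v 0 := fun v => rfl
    rw [← e0 (P d), ← hneg, (hrec _ (neg_mem_slab hdd)).1, hs.psi_init]
  refine ⟨?_, by rw [hend]; exact h1, by rw [hend]; exact h5, fun x hx => ?_⟩
  · rw [hend, hψd]
    simp only [z]
    field_simp
  · have hsq : √z.1 = α * ψ 0 := by
      show √(α ^ 2 * ψ 0 ^ 2) = _
      rw [← mul_pow]
      exact Real.sqrt_sq (mul_pos hα hψ0).le
    have hx' : profile (centreState z.2 0 0) ![z.1, 0, κ, d] x = P x := hprof x hx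
    rw [hx', hsq, (hrec x hx).1, (hrec x hx).2]
    refine ⟨?_, rfl⟩
    field_simp

/-- In short and in long slabs all small solutions are symmetric, with data close to the critical
one. -/
theorem exists_forall_small_symmetric {κ d : ℝ} (hκ : 0 < κ) (hd : 0 < d)
    (hreg : κ * d < 1 / 100 ∨ 6 < κ * d) {p : ℝ × (ℝ × ℝ) → Prop}
    (hp : ∀ᶠ x in 𝓝 (0, (0, criticalField κ d 0)), p x) :
    ∃ δ : ℝ, 0 < δ ∧ ∀ (α h : ℝ) (ψ a : ℝ → ℝ), 0 < α → α < δ → |h - criticalField κ d 0| < δ →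
      IsScaledSolution κ d α h ψ a → slabDeriv d ψ 0 = 0 ∧ a 0 = 0 ∧
        p (α ^ 2, (α ^ 2 * ψ 0 ^ 2, slabDeriv d a 0)) := by
  by_contra! hcon
  have hδ : ∀ n : ℕ, (0 : ℝ) < 1 / ((n : ℝ) + 1) := fun n => by positivity
  choose α h ψ a hα hαδ hhδ hs hbad using fun n : ℕ => hcon (1 / ((n : ℝ) + 1)) (hδ n)
  have hone : Tendsto (fun n : ℕ => 1 / ((n : ℝ) + 1)) atTop (𝓝 0) :=
    tendsto_one_div_add_atTop_nhds_zero_nat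
  -- Along an ultrafilter every bounded sequence converges, so no subsequences have to be extracted.
  obtain ⟨𝓤, hle⟩ : ∃ 𝓤 : Ultrafilter ℕ, (𝓤 : Filter ℕ) ≤ atTop :=
    ⟨Filter.hyperfilter ℕ, Nat.hyperfilter_le_atTop⟩
  have S : IsSmallFamily (𝓤 : Filter ℕ) κ d α h ψ a := by
    refine ⟨hs, hα, fun n => ?_, ?_, ?_⟩
    · have h1 := (abs_lt.1 (hhδ n)).2
      have h2 : 1 / ((n : ℝ) + 1) ≤ 1 := by
        rw [div_le_one (by positivity)]
        linarith [Nat.cast_nonneg (α := ℝ) n]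
      linarith
    · exact (squeeze_zero (fun n => (hα n).le) (fun n => (hαδ n).le) hone).mono_left hle
    · refine Tendsto.mono_left ?_ hle
      have : Tendsto (fun n => h n - criticalField κ d 0) atTop (𝓝 0) :=
        squeeze_zero_norm (fun n => (hhδ n).le) hone
      simpa using this.add_const (criticalField κ d 0)
  obtain ⟨hb, hσ⟩ := S.centre_tendsto hκ hd
  have hα2 : Tendsto (fun n => α n ^ 2) (𝓤 : Filter ℕ) (𝓝 0) := by simpa using S.amplitude.pow 2
  have hev := (hα2.prodMk_nhds (hσ.prodMk_nhds hb)).eventually hp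
  have hlim : ∀ {B : ℝ} {f : ℕ → ℝ}, (∀ n, |f n| ≤ B) →
      ∃ y, Tendsto f (𝓤 : Filter ℕ) (𝓝 y) := fun {B f} hf => by
    obtain ⟨y, -, hy⟩ := (isCompact_Icc (a := -B) (b := B)).ultrafilter_le_nhds' (𝓤.map f)
      (Filter.Eventually.of_forall (f := (𝓤 : Filter ℕ)) fun n => abs_le.1 (hf n))
    exact ⟨y, hy⟩
  obtain ⟨B, hB, hbd⟩ := IsScaledSolution.exists_centre_bound κ d (criticalField κ d 0 + 1) hκ hd
  have hbd' := fun n => hbd _ _ _ _ (hα n) (S.le n) (hs n)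
  obtain ⟨r, hr⟩ := hlim fun n => (hbd' n).1
  obtain ⟨q, hq⟩ := hlim fun n => (hbd' n).2.1
  obtain ⟨rfl, rfl⟩ := S.centre_limit_eq_zero hκ hd hreg hr hq
  set u : ℕ → ℝ := fun n => slabDeriv d (ψ n) 0 / ψ n 0 with hu
  -- The size of the asymmetry at the centre. Where it is zero, the positive null sequence `α` is
  -- used instead, so that division by `η` is meaningful and `η` still tends to `0`.
  let η : ℕ → ℝ := fun n => if |u n| + |a n 0| = 0 then α n else |u n| + |a n 0|
  have hηpos : ∀ n, 0 < η n := fun n => by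
    simp only [η]
    split_ifs with hn
    · exact hα n
    · exact lt_of_le_of_ne (by positivity) (Ne.symm hn)
  have hle1 : ∀ n, |u n| ≤ η n ∧ |a n 0| ≤ η n := fun n => by
    simp only [η]
    split_ifs with hn
    · have h1 := abs_nonneg (u n)
      have h2 := abs_nonneg (a n 0)
      have h3 := (hα n).le
      exact ⟨by linarith, by linarith⟩
    · exact ⟨by linarith [abs_nonneg (a n 0)], by linarith [abs_nonneg (u n)]⟩
  have hη0 : Tendsto η (𝓤 : Filter ℕ) (𝓝 0) := by
    have h1 : Tendsto (fun n => α n + (|u n| + |a n 0|)) (𝓤 : Filter ℕ) (𝓝 0) := by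
      simpa using S.amplitude.add (hr.abs.add hq.abs)
    refine squeeze_zero (fun n => (hηpos n).le) (fun n => ?_) h1
    simp only [η]
    split_ifs with hn
    · linarith
    · linarith [hα n]
  have hquot : ∀ {f : ℕ → ℝ}, (∀ n, |f n| ≤ η n) → ∀ n, |f n / η n| ≤ 1 := fun {f} hf n => by
    rw [abs_div, abs_of_pos (hηpos n), div_le_one (hηpos n)]
    exact hf n
  obtain ⟨ρ', hρ'⟩ := hlim (hquot fun n => (hle1 n).1)
  obtain ⟨q', hq'⟩ := hlim (hquot fun n => (hle1 n).2)
  obtain ⟨rfl, rfl⟩ := S.not_asymmetric hκ hd hreg (fun n => (hηpos n).ne') hη0 hρ' hq'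
  -- This sum equals `1` wherever the asymmetry is nonzero. As it tends to `0`, some solution of the
  -- family has symmetric centre data, which contradicts its choice.
  have hsum : Tendsto (fun n => |u n / η n| + |a n 0 / η n|) (𝓤 : Filter ℕ) (𝓝 0) := by
    simpa using hρ'.abs.add hq'.abs
  obtain ⟨n, hn1, hn2⟩ := (hev.and (hsum.eventually (gt_mem_nhds one_pos))).exists
  have hzero : |u n| + |a n 0| = 0 := by
    by_contra hne
    have he : η n = |u n| + |a n 0| := by simp only [η, if_neg hne]
    rw [abs_div (u n), abs_div (a n 0), abs_of_pos (hηpos n), ← add_div, ← he, div_self (hηpos n).ne'] at hn2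
    exact lt_irrefl _ hn2
  have h1 : u n = 0 := abs_eq_zero.1 (by linarith [abs_nonneg (u n), abs_nonneg (a n 0)])
  have h2 : a n 0 = 0 := abs_eq_zero.1 (by linarith [abs_nonneg (u n), abs_nonneg (a n 0)])
  have h3 : slabDeriv d (ψ n) 0 = 0 :=
    (div_eq_zero_iff.1 h1).resolve_right ((hs n).pos 0 ⟨by linarith, hd.le⟩).ne'
  exact hbad n h3 h2 hn1

/-- Existence comes from the symmetric branch. A competing small solution has symmetric centre data
near the critical one, so by local uniqueness in the implicit function theorem these data lie on the
branch, and they determine the field and the solution. -/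
theorem uniqueSymmetricBifurcation {κ d : ℝ} (hκ : 0 < κ) (hd : 0 < d)
    (hreg : κ * d < 1 / 100 ∨ 6 < κ * d) : UniqueSymmetricBifurcation κ d := by
  obtain ⟨g, U, hUo, hU0, hgc, hg0, hgU, hloc⟩ := exists_symmetric_branch hκ hd
  obtain ⟨δ, hδ, hsym⟩ := exists_forall_small_symmetric hκ hd hreg hloc
  obtain ⟨E, E', o, o', M⟩ := exists_criticalModes hκ hd le_rfl
  have hfield : ∀ᶠ τ in 𝓝 (0 : ℝ), τ ∈ U ∧
      |symmetricEnd κ d (g τ) 5 - criticalField κ d 0| < δ := by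
    refine (hUo.eventually_mem hU0).and ?_
    have hflow : FlowsFrom timeField (symmetricData κ d (0, criticalField κ d 0)) :=
      flowsFrom_of_zero_amplitude hκ.ne' M.field_pos.ne' hd 0 0
    obtain ⟨L, hL⟩ := hasStrictFDerivAt_endState_comp (contDiff_symmetricData κ d) hflow
    have hL : HasStrictFDerivAt (symmetricEnd κ d) L (0, criticalField κ d 0) := hL
    have h5 : symmetricEnd κ d (0, criticalField κ d 0) 5 = criticalField κ d 0 :=
      congrFun (M.endState_eq 0 0) 5
    have hc : ContinuousAt (fun τ => symmetricEnd κ d (g τ) 5) 0 :=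
      (continuous_apply 5).continuousAt.comp (ContinuousAt.comp (g := symmetricEnd κ d)
        (by rw [hg0]; exact hL.continuousAt) (hgc.continuousAt (hUo.mem_nhds hU0)))
    refine hc.eventually_mem (Metric.ball_mem_nhds _ hδ) |>.mono fun τ hτ => ?_
    rw [hg0, h5] at hτ
    exact hτ
  have hsq : Tendsto (fun α : ℝ => α ^ 2) (𝓝 0) (𝓝 0) := by
    simpa using (continuous_pow 2 (M := ℝ)).tendsto 0
  obtain ⟨r, hr, hrs⟩ := Metric.eventually_nhds_iff_ball.1 (hsq.eventually hfield)
  refine ⟨δ, hδ, min r δ, lt_min hr hδ, fun α hα => ?_⟩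
  have hα0 : 0 < α := hα.1
  obtain ⟨hαU, hαδ⟩ := hrs α (by
    rw [Metric.mem_ball, Real.dist_eq, sub_zero, abs_of_pos hα0]
    exact hα.2.trans_le (min_le_left _ _))
  have hz := hgU _ hαU
  obtain ⟨hsol, hs1, hs2⟩ := hz.isSolution hd hα0
  have hsc := hsol.isScaledSolution hd
  simp only [hs2] at hsc
  refine ⟨_, _, _, hαδ, hsc, fun x hx => ⟨?_, (hs1 x hx).2⟩, fun h' ψ' a' hh' hs' => ?_⟩
  · exact congrArg (· / α) (hs1 x hx).1
  · obtain ⟨e1, e2, e3⟩ := hsym α h' ψ' a' hα0 (hα.2.trans_le (min_le_right _ _)) hh' hs'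
    obtain ⟨f1, f2, f3, f4⟩ := hs'.symmetric_eq hd hα0 e1 e2
    have hg : (α ^ 2 * ψ' 0 ^ 2, slabDeriv d a' 0) = g (α ^ 2) := e3 f1 f2
    rw [hg] at f3 f4
    refine ⟨f3.symm, fun x hx => ?_, fun x hx => (f4 x hx).2⟩
    show ψ' x = _ / α
    rw [← (f4 x hx).1]
    field_simp

end GinzburgLandau

theorem mainTheorem4 :
    (∀ κ d : ℝ, 0 < κ → 0 < d → GinzburgLandau.SymmetricBifurcation κ d) ∧
    (∃ K : ℝ, ∀ κ d : ℝ, 0 < κ → 0 < d → K < κ * d →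
      GinzburgLandau.UniqueSymmetricBifurcation κ d) ∧
    (∃ k : ℝ, 0 < k ∧ ∀ κ d : ℝ, 0 < κ → 0 < d → κ * d < k →
      GinzburgLandau.UniqueSymmetricBifurcation κ d) ∧
    (∀ κ d : ℝ → ℝ,
      AnalyticOn ℝ κ (Set.Icc 0 1) → AnalyticOn ℝ d (Set.Icc 0 1) →
      (∀ t ∈ Set.Icc (0 : ℝ) 1, 0 < κ t ∧ 0 < d t) →
      deriv (GinzburgLandau.bifurcationIntegral (κ 0) (d 0)) 0 < 0 →
      0 < deriv (GinzburgLandau.bifurcationIntegral (κ 1) (d 1)) 0 →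
      ∃ t₀ ∈ Set.Ioo (0 : ℝ) 1, ∀ ε : ℝ, 0 < ε →
        ∃ t ∈ Set.Ioo (0 : ℝ) 1,
          |t - t₀| < ε ∧ |κ t - κ t₀| < ε ∧ |d t - d t₀| < ε ∧
          ∃ (h : ℝ) (φ a : ℝ → ℝ),
            |h - GinzburgLandau.criticalField (κ t₀) (d t₀) 0| < ε ∧
            GinzburgLandau.IsSolution (κ t) (d t) h φ a ∧
            ¬ GinzburgLandau.IsSymmetric (d t) φ a ∧
            GinzburgLandau.NearNormalState (d t)
              (GinzburgLandau.criticalField (κ t₀) (d t₀) 0) ε φ a ∧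
            GinzburgLandau.NearlySymmetric (d t) ε φ a) := by
  refine ⟨fun κ d hκ hd => GinzburgLandau.symmetricBifurcation hκ hd,
    ⟨6, fun κ d hκ hd h => GinzburgLandau.uniqueSymmetricBifurcation hκ hd (Or.inr h)⟩,
    ⟨1 / 100, by norm_num, fun κ d hκ hd h =>
      GinzburgLandau.uniqueSymmetricBifurcation hκ hd (Or.inl h)⟩,
    fun κ d hκ hd hpos hl hr => ?_⟩
  exact GinzburgLandau.exists_asymmetric_of_sign_change hκ.continuousOn hd.continuousOn hpos hl hr
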